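/- Let $c\ge 2$ be a real number, let $L\ge 8$ be an integer with $c\le 6L$, and let $C>1$, $c_1>0$, $\kappa>0$ be real constants. There is a constant $K>0$, depending only on $c,L,C,c_1,\kappa$, such that the following holds. Let $A\in\mathbb R^{n\times m}$, $m>n$, have unit-length columns $A_1,\dots,A_m$ with $|\langle A_i,A_j\rangle|\le \mu/\sqrt n$ for all $i\ne j$, where $\mu\ge 1$, and spectral norm at most $\sigma$. Let $k\ge1$ be an integer and $\tau\ge 1$. Let $\mathcal D^{(s)}_R$ be a probability distribution on vectors $\xi\in\{0,1\}^m$ with at most $k$ ones such that $\Pr[\xi_i\ne0]=k/m$ for all $i$, and $\Pr[\xi_i\neq 0\mid \xi_j\ne0\ \forall j\in S]\le \tau k/m$ whenever $i\notin S$, $|S|\le\kappa\log m$ and the conditioning event has positive probability. Let $\mathcal D^{(v)}$ be a symmetric (hence mean-zero) probability distribution on $[-C,-1]\cup[1,C]$. Let $\mathcal D^{(s)}_R\odot\mathcal D^{(v)}$ be the law of the random vector in $\mathbb R^m$ whose support is drawn from $\mathcal D^{(s)}_R$ and whose nonzero entries are then drawn independently from $\mathcal D^{(v)}$. Assume $$k\le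 \frac{n^{2/3}}{\nu(\tfrac1m,2L)\,\tau\,\mu^2},\qquad \nu(\eta,d)=c_1\Bigl(C\bigl(\sigma^2+\mu\sqrt{m/n}\bigr)\log^2(n/\eta)\Bigr)^d .$$ Let $\zeta^{(1)},\dots,\zeta^{(2L-1)}$ be independent draws from $\mathcal D^{(s)}_R\odot\mathcal D^{(v)}$, each conditioned on $\zeta^{(t)}_1>0$; let $u^{(t)}=A\zeta^{(t)}$, and let $y=Ax$ with $x\sim\mathcal D^{(s)}_R\odot\mathcal D^{(v)}$ independent of them. Put $q_1=\Pr[x_1\ne0]=k/m$ and $a_1=\mathbb E[x_1^{2L}]\prod_{t=1}^{2L-1}\zeta^{(t)}_1$. With probability at least $1-\frac1{\log^2 m}$ over $\zeta^{(1)},\dots,\zeta^{(2L-1)}$, we have $a_1\ge q_1$ and $$\mathbb E_{x}\bigl[\langle u^{(1)},y\rangle\cdots\langle u^{(2L-1)},y\rangle\, y\bigr]=a_1A_1+e_1,\qquad \|e_1\|\le K\,\frac{q_1}{\log^c m}.$$ (If the values are $\pm1$, then $a_1=q_1$.) The same holds with any other fixed column in place of column $1$. -/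

import Mathlib

open MeasureTheory ProbabilityTheory

noncomputable section

/-- The spike-and-slab model for the nonzero values: a symmetric probability distribution on
`[-C, -1] ∪ [1, C]`. (Being symmetric and bounded, it has mean zero.) -/
structure IsValueDistribution (C : ℝ) (Dv : Measure ℝ) : Prop where
  isProbabilityMeasure : IsProbabilityMeasure Dv
  symmetric : Dv.map (fun v => -v) = Dv
  supported : ∀ᵐ v ∂Dv, v ∈ Set.Icc (-C) (-1) ∪ Set.Icc 1 C

/-- A random support distribution on `{0,1}^m`: at most `k` ones, every coordinate is nonzero with
probability `k / m`, and `τ`-negative correlation,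
`P(ξ i ≠ 0 | ξ j ≠ 0 for all j ∈ S) ≤ τ k / m` for `i ∉ S` and `|S| ≤ κ log m`.
(Conditioning on a null event gives the zero measure, so such `S` impose nothing.) -/
structure IsRandomSupport {m : ℕ} (κ τ : ℝ) (k : ℕ) (Ds : Measure (Fin m → Bool)) : Prop where
  isProbabilityMeasure : IsProbabilityMeasure Ds
  sparse : ∀ᵐ ξ ∂Ds, (Finset.univ.filter fun i => ξ i = true).card ≤ k
  marginal : ∀ i, Ds.real {ξ | ξ i = true} = (k : ℝ) / m
  negCorrelated : ∀ (i : Fin m) (S : Finset (Fin m)), i ∉ S → (S.card : ℝ) ≤ κ * Real.log m →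
    (Ds[|{ξ | ∀ j ∈ S, ξ j = true}]).real {ξ | ξ i = true} ≤ τ * ((k : ℝ) / m)

/-- The law of a coefficient vector: draw a support `ξ` from `Ds` and, independently, i.i.d. values
from `Dv`, and put the values on the support. -/
def sampleLaw {m : ℕ} (Ds : Measure (Fin m → Bool)) (Dv : Measure ℝ) : Measure (Fin m → ℝ) :=
  (Ds.prod (Measure.pi fun _ : Fin m => Dv)).map fun p i => if p.1 i = true then p.2 i else 0

/-- The `i`-th column of `A`, as a Euclidean vector. -/
def dictColumn {n m : ℕ} (A : Matrix (Fin n) (Fin m) ℝ) (i : Fin m) : EuclideanSpace ℝ (Fin n) :=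
  WithLp.toLp 2 fun r => A r i

/-- The sample `∑ i, x i • A_i` with coefficient vector `x`. -/
def dictSample {n m : ℕ} (A : Matrix (Fin n) (Fin m) ℝ) (x : Fin m → ℝ) :
    EuclideanSpace ℝ (Fin n) :=
  ∑ i, x i • dictColumn A i

/-- Unit-length columns with pairwise inner products at most `μ / √n` in absolute value. -/
def IsIncoherent {n m : ℕ} (μ : ℝ) (A : Matrix (Fin n) (Fin m) ℝ) : Prop :=
  (∀ i, ‖dictColumn A i‖ = 1) ∧
    ∀ i j, i ≠ j → |inner ℝ (dictColumn A i) (dictColumn A j)| ≤ μ / √(n : ℝ)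

/-- The spectral norm, i.e. the operator norm between Euclidean spaces. -/
def dictSpectralNorm {n m : ℕ} (A : Matrix (Fin n) (Fin m) ℝ) : ℝ :=
  ‖LinearMap.toContinuousLinearMap (Matrix.toEuclideanLin A)‖

/-- `q_i`, the probability that coordinate `i` lies in the support. -/
def supportMarginal {m : ℕ} (Ds : Measure (Fin m → Bool)) (i : Fin m) : ℝ :=
  Ds.real {ξ | ξ i = true}

/-- `q_i(d) = E[x_i ^ d]`. -/
def coordMoment {m : ℕ} (Ds : Measure (Fin m → Bool)) (Dv : Measure ℝ) (i : Fin m) (d : ℕ) : ℝ :=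
  ∫ x, x i ^ d ∂(sampleLaw Ds Dv)

/-- `E[⟨u₁, y⟩ ⋯ ⟨u_N, y⟩ y]` for `u_t = A ζ_t` and a fresh sample `y = A x`; the expectation is
over `x` (support and values), for fixed `ζ`. -/
def momentStatistic {n m N : ℕ} (A : Matrix (Fin n) (Fin m) ℝ) (Ds : Measure (Fin m → Bool))
    (Dv : Measure ℝ) (ζ : Fin N → Fin m → ℝ) : EuclideanSpace ℝ (Fin n) :=
  ∫ x, (∏ t, inner ℝ (dictSample A (ζ t)) (dictSample A x)) • dictSample A x ∂(sampleLaw Ds Dv)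

/-- The law of `N` independent coefficient vectors, each conditioned on a positive coordinate `i`. -/
def sharedColumnLaw {m : ℕ} (N : ℕ) (Ds : Measure (Fin m → Bool)) (Dv : Measure ℝ) (i : Fin m) :
    Measure (Fin N → Fin m → ℝ) :=
  Measure.pi fun _ : Fin N => (sampleLaw Ds Dv)[|{x | 0 < x i}]

/-- `ν(η, d) = c₁ (C (σ² + μ √(m/n)) log²(n/η))^d`. -/
def nuFactor (c₁ C σ μ : ℝ) (n m : ℕ) (η : ℝ) (d : ℕ) : ℝ :=
  c₁ * (C * (σ ^ 2 + μ * √((m : ℝ) / n)) * Real.log (n / η) ^ 2) ^ d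

/-- The coefficient `E[x_i ^ (N + 1)] · ∏ t, ζ_t(i)` with which the column `A_i` enters the
`N`-fold moment statistic. -/
def columnCoeff {m N : ℕ} (Ds : Measure (Fin m → Bool)) (Dv : Measure ℝ) (i : Fin m)
    (ζ : Fin N → Fin m → ℝ) : ℝ :=
  coordMoment Ds Dv i (N + 1) * ∏ t, ζ t i

end

noncomputable section

set_option linter.unusedSectionVars false

/-! Write `N = 2L - 1`, `G` for the Gram matrix of the columns, `i₁` for the shared column, `q =
k/m` and `p = τk/m`. Since `⟨u_t, y⟩ = ∑ x_i (Gζ_t)_i`, expanding the product turns the statistic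
into `∑_j c_j A_j`, where `c_j` sums `E[x_j ∏ x_{φ t}] ∏ (Gζ_t)_{φ t}` over all index functions `φ`
(`integral_moment_eq`). Sign symmetry kills the moment unless every index occurs an even number of
times, the outer `x_j` included; negative correlation bounds it by `C^{2L} q p^d`, where `d` is the
number of values of `φ` other than `j`.

The index functions are of three kinds. For `j = i₁` and `φ` constantly `i₁`, the term is
`E[x_{i₁}^{2L}] ∏ (Gζ_t)_{i₁}`, and `(Gζ_t)_{i₁}` differs from `ζ_t(i₁)` by an interference with
second moment `O(pσ²)`. The spikes (`φ = i₁` except for one `j ≠ i₁`) form, over `j`, multiples of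
the correlations of one `u_t` with the columns. They are bounded without averaging, by `σ³ q p √k`
up to constants (`norm_spike_le`); the sparsity exponent `2/3` makes `p √k ≈ k^{3/2}/m` small.

All remaining terms are controlled through their second moment in `ζ`. With `D_a = E[ζ(a)² | ζ(i₁) >
0]` and `Q = G diag(D) G`, independence gives `∑_{φ,φ'} w_φ w_φ' ∏ Q(φ t, φ' t)`. For a fixed
pattern of coincidences this factors over the fibres. A fibre with value other than `j` has at least
two positions, so it contributes at most a constant times `‖Q‖_F²`, and the weights supply `p²` for
it; the fibre at `j` is odd and gives powers of `Q_jj` (`pattern_second_moment_le`). Summing over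
`j` uses the trace of `Q`, and that its entries away from `i₁` are small: incoherence controls the
conditioned coordinate, and `D_a ≤ C²p` controls the others.

Finally let `h = n^{1/3}` and `s = τk`, so that the sparsity assumption reads `ν s μ² ≤ h²`. The
`√(m/n)` inside `ν` forces `h⁵ ≥ c₁ m`, hence `h` beats every power of `log m` when `m` is large,
while `ν` beats the required powers of `σ` and `log m`. Markov's inequality for the interference and
for the remaining terms, each failing with probability at most `1/(2 log² m)`, finishes large `m`;
bounded `m` is absorbed into the constant. -/

/-- Negate the `b`-th coordinate of a vector. -/
def flipCoord {ι : Type*} [DecidableEq ι] (b : ι) (x : ι → ℝ) : ι → ℝ :=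
  fun i => if i = b then - x i else x i

/-- The properties of a law of sparse coefficient vectors that enter the moment computations:
bounded nonzero values, at most `k` of them, invariance under coordinate sign flips, coordinate
marginals `q`, and joint support probabilities of at most `r` coordinates bounded geometrically with
ratio `p`. -/
structure IsSparseSymmetric {ι : Type*} [Fintype ι] [DecidableEq ι] (C q p : ℝ) (k r : ℕ)
    (P : Measure (ι → ℝ)) : Prop where
  prob : IsProbabilityMeasure P
  range : ∀ᵐ x ∂P, ∀ i, x i = 0 ∨ (1 ≤ |x i| ∧ |x i| ≤ C)
  sparse : ∀ᵐ x ∂P, (Finset.univ.filter fun i => x i ≠ 0).card ≤ k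
  flip : ∀ b, MeasurePreserving (flipCoord b) P P
  marginal : ∀ i, P.real {x | x i ≠ 0} = q
  joint : ∀ (j : ι) (J : Finset ι), j ∉ J → J.card ≤ r →
    P.real {x | x j ≠ 0 ∧ ∀ i ∈ J, x i ≠ 0} ≤ q * p ^ J.card

/-! ### Structural properties of the coefficient law -/

section SampleLaw

variable {m : ℕ} {κ τ C : ℝ} {k : ℕ} {Ds : Measure (Fin m → Bool)} {Dv : Measure ℝ}

/-- Put the values `p.2` on the support `p.1`. -/
def maskValues (p : (Fin m → Bool) × (Fin m → ℝ)) : Fin m → ℝ :=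
  fun i => if p.1 i = true then p.2 i else 0

lemma measurable_maskValues : Measurable (maskValues (m := m)) := by
  refine measurable_pi_lambda _ fun i => ?_
  refine Measurable.ite ?_ ?_ measurable_const
  · have h : Measurable fun p : (Fin m → Bool) × (Fin m → ℝ) => p.1 i := by fun_prop
    exact h (measurableSet_singleton true)
  · fun_prop

lemma sampleLaw_eq_map :
    sampleLaw Ds Dv = (Ds.prod (Measure.pi fun _ : Fin m => Dv)).map maskValues := rfl

lemma isProbabilityMeasure_sampleLaw (hs : IsProbabilityMeasure Ds) (hv : IsProbabilityMeasure Dv) :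
    IsProbabilityMeasure (sampleLaw Ds Dv) := by
  rw [sampleLaw_eq_map]
  exact Measure.isProbabilityMeasure_map measurable_maskValues.aemeasurable

lemma measurable_flipCoord {ι : Type*} [DecidableEq ι] (b : ι) :
    Measurable (flipCoord b : (ι → ℝ) → ι → ℝ) := by
  refine measurable_pi_lambda _ fun i => ?_
  by_cases h : i = b
  · simp only [flipCoord, h, if_true]; fun_prop
  · simp only [flipCoord, h, if_false]; fun_prop

/-- Symmetry of `Dv` lets the flip act on the values alone, and it commutes with masking because `-0
= 0`. -/
lemma sampleLaw_flip [IsProbabilityMeasure Ds] (hv : IsValueDistribution C Dv) (b : Fin m) :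
    MeasurePreserving (flipCoord b) (sampleLaw Ds Dv) (sampleLaw Ds Dv) := by
  have := hv.isProbabilityMeasure
  refine ⟨measurable_flipCoord b, ?_⟩
  have h1 : MeasurePreserving (flipCoord b) (Measure.pi fun _ : Fin m => Dv)
      (Measure.pi fun _ : Fin m => Dv) := by
    have := measurePreserving_pi (fun _ : Fin m => Dv) (fun _ : Fin m => Dv)
      (f := fun i v => if i = b then -v else v) (fun i => by
        by_cases h : i = b
        · simp only [h, if_true]; exact ⟨measurable_neg, hv.symmetric⟩
        · simp only [h, if_false]; exact MeasurePreserving.id _)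
    exact this
  have h2 := (MeasurePreserving.id Ds).prod h1
  rw [sampleLaw_eq_map, Measure.map_map (measurable_flipCoord b) measurable_maskValues]
  conv_rhs => rw [← h2.map_eq, Measure.map_map measurable_maskValues h2.measurable]
  congr 1
  funext p i
  simp only [Function.comp, flipCoord, maskValues, Prod.map]
  split_ifs <;> simp_all

lemma sampleLaw_ae_of_ae (hv : IsProbabilityMeasure Dv)
    {R : (Fin m → Bool) → Prop} {S : ℝ → Prop} (hR : ∀ᵐ ξ ∂Ds, R ξ) (hS : ∀ᵐ v ∂Dv, S v) :
    ∀ᵐ p ∂(Ds.prod (Measure.pi fun _ : Fin m => Dv)), R p.1 ∧ ∀ i, S (p.2 i) := by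
  have h1 : ∀ᵐ p ∂(Ds.prod (Measure.pi fun _ : Fin m => Dv)), R p.1 :=
    Measure.quasiMeasurePreserving_fst.ae hR
  have h2 : ∀ᵐ p ∂(Ds.prod (Measure.pi fun _ : Fin m => Dv)), ∀ i, S (p.2 i) := by
    refine Measure.quasiMeasurePreserving_snd.ae (p := fun v : Fin m → ℝ => ∀ i, S (v i)) ?_
    refine ae_all_iff.2 fun i => ?_
    exact (Measure.quasiMeasurePreserving_eval (fun _ : Fin m => Dv) i).ae hS
  exact h1.and h2

lemma abs_mem_of_mem_support {v : ℝ} (hv : v ∈ Set.Icc (-C) (-1) ∪ Set.Icc 1 C) :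
    1 ≤ |v| ∧ |v| ≤ C := by
  rcases hv with ⟨h1, h2⟩ | ⟨h1, h2⟩
  · rw [abs_of_nonpos (by linarith)]; constructor <;> linarith
  · rw [abs_of_nonneg (by linarith)]; exact ⟨h1, h2⟩

lemma sampleLaw_real_preimage {S : Set (Fin m → ℝ)} (hS : MeasurableSet S) :
    (sampleLaw Ds Dv).real S =
      (Ds.prod (Measure.pi fun _ : Fin m => Dv)).real (maskValues ⁻¹' S) := by
  rw [sampleLaw_eq_map, map_measureReal_apply measurable_maskValues hS]

/-- Chain rule: start with `j` and add the indices of `J` one at a time, each at the price of a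
conditional probability `τk/m`. The conditioning set contains `j` but not the new index, so its size
never exceeds that of the enlarged `J`. -/
lemma support_joint_le (h : IsRandomSupport κ τ k Ds) (hτ : 0 ≤ τ) (j : Fin m)
    (J : Finset (Fin m)) (hj : j ∉ J) (hJ : (J.card : ℝ) ≤ κ * Real.log m) :
    Ds.real {ξ | ξ j = true ∧ ∀ i ∈ J, ξ i = true} ≤
      (k : ℝ) / m * (τ * ((k : ℝ) / m)) ^ J.card := by
  have := h.isProbabilityMeasure
  induction J using Finset.induction_on with
  | empty => simpa using (h.marginal j).le
  | insert i J hi ih =>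
    have hij : i ∉ insert j J := by
      simp only [Finset.mem_insert, not_or] at hj ⊢
      exact ⟨fun h => hj.1 h.symm, hi⟩
    have hjJ : j ∉ J := fun h => hj (Finset.mem_insert_of_mem h)
    have hcard : (insert i J).card = J.card + 1 := Finset.card_insert_of_notMem hi
    have hcard' : (insert j J).card = J.card + 1 := Finset.card_insert_of_notMem hjJ
    have ih := ih hjJ (le_trans (by rw [hcard]; push_cast; linarith) hJ)
    have hc := h.negCorrelated i (insert j J) hij (by rw [hcard', ← hcard]; exact hJ)
    have hset : {ξ : Fin m → Bool | ξ j = true ∧ ∀ i' ∈ insert i J, ξ i' = true} =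
        {ξ | ∀ j' ∈ insert j J, ξ j' = true} ∩ {ξ | ξ i = true} := by
      ext ξ; simp only [Finset.forall_mem_insert, Set.mem_ofPred_eq, Set.mem_inter_iff]; tauto
    have hset' : {ξ : Fin m → Bool | ξ j = true ∧ ∀ i' ∈ J, ξ i' = true} =
        {ξ | ∀ j' ∈ insert j J, ξ j' = true} := by
      ext ξ; simp only [Finset.forall_mem_insert, Set.mem_ofPred_eq]
    rw [hset'] at ih
    have hmul := congrArg ENNReal.toReal (cond_mul_eq_inter
      (s := {ξ : Fin m → Bool | ∀ j' ∈ insert j J, ξ j' = true}) (MeasurableSet.of_discrete)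
      {ξ | ξ i = true} Ds)
    rw [ENNReal.toReal_mul] at hmul
    rw [hset, measureReal_def, ← hmul, hcard, pow_succ]
    simp only [measureReal_def] at hc ih
    calc _ ≤ (τ * ((k : ℝ) / m)) * ((k : ℝ) / m * (τ * ((k : ℝ) / m)) ^ J.card) :=
          mul_le_mul hc ih ENNReal.toReal_nonneg (by positivity)
      _ = _ := by ring

lemma sampleLaw_isSparseSymmetric (hs : IsRandomSupport κ τ k Ds) (hv : IsValueDistribution C Dv)
    (hτ : 0 ≤ τ) {r : ℕ} (hr : (r : ℝ) ≤ κ * Real.log m) :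
    IsSparseSymmetric C ((k : ℝ) / m) (τ * ((k : ℝ) / m)) k r (sampleLaw Ds Dv) := by
  have hsp := hs.isProbabilityMeasure
  have hvp := hv.isProbabilityMeasure
  have hae := sampleLaw_ae_of_ae hvp hs.sparse hv.supported
  have hP := isProbabilityMeasure_sampleLaw hsp hvp
  -- The values have absolute value at least 1, so almost surely a coordinate vanishes only off the
  -- support.
  have hne : ∀ᵐ p ∂(Ds.prod (Measure.pi fun _ : Fin m => Dv)),
      ∀ i, (maskValues p i ≠ 0 ↔ p.1 i = true) := by
    filter_upwards [hae] with p hp i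
    have h0 : p.2 i ≠ 0 := by
      have := (abs_mem_of_mem_support (hp.2 i)).1
      intro h; rw [h, abs_zero] at this; linarith
    by_cases hi : p.1 i = true <;> simp [maskValues, hi, h0]
  refine ⟨hP, ?_, ?_, sampleLaw_flip hv, ?_, ?_⟩
  · rw [sampleLaw_eq_map, ae_map_iff measurable_maskValues.aemeasurable]
    · filter_upwards [hae] with p hp i
      by_cases hi : p.1 i = true
      · right; simpa [maskValues, hi] using abs_mem_of_mem_support (hp.2 i)
      · left; simp [maskValues, hi]
    · simp only [Set.ofPred_forall]
      refine MeasurableSet.iInter fun i => ?_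
      have : Measurable fun x : Fin m → ℝ => x i := measurable_pi_apply i
      have h2 : Measurable fun x : Fin m → ℝ => |x i| := by fun_prop
      exact (measurableSet_eq_fun this measurable_const).union
        ((measurableSet_le measurable_const h2).inter (measurableSet_le h2 measurable_const))
  · have hm : MeasurableSet {x : Fin m → ℝ | (Finset.univ.filter fun i => x i ≠ 0).card ≤ k} := by
      have : Measurable fun x : Fin m → ℝ => ∑ i, if x i ≠ 0 then (1 : ℕ) else 0 := by
        refine Finset.measurable_sum _ fun i _ => ?_
        refine Measurable.ite ?_ measurable_const measurable_const
        exact (measurableSet_eq_fun (measurable_pi_apply i) measurable_const).compl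
      simp only [Finset.card_filter]
      exact measurableSet_le this measurable_const
    rw [sampleLaw_eq_map, ae_map_iff measurable_maskValues.aemeasurable hm]
    filter_upwards [hae, hne] with p hp hp'
    simpa only [hp'] using hp.1
  · intro i
    have hm : MeasurableSet {x : Fin m → ℝ | x i ≠ 0} :=
      (measurableSet_eq_fun (measurable_pi_apply i) measurable_const).compl
    rw [sampleLaw_real_preimage hm, ← hs.marginal i]
    have : (maskValues ⁻¹' {x : Fin m → ℝ | x i ≠ 0} : Set _)
        =ᵐ[Ds.prod (Measure.pi fun _ : Fin m => Dv)] {ξ | ξ i = true} ×ˢ Set.univ := by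
      refine Filter.eventuallyEq_set.2 ?_
      filter_upwards [hne] with p hp
      simpa using hp i
    rw [measureReal_congr this, measureReal_prod_prod]
    simp
  · intro j J hj hJ
    have hm : MeasurableSet {x : Fin m → ℝ | x j ≠ 0 ∧ ∀ i ∈ J, x i ≠ 0} := by
      have h0 : ∀ i, MeasurableSet {x : Fin m → ℝ | x i ≠ 0} := fun i =>
        (measurableSet_eq_fun (measurable_pi_apply i) measurable_const).compl
      have : {x : Fin m → ℝ | x j ≠ 0 ∧ ∀ i ∈ J, x i ≠ 0} =
          {x | x j ≠ 0} ∩ ⋂ i ∈ J, {x | x i ≠ 0} := by ext; simp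
      rw [this]
      exact (h0 j).inter (Finset.measurableSet_biInter _ fun i _ => h0 i)
    rw [sampleLaw_real_preimage hm]
    have hsub : (maskValues ⁻¹' {x : Fin m → ℝ | x j ≠ 0 ∧ ∀ i ∈ J, x i ≠ 0} : Set _) ⊆
        {ξ | ξ j = true ∧ ∀ i ∈ J, ξ i = true} ×ˢ Set.univ := by
      rintro p ⟨h1, h2⟩
      have h0 : ∀ i, maskValues p i ≠ 0 → p.1 i = true := by
        intro i hi; by_contra h; exact hi (by simp [maskValues, h])
      exact ⟨⟨h0 j h1, fun i hi => h0 i (h2 i hi)⟩, trivial⟩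
    refine (measureReal_mono hsub).trans ?_
    rw [measureReal_prod_prod]
    simp only [probReal_univ, mul_one]
    exact support_joint_le hs hτ j J hj (le_trans (by exact_mod_cast hJ) hr)

end SampleLaw

/-! ### Mixed moments, conditioning on a positive coordinate, and second moments of correlations -/

section Moments

variable {ι : Type*} [Fintype ι] [DecidableEq ι]

lemma flipCoord_flipCoord (b : ι) (x : ι → ℝ) : flipCoord b (flipCoord b x) = x := by
  funext i; by_cases h : i = b <;> simp [flipCoord, h]

/-- The coordinate sign flip as a measurable equivalence. -/
def flipCoordEquiv (b : ι) : (ι → ℝ) ≃ᵐ (ι → ℝ) where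
  toFun := flipCoord b
  invFun := flipCoord b
  left_inv := flipCoord_flipCoord b
  right_inv := flipCoord_flipCoord b
  measurable_toFun := measurable_flipCoord b
  measurable_invFun := measurable_flipCoord b

/-- The integral equals its own negative. The flip is a measurable equivalence, so no integrability
is needed. -/
lemma integral_eq_zero_of_flip {P : Measure (ι → ℝ)} {b : ι}
    (hP : MeasurePreserving (flipCoord b) P P) {f : (ι → ℝ) → ℝ}
    (hf : ∀ x, f (flipCoord b x) = - f x) : ∫ x, f x ∂P = 0 := by
  have h := hP.integral_comp (flipCoordEquiv b).measurableEmbedding f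
  simp only [hf, integral_neg] at h
  linarith

/-- The mixed moment `E[x_j ∏ t, x_{φ t}]`. -/
def mixedMoment {N : ℕ} (P : Measure (ι → ℝ)) (j : ι) (φ : Fin N → ι) : ℝ :=
  ∫ x, x j * ∏ t, x (φ t) ∂P

variable {C q p : ℝ} {k r N : ℕ} {P : Measure (ι → ℝ)}

lemma IsSparseSymmetric.ae_abs_le (h : IsSparseSymmetric C q p k r P) (hC : 1 ≤ C) :
    ∀ᵐ x ∂P, ∀ i, |x i| ≤ C := by
  filter_upwards [h.range] with x hx i
  rcases hx i with h0 | h0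
  · rw [h0, abs_zero]; linarith
  · exact h0.2

lemma abs_monomial_le (hC : 1 ≤ C) {x : ι → ℝ} (hx : ∀ i, |x i| ≤ C) (j : ι) (φ : Fin N → ι) :
    |x j * ∏ t, x (φ t)| ≤ C ^ (N + 1) := by
  rw [abs_mul, Finset.abs_prod, pow_succ, mul_comm]
  refine mul_le_mul ?_ (hx j) (abs_nonneg _) (by positivity)
  calc ∏ t, |x (φ t)| ≤ ∏ _t : Fin N, C :=
        Finset.prod_le_prod (fun _ _ => abs_nonneg _) fun t _ => hx _
    _ = C ^ N := by simp

lemma IsSparseSymmetric.integrable_monomial (h : IsSparseSymmetric C q p k r P) (hC : 1 ≤ C)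
    (j : ι) (φ : Fin N → ι) : Integrable (fun x => x j * ∏ t, x (φ t)) P := by
  have := h.prob
  refine Integrable.of_bound (C := C ^ (N + 1)) ?_ ?_
  · have : Measurable fun x : ι → ℝ => x j * ∏ t, x (φ t) := by fun_prop
    exact this.aestronglyMeasurable
  · filter_upwards [h.ae_abs_le hC] with x hx
    exact abs_monomial_le hC hx j φ

/-- The monomial has odd degree in `x i`, so flipping that coordinate changes its sign. -/
lemma IsSparseSymmetric.mixedMoment_eq_zero (h : IsSparseSymmetric C q p k r P) (i j : ι)
    (φ : Fin N → ι)
    (hodd : Odd ((if j = i then 1 else 0) + (Finset.univ.filter fun t => φ t = i).card)) :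
    mixedMoment P j φ = 0 := by
  refine integral_eq_zero_of_flip (h.flip i) fun x => ?_
  have h1 : ∀ l, flipCoord i x l = (if l = i then -1 else 1) * x l := by
    intro l; by_cases hl : l = i <;> simp [flipCoord, hl]
  simp only [h1, Finset.prod_mul_distrib]
  have h2 : (if j = i then (-1 : ℝ) else 1) * ∏ t, (if φ t = i then (-1 : ℝ) else 1) = -1 := by
    have h3 : ∏ t, (if φ t = i then (-1 : ℝ) else 1)
        = (-1) ^ (Finset.univ.filter fun t => φ t = i).card := by
      rw [Finset.prod_ite]; simp
    have h4 : (if j = i then (-1 : ℝ) else 1) = (-1) ^ (if j = i then 1 else 0) := by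
      split_ifs <;> simp
    rw [h3, h4, ← pow_add, hodd.neg_one_pow]
  linear_combination (x j * ∏ t, x (φ t)) * h2

/-- The monomial is bounded and vanishes unless all its variables are in the support; repeated
variables cost nothing, so only distinct values contribute a factor `p`. -/
lemma IsSparseSymmetric.abs_mixedMoment_le (h : IsSparseSymmetric C q p k r P) (hC : 1 ≤ C)
    (j : ι) (φ : Fin N → ι) (hr : ((Finset.univ.image φ).erase j).card ≤ r) :
    |mixedMoment P j φ| ≤ C ^ (N + 1) * (q * p ^ ((Finset.univ.image φ).erase j).card) := by
  have := h.prob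
  set J := (Finset.univ.image φ).erase j with hJ
  have hm : MeasurableSet {x : ι → ℝ | x j ≠ 0 ∧ ∀ i ∈ J, x i ≠ 0} := by
    have h0 : ∀ i, MeasurableSet {x : ι → ℝ | x i ≠ 0} := fun i =>
      (measurableSet_eq_fun (measurable_pi_apply i) measurable_const).compl
    have : {x : ι → ℝ | x j ≠ 0 ∧ ∀ i ∈ J, x i ≠ 0} =
        {x | x j ≠ 0} ∩ ⋂ i ∈ J, {x | x i ≠ 0} := by ext; simp
    rw [this]
    exact (h0 j).inter (Finset.measurableSet_biInter _ fun i _ => h0 i)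
  set S := {x : ι → ℝ | x j ≠ 0 ∧ ∀ i ∈ J, x i ≠ 0} with hS
  calc |mixedMoment P j φ| ≤ ∫ x, |x j * ∏ t, x (φ t)| ∂P := abs_integral_le_integral_abs
    _ ≤ ∫ x, S.indicator (fun _ => C ^ (N + 1)) x ∂P := by
        refine integral_mono_ae (h.integrable_monomial hC j φ).abs
          ((integrable_const _).indicator hm) ?_
        filter_upwards [h.ae_abs_le hC] with x hx
        by_cases hxS : x ∈ S
        · rw [Set.indicator_of_mem hxS]; exact abs_monomial_le hC hx j φ
        · rw [Set.indicator_of_notMem hxS]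
          have : x j * ∏ t, x (φ t) = 0 := by
            by_contra hne
            refine hxS ⟨left_ne_zero_of_mul hne, fun i hi => ?_⟩
            obtain ⟨t, -, rfl⟩ := Finset.mem_image.1 (Finset.mem_of_mem_erase hi)
            exact Finset.prod_ne_zero_iff.1 (right_ne_zero_of_mul hne) t (Finset.mem_univ _)
          simp [this]
    _ = C ^ (N + 1) * P.real S := by
        rw [integral_indicator_const _ hm, smul_eq_mul, mul_comm]
    _ ≤ _ := by
        refine mul_le_mul_of_nonneg_left ?_ (by positivity)
        exact h.joint j J (Finset.notMem_erase _ _) hr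

/-- The law conditioned on a positive coordinate. -/
def condPos (P : Measure (ι → ℝ)) (i : ι) : Measure (ι → ℝ) := P[|{x | 0 < x i}]

lemma measurableSet_pos (i : ι) : MeasurableSet {x : ι → ℝ | 0 < x i} :=
  measurableSet_lt measurable_const (measurable_pi_apply i)

/-- The flip at `i` exchanges `x i > 0` and `x i < 0` within `S`. Hence, for flip-invariant events,
conditioning on `x i > 0` is the same as conditioning on `x i ≠ 0`, for which the joint support
bounds are available. -/
lemma IsSparseSymmetric.real_pos_inter (h : IsSparseSymmetric C q p k r P) (i : ι)
    {S : Set (ι → ℝ)} (hS : MeasurableSet S) (hinv : ∀ x, flipCoord i x ∈ S ↔ x ∈ S) :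
    P.real ({x | 0 < x i} ∩ S) = P.real ({x | x i ≠ 0} ∩ S) / 2 := by
  have := h.prob
  have h1 : P.real ({x | x i < 0} ∩ S) = P.real ({x | 0 < x i} ∩ S) := by
    have hpre : flipCoord i ⁻¹' ({x | 0 < x i} ∩ S) = {x | x i < 0} ∩ S := by
      ext x
      have : flipCoord i x i = - x i := by simp [flipCoord]
      simp [hinv, this]
    rw [← hpre]
    exact congrArg ENNReal.toReal
      ((h.flip i).measure_preimage ((measurableSet_pos i).inter hS).nullMeasurableSet)
  have h2 : {x : ι → ℝ | x i ≠ 0} ∩ S = ({x | 0 < x i} ∩ S) ∪ ({x | x i < 0} ∩ S) := by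
    ext x
    simp only [Set.mem_inter_iff, Set.mem_union, Set.mem_ofPred_eq, ne_iff_lt_or_gt]
    tauto
  have hneg : MeasurableSet {x : ι → ℝ | x i < 0} :=
    measurableSet_lt (measurable_pi_apply i) measurable_const
  rw [h2, measureReal_union _ (hneg.inter hS), h1]
  · ring
  · rw [Set.disjoint_left]
    rintro x ⟨hx, -⟩ ⟨hx', -⟩
    simp only [Set.mem_ofPred_eq] at hx hx'
    linarith

lemma IsSparseSymmetric.real_pos (h : IsSparseSymmetric C q p k r P) (i : ι) :
    P.real {x | 0 < x i} = q / 2 := by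
  have := h.real_pos_inter i MeasurableSet.univ (by simp)
  simpa [h.marginal i] using this

lemma IsSparseSymmetric.prob_condPos (h : IsSparseSymmetric C q p k r P) (hq : 0 < q) (i : ι) :
    IsProbabilityMeasure (condPos P i) := by
  have := h.prob
  refine cond_isProbabilityMeasure fun h0 => ?_
  have := h.real_pos i
  rw [measureReal_def, h0] at this
  simp at this; linarith

lemma condPos_ae {i : ι} {R : (ι → ℝ) → Prop} (hR : ∀ᵐ x ∂P, R x) : ∀ᵐ x ∂condPos P i, R x :=
  cond_absolutelyContinuous.ae_le hR

lemma IsSparseSymmetric.condPos_flip (h : IsSparseSymmetric C q p k r P) {i b : ι} (hb : b ≠ i) :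
    MeasurePreserving (flipCoord b) (condPos P i) (condPos P i) := by
  have hpre : flipCoord b ⁻¹' {x : ι → ℝ | 0 < x i} = {x | 0 < x i} := by
    ext x; simp [flipCoord, hb.symm]
  have h1 := (h.flip b).restrict_preimage (measurableSet_pos i)
  rw [hpre] at h1
  exact h1.smul_measure _

/-- The conditional second moment of coordinate `a` given that coordinate `i` is positive. -/
def condSecondMoment (P : Measure (ι → ℝ)) (i a : ι) : ℝ := ∫ x, x a ^ 2 ∂condPos P i

lemma condSecondMoment_nonneg (i a : ι) : 0 ≤ condSecondMoment P i a :=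
  integral_nonneg fun _ => sq_nonneg _

lemma IsSparseSymmetric.integrable_condPos (h : IsSparseSymmetric C q p k r P) (hC : 1 ≤ C)
    (hq : 0 < q) (i a b : ι) : Integrable (fun x => x a * x b) (condPos P i) := by
  have := h.prob_condPos hq i
  refine Integrable.of_bound (C := C * C) ?_ ?_
  · have : Measurable fun x : ι → ℝ => x a * x b := by fun_prop
    exact this.aestronglyMeasurable
  · filter_upwards [condPos_ae (h.ae_abs_le hC)] with x hx
    rw [Real.norm_eq_abs, abs_mul]
    exact mul_le_mul (hx a) (hx b) (abs_nonneg _) (by linarith)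

lemma IsSparseSymmetric.condSecondMoment_le (h : IsSparseSymmetric C q p k r P) (hC : 1 ≤ C)
    (hq : 0 < q) (i a : ι) : condSecondMoment P i a ≤ C ^ 2 := by
  have := h.prob_condPos hq i
  have h1 : condSecondMoment P i a ≤ ∫ _x, C ^ 2 ∂condPos P i := by
    refine integral_mono_ae ?_ (integrable_const _) ?_
    · simpa only [sq] using h.integrable_condPos hC hq i a a
    · filter_upwards [condPos_ae (h.ae_abs_le hC)] with x hx
      have := sq_le_sq' (by linarith [abs_le.1 (hx a)]) (abs_le.1 (hx a)).2
      exact this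
  simpa using h1

/-- Given `x i > 0`, another coordinate is in the support with probability at most `p`: the factor
`q / 2` cancels between the joint probability and the conditioning event. -/
lemma IsSparseSymmetric.condSecondMoment_le_of_ne (h : IsSparseSymmetric C q p k r P)
    (hC : 1 ≤ C) (hq : 0 < q) (hr : 1 ≤ r) {i a : ι} (ha : a ≠ i) :
    condSecondMoment P i a ≤ C ^ 2 * p := by
  have := h.prob
  have := h.prob_condPos hq i
  have hm : MeasurableSet {x : ι → ℝ | x a ≠ 0} :=
    (measurableSet_eq_fun (measurable_pi_apply a) measurable_const).compl
  have h1 : condSecondMoment P i a ≤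
      ∫ x, {x : ι → ℝ | x a ≠ 0}.indicator (fun _ => C ^ 2) x ∂condPos P i := by
    refine integral_mono_ae ?_ ((integrable_const _).indicator hm) ?_
    · simpa only [sq] using h.integrable_condPos hC hq i a a
    · filter_upwards [condPos_ae (h.ae_abs_le hC)] with x hx
      by_cases hxS : x ∈ {x : ι → ℝ | x a ≠ 0}
      · rw [Set.indicator_of_mem hxS]
        exact sq_le_sq' (by linarith [abs_le.1 (hx a)]) (abs_le.1 (hx a)).2
      · rw [Set.indicator_of_notMem hxS]
        have : x a = 0 := by simpa using hxS
        simp [this]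
  rw [integral_indicator_const _ hm, smul_eq_mul] at h1
  have h2 : (condPos P i).real {x | x a ≠ 0} ≤ p := by
    have h3 := congrArg ENNReal.toReal
      (cond_mul_eq_inter (measurableSet_pos i) {x : ι → ℝ | x a ≠ 0} P)
    rw [ENNReal.toReal_mul] at h3
    have h4 := h.real_pos_inter i hm (fun x => by simp [flipCoord, ha])
    have h5 := h.joint i {a} (by simpa using ha.symm) (by simpa using hr)
    have h6 : {x : ι → ℝ | x i ≠ 0 ∧ ∀ l ∈ ({a} : Finset ι), x l ≠ 0}
        = {x | x i ≠ 0} ∩ {x | x a ≠ 0} := by ext; simp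
    rw [h6] at h5
    simp only [Finset.card_singleton, pow_one] at h5
    have h7 := h.real_pos i
    simp only [measureReal_def] at h4 h5 h7 ⊢
    rw [h4, h7] at h3
    change (condPos P i {x | x a ≠ 0}).toReal * (q / 2) = _ at h3
    nlinarith
  nlinarith [sq_nonneg C]

lemma IsSparseSymmetric.integral_condPos_mul (h : IsSparseSymmetric C q p k r P) (i a b : ι) :
    ∫ x, x a * x b ∂condPos P i = if a = b then condSecondMoment P i a else 0 := by
  by_cases hab : a = b
  · subst hab; simp [condSecondMoment, sq]
  · rw [if_neg hab]
    -- Of two distinct indices at least one differs from `i`; flipping that one preserves the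
    -- conditioned law and negates the product.
    by_cases ha : a = i
    · refine integral_eq_zero_of_flip (h.condPos_flip (i := i) (b := b) ?_) fun x => ?_
      · rw [← ha]; exact fun h => hab h.symm
      · simp [flipCoord, hab]
    · refine integral_eq_zero_of_flip (h.condPos_flip (i := i) (b := a) ha) fun x => ?_
      simp [flipCoord, Ne.symm hab]

/-- The image of a coefficient vector under the transpose of the matrix `G`. -/
def correlate (G : ι → ι → ℝ) (x : ι → ℝ) (i : ι) : ℝ := ∑ b, x b * G b i

/-- The entries of `Gᵀ diag(D) G`. -/
def weightedGram (G : ι → ι → ℝ) (D : ι → ℝ) (i i' : ι) : ℝ := ∑ a, D a * (G a i * G a i')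

lemma correlate_mul_correlate (G G' : ι → ι → ℝ) (x : ι → ℝ) (i i' : ι) :
    correlate G x i * correlate G' x i' = ∑ a, ∑ b, x a * x b * (G a i * G' b i') := by
  rw [correlate, correlate, Finset.sum_mul_sum]
  exact Finset.sum_congr rfl fun a _ => Finset.sum_congr rfl fun b _ => by ring

lemma IsSparseSymmetric.integrable_correlate_mul (h : IsSparseSymmetric C q p k r P) (hC : 1 ≤ C)
    (hq : 0 < q) (G : ι → ι → ℝ) (i₁ i i' : ι) :
    Integrable (fun x => correlate G x i * correlate G x i') (condPos P i₁) := by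
  simp only [correlate_mul_correlate]
  exact integrable_finsetSum _ fun a _ => integrable_finsetSum _ fun b _ =>
    (h.integrable_condPos hC hq i₁ a b).mul_const _

lemma IsSparseSymmetric.integral_correlate_mul (h : IsSparseSymmetric C q p k r P) (hC : 1 ≤ C)
    (hq : 0 < q) (G : ι → ι → ℝ) (i₁ i i' : ι) :
    ∫ x, correlate G x i * correlate G x i' ∂condPos P i₁ =
      weightedGram G (condSecondMoment P i₁) i i' := by
  simp only [correlate_mul_correlate]
  rw [integral_finsetSum _ fun a _ => integrable_finsetSum _ fun b _ =>
    (h.integrable_condPos hC hq i₁ a b).mul_const _]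
  refine Finset.sum_congr rfl fun a _ => ?_
  rw [integral_finsetSum _ fun b _ => (h.integrable_condPos hC hq i₁ a b).mul_const _]
  simp only [integral_mul_const, h.integral_condPos_mul, ite_mul, zero_mul, Finset.sum_ite_eq,
    Finset.mem_univ, if_true]

lemma IsSparseSymmetric.integrable_prod_correlate (h : IsSparseSymmetric C q p k r P) (hC : 1 ≤ C)
    (hq : 0 < q) (G : ι → ι → ℝ) (i₁ : ι) (φ φ' : Fin N → ι) :
    Integrable (fun ζ : Fin N → ι → ℝ =>
      (∏ t, correlate G (ζ t) (φ t)) * ∏ t, correlate G (ζ t) (φ' t))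
      (Measure.pi fun _ : Fin N => condPos P i₁) := by
  have := h.prob_condPos hq i₁
  simp only [← Finset.prod_mul_distrib]
  exact Integrable.fintype_prod (f := fun t x => correlate G x (φ t) * correlate G x (φ' t))
    fun t => h.integrable_correlate_mul hC hq G i₁ _ _

lemma sq_sum_mul_eq {α : Type*} (Φ : Finset α) (w f : α → ℝ) :
    (∑ φ ∈ Φ, w φ * f φ) ^ 2 = ∑ φ ∈ Φ, ∑ φ' ∈ Φ, w φ * w φ' * (f φ * f φ') := by
  rw [sq, Finset.sum_mul_sum]
  exact Finset.sum_congr rfl fun a _ => Finset.sum_congr rfl fun b _ => by ring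

lemma IsSparseSymmetric.integrable_sq_sum (h : IsSparseSymmetric C q p k r P) (hC : 1 ≤ C)
    (hq : 0 < q) (G : ι → ι → ℝ) (i₁ : ι) (Φ : Finset (Fin N → ι)) (w : (Fin N → ι) → ℝ) :
    Integrable (fun ζ : Fin N → ι → ℝ => (∑ φ ∈ Φ, w φ * ∏ t, correlate G (ζ t) (φ t)) ^ 2)
      (Measure.pi fun _ : Fin N => condPos P i₁) := by
  simp only [sq_sum_mul_eq]
  exact integrable_finsetSum _ fun φ _ => integrable_finsetSum _ fun φ' _ =>
    (h.integrable_prod_correlate hC hq G i₁ φ φ').const_mul _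

/-- Expanding the square gives pairs of index functions; independence of the samples makes each pair
a product over `t`, and sign symmetry leaves only the diagonal weights in each factor. -/
lemma IsSparseSymmetric.integral_sq_sum (h : IsSparseSymmetric C q p k r P) (hC : 1 ≤ C)
    (hq : 0 < q) (G : ι → ι → ℝ) (i₁ : ι) (Φ : Finset (Fin N → ι)) (w : (Fin N → ι) → ℝ) :
    ∫ ζ : Fin N → ι → ℝ, (∑ φ ∈ Φ, w φ * ∏ t, correlate G (ζ t) (φ t)) ^ 2
      ∂(Measure.pi fun _ : Fin N => condPos P i₁) =
      ∑ φ ∈ Φ, ∑ φ' ∈ Φ, w φ * w φ' *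
        ∏ t, weightedGram G (condSecondMoment P i₁) (φ t) (φ' t) := by
  have := h.prob_condPos hq i₁
  have hi := fun φ φ' : Fin N → ι => h.integrable_prod_correlate hC hq G i₁ φ φ'
  simp only [sq_sum_mul_eq]
  rw [integral_finsetSum _ fun φ _ => integrable_finsetSum _ fun φ' _ => (hi φ φ').const_mul _]
  refine Finset.sum_congr rfl fun φ _ => ?_
  rw [integral_finsetSum _ fun φ' _ => (hi φ φ').const_mul _]
  refine Finset.sum_congr rfl fun φ' _ => ?_
  rw [integral_const_mul]
  congr 1
  simp only [← Finset.prod_mul_distrib]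
  rw [integral_fintype_prod_eq_prod
    (f := fun t x => correlate G x (φ t) * correlate G x (φ' t))]
  exact Finset.prod_congr rfl fun t _ => h.integral_correlate_mul hC hq G i₁ _ _

end Moments

/-! ### Second moments of sums over index functions with a fixed coincidence pattern -/

section Patterns

variable {ι : Type*} [DecidableEq ι] {N : ℕ}

lemma prod_abs_eq_of_pattern (Q : ι → ι → ℝ) {j : ι} {s : Fin N → Fin N} {B : Finset (Fin N)}
    {φ φ' : Fin N → ι} (hB : ∀ t ∈ B, φ t = j) (hB' : ∀ t ∈ B, φ' t = j)
    (hs : ∀ t ∉ B, φ t = φ (s t)) (hs' : ∀ t ∉ B, φ' t = φ' (s t)) :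
    ∏ t, |Q (φ t) (φ' t)| = |Q j j| ^ B.card * ∏ ρ ∈ Bᶜ.image s,
      |Q (φ ρ) (φ' ρ)| ^ (Bᶜ.filter fun t => s t = ρ).card := by
  rw [← Finset.prod_mul_prod_compl B, ← Finset.prod_comp (fun ρ => |Q (φ ρ) (φ' ρ)|) s]
  congr 1
  · rw [← Finset.prod_const]
    exact Finset.prod_congr rfl fun t ht => by rw [hB t ht, hB' t ht]
  · refine Finset.prod_congr rfl fun t ht => ?_
    have ht := Finset.mem_compl.1 ht
    rw [← hs t ht, ← hs' t ht]

/-- Sums over index functions that are constant on the fibres of `s` (and equal to `j` on `B`)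
factor, up to an inequality, over these fibres. -/
lemma sum_prod_abs_le_of_pattern (Q : ι → ι → ℝ) {j : ι} {s : Fin N → Fin N} {B : Finset (Fin N)}
    {I : Finset ι} {Φ : Finset (Fin N → ι)} (hB : ∀ φ ∈ Φ, ∀ t ∈ B, φ t = j)
    (hs : ∀ φ ∈ Φ, ∀ t ∉ B, φ t = φ (s t)) (hI : ∀ φ ∈ Φ, ∀ t ∉ B, φ t ∈ I) :
    ∑ φ ∈ Φ, ∑ φ' ∈ Φ, ∏ t, |Q (φ t) (φ' t)| ≤ |Q j j| ^ B.card * ∏ ρ ∈ Bᶜ.image s,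
      ∑ i ∈ I, ∑ i' ∈ I, |Q i i'| ^ (Bᶜ.filter fun t => s t = ρ).card := by
  classical
  set R := Bᶜ.image s with hR
  set b : Fin N → ℕ := fun ρ => (Bᶜ.filter fun t => s t = ρ).card with hb
  let F : (R → ι × ι) → ℝ := fun x => ∏ ρ : R, |Q (x ρ).1 (x ρ).2| ^ b ρ
  -- A pair of index functions is determined by its values at the representatives. Letting these
  -- values range freely over `I` drops the requirement that different fibres have different values,
  -- which only adds nonnegative terms.
  let e : (Fin N → ι) × (Fin N → ι) → (R → ι × ι) := fun x ρ => (x.1 ρ, x.2 ρ)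
  have hmemR : ∀ t ∉ B, s t ∈ R := fun t ht =>
    Finset.mem_image_of_mem _ (Finset.mem_compl.2 ht)
  have hinj : Set.InjOn e (Φ ×ˢ Φ : Finset _) := by
    rintro ⟨φ, φ'⟩ hx ⟨ψ, ψ'⟩ hy hxy
    simp only [Finset.coe_product, Set.mem_prod, Finset.mem_coe] at hx hy
    have h1 : ∀ ρ : R, φ ρ = ψ ρ := fun ρ => congrArg Prod.fst (congrFun hxy ρ)
    have h2 : ∀ ρ : R, φ' ρ = ψ' ρ := fun ρ => congrArg Prod.snd (congrFun hxy ρ)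
    refine Prod.ext (funext fun t => ?_) (funext fun t => ?_)
    · by_cases ht : t ∈ B
      · exact (hB φ hx.1 t ht).trans (hB ψ hy.1 t ht).symm
      · exact (hs φ hx.1 t ht).trans ((h1 ⟨s t, hmemR t ht⟩).trans (hs ψ hy.1 t ht).symm)
    · by_cases ht : t ∈ B
      · exact (hB φ' hx.2 t ht).trans (hB ψ' hy.2 t ht).symm
      · exact (hs φ' hx.2 t ht).trans ((h2 ⟨s t, hmemR t ht⟩).trans (hs ψ' hy.2 t ht).symm)
  have hmaps : (Φ ×ˢ Φ).image e ⊆ Fintype.piFinset fun _ : R => I ×ˢ I := by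
    intro x hx
    obtain ⟨⟨φ, φ'⟩, hφ, rfl⟩ := Finset.mem_image.1 hx
    have hφ := Finset.mem_product.1 hφ
    refine Fintype.mem_piFinset.2 fun ρ => ?_
    obtain ⟨t, ht, hρ⟩ := Finset.mem_image.1 ρ.2
    have ht := Finset.mem_compl.1 ht
    refine Finset.mem_product.2 ⟨?_, ?_⟩
    · change φ ρ ∈ I
      rw [← hρ, ← hs φ hφ.1 t ht]; exact hI φ hφ.1 t ht
    · change φ' ρ ∈ I
      rw [← hρ, ← hs φ' hφ.2 t ht]; exact hI φ' hφ.2 t ht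
  have hF : ∀ x, 0 ≤ F x := fun x => Finset.prod_nonneg fun _ _ => by positivity
  calc ∑ φ ∈ Φ, ∑ φ' ∈ Φ, ∏ t, |Q (φ t) (φ' t)|
      = ∑ x ∈ Φ ×ˢ Φ, |Q j j| ^ B.card * F (e x) := by
        rw [Finset.sum_product]
        refine Finset.sum_congr rfl fun φ hφ => Finset.sum_congr rfl fun φ' hφ' => ?_
        rw [prod_abs_eq_of_pattern Q (hB φ hφ) (hB φ' hφ') (hs φ hφ) (hs φ' hφ')]
        congr 1
        exact (Finset.prod_coe_sort R fun ρ => |Q (φ ρ) (φ' ρ)| ^ b ρ).symm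
    _ = |Q j j| ^ B.card * ∑ x ∈ (Φ ×ˢ Φ).image e, F x := by
        rw [Finset.sum_image hinj, Finset.mul_sum]
    _ ≤ |Q j j| ^ B.card * ∑ x ∈ Fintype.piFinset (fun _ : R => I ×ˢ I), F x := by
        refine mul_le_mul_of_nonneg_left ?_ (by positivity)
        exact Finset.sum_le_sum_of_subset_of_nonneg hmaps fun x _ _ => hF x
    _ = _ := by
        congr 1
        have := Finset.prod_univ_sum (fun _ : R => I ×ˢ I)
          (fun (ρ : R) (y : ι × ι) => |Q y.1 y.2| ^ b ρ)
        rw [← this, ← Finset.prod_coe_sort R]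
        exact Finset.prod_congr rfl fun ρ _ => Finset.sum_product _ _ _

lemma sum_abs_pow_le {Q : ι → ι → ℝ} {I : Finset ι} {M : ℝ}
    (hM : ∀ i ∈ I, ∀ i' ∈ I, |Q i i'| ≤ M) {b : ℕ} (hb : 2 ≤ b) :
    ∑ i ∈ I, ∑ i' ∈ I, |Q i i'| ^ b ≤ M ^ (b - 2) * ∑ i ∈ I, ∑ i' ∈ I, Q i i' ^ 2 := by
  simp only [Finset.mul_sum]
  refine Finset.sum_le_sum fun i hi => Finset.sum_le_sum fun i' hi' => ?_
  obtain ⟨d, rfl⟩ := Nat.exists_eq_add_of_le' hb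
  rw [pow_add, sq_abs, Nat.add_sub_cancel]
  exact mul_le_mul_of_nonneg_right (pow_le_pow_left₀ (abs_nonneg _) (hM i hi i' hi') _)
    (sq_nonneg _)

lemma sum_weight_le {Q : ι → ι → ℝ} {Φ : Finset (Fin N → ι)} {w : (Fin N → ι) → ℝ} {W : ℝ}
    (hw : ∀ φ ∈ Φ, |w φ| ≤ W) :
    ∑ φ ∈ Φ, ∑ φ' ∈ Φ, w φ * w φ' * ∏ t, Q (φ t) (φ' t) ≤
      W ^ 2 * ∑ φ ∈ Φ, ∑ φ' ∈ Φ, ∏ t, |Q (φ t) (φ' t)| := by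
  simp only [Finset.mul_sum]
  refine Finset.sum_le_sum fun φ hφ => Finset.sum_le_sum fun φ' hφ' => ?_
  refine (le_abs_self _).trans ?_
  rw [abs_mul, abs_mul, Finset.abs_prod, sq]
  refine mul_le_mul_of_nonneg_right ?_ (Finset.prod_nonneg fun _ _ => abs_nonneg _)
  exact mul_le_mul (hw φ hφ) (hw φ' hφ') (abs_nonneg _) ((abs_nonneg _).trans (hw φ hφ))

/-- A chosen representative of the fibre of `φ` through `t`. -/
def fibreRep (φ : Fin N → ι) (t : Fin N) : Fin N :=
  have : Nonempty (Fin N) := ⟨t⟩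
  Function.invFun φ (φ t)

lemma apply_fibreRep (φ : Fin N → ι) (t : Fin N) : φ (fibreRep φ t) = φ t :=
  have : Nonempty (Fin N) := ⟨t⟩
  Function.invFun_eq ⟨t, rfl⟩

lemma fibreRep_congr {φ : Fin N → ι} {s t : Fin N} (h : φ s = φ t) :
    fibreRep φ s = fibreRep φ t := by
  simp only [fibreRep, h]

/-- The positions at which `φ` takes the value `j`. -/
def fibreAt (j : ι) (φ : Fin N → ι) : Finset (Fin N) := Finset.univ.filter fun t => φ t = j

lemma mem_fibreAt {j : ι} {φ : Fin N → ι} {t : Fin N} : t ∈ fibreAt j φ ↔ φ t = j := by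
  simp [fibreAt]

lemma fibre_card_eq {j : ι} {φ : Fin N → ι} {t : Fin N} (ht : φ t ≠ j) :
    ((fibreAt j φ)ᶜ.filter fun u => fibreRep φ u = fibreRep φ t).card =
      (fibreAt (φ t) φ).card := by
  congr 1
  ext u
  simp only [Finset.mem_filter, Finset.mem_compl, mem_fibreAt]
  constructor
  · rintro ⟨-, h⟩
    rw [← apply_fibreRep φ u, h, apply_fibreRep φ t]
  · intro h
    exact ⟨by rwa [h], fibreRep_congr h⟩

/-- Identifies the number of free fibres of the pattern with the exponent of `p` in the weight
bound. -/
lemma card_image_fibreRep (j : ι) (φ : Fin N → ι) :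
    ((fibreAt j φ)ᶜ.image (fibreRep φ)).card = ((Finset.univ.image φ).erase j).card := by
  rw [← Finset.card_image_of_injOn (f := φ) (s := (fibreAt j φ)ᶜ.image (fibreRep φ))]
  · congr 1
    ext i
    simp only [Finset.image_image, Finset.mem_image, Finset.mem_compl, mem_fibreAt,
      Finset.mem_erase, Finset.mem_univ, true_and, Function.comp, apply_fibreRep]
    constructor
    · rintro ⟨t, ht, rfl⟩; exact ⟨ht, t, rfl⟩
    · rintro ⟨hi, t, rfl⟩; exact ⟨t, hi, rfl⟩
  · intro a ha b hb hab
    obtain ⟨t, -, rfl⟩ := Finset.mem_image.1 ha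
    obtain ⟨u, -, rfl⟩ := Finset.mem_image.1 hb
    simp only [apply_fibreRep] at hab
    exact fibreRep_congr hab

/-- The index functions that are neither constantly `j`, nor equal to `i₁ ≠ j` except at a single
position, where they equal `j`. -/
def IsGeneric (i₁ j : ι) (φ : Fin N → ι) : Prop :=
  (∃ t, φ t ≠ j) ∧ ¬ (j ≠ i₁ ∧ ∃ t₀, φ t₀ = j ∧ ∀ t, t ≠ t₀ → φ t = i₁)

/-- The weights of index functions: zero unless every value is attained an even number of times
(the value `j` being counted once more), and bounded by `W * p ^ d`, where `d` is the number of
values different from `j`. -/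
structure IsEvenWeight (W p : ℝ) (r : ℕ) (j : ι) (w : (Fin N → ι) → ℝ) : Prop where
  even_of_ne_zero : ∀ φ, w φ ≠ 0 → ∀ i,
    Even ((if j = i then 1 else 0) + (fibreAt i φ).card)
  abs_le : ∀ φ, ((Finset.univ.image φ).erase j).card ≤ r →
    |w φ| ≤ W * p ^ ((Finset.univ.image φ).erase j).card

variable [Fintype ι]

/-- The three summands are the three shapes of a pattern. With `ρ = p²‖Q‖_F²`: two or more free
fibres give `ρ² Q_jj`; one free fibre with at least three positions at `j` gives `ρ Q_jj³`; one free
fibre with a single position at `j` gives `ρ δ² Q_jj`, because genericity then keeps the free value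
away from `i₁`. -/
lemma pattern_second_moment_le {Q : ι → ι → ℝ} {i₁ j : ι} {W p M δ : ℝ} {r : ℕ}
    (hN : N = 2 * r + 1) (hr : 2 ≤ r) (hM : 1 ≤ M) (hδ0 : 0 ≤ δ) (hδ1 : δ ≤ 1)
    (hQM : ∀ i i', |Q i i'| ≤ M) (hQδ : ∀ i i', i ≠ i₁ → i' ≠ i₁ → |Q i i'| ≤ δ)
    (hQj : 0 ≤ Q j j) (hρ : p ^ 2 * ∑ i, ∑ i', Q i i' ^ 2 ≤ 1) {w : (Fin N → ι) → ℝ}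
    (hw : IsEvenWeight W p r j w) {s : Fin N → Fin N} {B : Finset (Fin N)}
    {Φ : Finset (Fin N → ι)}
    (hΦ : ∀ φ ∈ Φ, w φ ≠ 0 ∧ IsGeneric i₁ j φ ∧ fibreRep φ = s ∧ fibreAt j φ = B) :
    ∑ φ ∈ Φ, ∑ φ' ∈ Φ, w φ * w φ' * ∏ t, Q (φ t) (φ' t) ≤
      W ^ 2 * M ^ (N * (N + 1)) *
        ((p ^ 2 * ∑ i, ∑ i', Q i i' ^ 2) ^ 2 * Q j j +
          (p ^ 2 * ∑ i, ∑ i', Q i i' ^ 2) * Q j j ^ 3 +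
          (p ^ 2 * ∑ i, ∑ i', Q i i' ^ 2) * δ ^ 2 * Q j j) := by
  set F := ∑ i, ∑ i', Q i i' ^ 2 with hF
  have hF0 : 0 ≤ F := Finset.sum_nonneg fun _ _ => Finset.sum_nonneg fun _ _ => sq_nonneg _
  have hρ0 : 0 ≤ p ^ 2 * F := by positivity
  have hMpos : 0 < M := by linarith
  rcases Φ.eq_empty_or_nonempty with rfl | ⟨φ₀, hφ₀⟩
  · simp only [Finset.sum_empty]; positivity
  obtain ⟨hw0, hgen0, hs0, hB0⟩ := hΦ φ₀ hφ₀
  set R := Bᶜ.image s with hR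
  set b : Fin N → ℕ := fun ρ => (Bᶜ.filter fun t => s t = ρ).card with hb
  have hcard : ∀ φ ∈ Φ, ((Finset.univ.image φ).erase j).card = R.card := by
    intro φ hφ
    obtain ⟨-, -, hs, hB⟩ := hΦ φ hφ
    rw [← card_image_fibreRep, hs, hB]
  -- A free fibre is nonempty and has even size, since `w φ₀ ≠ 0`.
  have hb2 : ∀ ρ ∈ R, 2 ≤ b ρ := by
    intro ρ hρ
    obtain ⟨t, ht, rfl⟩ := Finset.mem_image.1 hρ
    rw [← hB0, Finset.mem_compl, mem_fibreAt] at ht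
    have h1 : b (s t) = (fibreAt (φ₀ t) φ₀).card := by
      rw [hb, ← hB0, ← hs0]; exact fibre_card_eq ht
    have h2 := hw.even_of_ne_zero φ₀ hw0 (φ₀ t)
    rw [if_neg (Ne.symm ht), zero_add, ← h1] at h2
    have h3 : 0 < b (s t) := by
      rw [h1]; exact Finset.card_pos.2 ⟨t, mem_fibreAt.2 rfl⟩
    obtain ⟨c, hc⟩ := h2
    omega
  -- At `j` the parity condition also counts the factor `x j`, so the fibre itself is odd and in
  -- particular nonempty.
  have hBodd : Odd B.card := by
    have h2 := hw.even_of_ne_zero φ₀ hw0 j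
    rw [if_pos rfl, hB0] at h2
    obtain ⟨c, hc⟩ := h2
    exact ⟨c - 1, by omega⟩
  have hBpos : 1 ≤ B.card := hBodd.pos
  have hsum : ∑ ρ ∈ R, b ρ = Bᶜ.card :=
    (Finset.card_eq_sum_card_image s Bᶜ).symm
  have hcompl : Bᶜ.card = N - B.card := by rw [Finset.card_compl, Fintype.card_fin]
  have hBN : B.card ≤ N := by simpa using Finset.card_le_univ B
  have hRle : 2 * R.card ≤ Bᶜ.card := by
    rw [← hsum, mul_comm, ← smul_eq_mul]
    exact Finset.card_nsmul_le_sum R b 2 hb2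
  -- Free fibres take at least two positions each and leave one for `j`, so `2 |R| ≤ N - 1 = 2r`;
  -- this is why joint bounds for `r` further coordinates suffice.
  have hRr : R.card ≤ r := by omega
  have hRN : R.card ≤ N := by omega
  have hR0 : 1 ≤ R.card := by
    obtain ⟨t, ht⟩ := hgen0.1
    refine Finset.card_pos.2 ⟨s t, Finset.mem_image_of_mem _ ?_⟩
    rw [Finset.mem_compl, ← hB0, mem_fibreAt]; exact ht
  have hwΦ : ∀ φ ∈ Φ, |w φ| ≤ W * p ^ R.card := by
    intro φ hφ
    have := hw.abs_le φ (by rw [hcard φ hφ]; exact hRr)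
    rwa [hcard φ hφ] at this
  have hΦB : ∀ φ ∈ Φ, ∀ t ∈ B, φ t = j := by
    intro φ hφ t ht
    obtain ⟨-, -, -, hB⟩ := hΦ φ hφ
    rw [← hB] at ht; exact mem_fibreAt.1 ht
  have hΦs : ∀ φ ∈ Φ, ∀ t ∉ B, φ t = φ (s t) := by
    intro φ hφ t _
    obtain ⟨-, -, hs, -⟩ := hΦ φ hφ
    rw [← hs, apply_fibreRep φ t]
  have hmain : ∀ I : Finset ι, (∀ φ ∈ Φ, ∀ t ∉ B, φ t ∈ I) →
      ∑ φ ∈ Φ, ∑ φ' ∈ Φ, w φ * w φ' * ∏ t, Q (φ t) (φ' t) ≤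
        (W * p ^ R.card) ^ 2 * (Q j j ^ B.card * ∏ ρ ∈ R, ∑ i ∈ I, ∑ i' ∈ I, |Q i i'| ^ b ρ) := by
    intro I hI
    refine (sum_weight_le hwΦ).trans (mul_le_mul_of_nonneg_left ?_ (sq_nonneg _))
    have := sum_prod_abs_le_of_pattern Q hΦB hΦs hI
    rwa [abs_of_nonneg hQj] at this
  have hQjM : Q j j ≤ M := (le_abs_self _).trans (hQM j j)
  have hfac : ∀ ρ ∈ R, ∑ i, ∑ i', |Q i i'| ^ b ρ ≤ M ^ N * F := by
    intro ρ hρ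
    refine (sum_abs_pow_le (fun i _ i' _ => hQM i i') (hb2 ρ hρ)).trans
      (mul_le_mul_of_nonneg_right (pow_le_pow_right₀ hM ?_) hF0)
    have h1 : b ρ ≤ Bᶜ.card := Finset.card_filter_le _ _
    omega
  have hprod : ∏ ρ ∈ R, ∑ i, ∑ i', |Q i i'| ^ b ρ ≤ (M ^ N * F) ^ R.card := by
    rw [← Finset.prod_const]
    exact Finset.prod_le_prod (fun ρ _ => Finset.sum_nonneg fun _ _ =>
      Finset.sum_nonneg fun _ _ => by positivity) hfac
  have hpowB : ∀ d, d ≤ B.card → Q j j ^ B.card ≤ M ^ N * Q j j ^ d := by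
    intro d hd
    obtain ⟨e, he⟩ := Nat.exists_eq_add_of_le' hd
    rw [he, pow_add]
    refine mul_le_mul_of_nonneg_right ?_ (by positivity)
    exact (pow_le_pow_left₀ hQj hQjM e).trans (pow_le_pow_right₀ hM (by omega))
  have hgenbound : ∀ d, d ≤ B.card →
      ∑ φ ∈ Φ, ∑ φ' ∈ Φ, w φ * w φ' * ∏ t, Q (φ t) (φ' t) ≤
        W ^ 2 * M ^ (N * (N + 1)) * ((p ^ 2 * F) ^ R.card * Q j j ^ d) := by
    intro d hd
    refine (hmain Finset.univ (fun _ _ _ _ => Finset.mem_univ _)).trans ?_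
    calc (W * p ^ R.card) ^ 2 * (Q j j ^ B.card * ∏ ρ ∈ R, ∑ i, ∑ i', |Q i i'| ^ b ρ)
        ≤ (W * p ^ R.card) ^ 2 * (M ^ N * Q j j ^ d * (M ^ N * F) ^ R.card) := by
          refine mul_le_mul_of_nonneg_left ?_ (sq_nonneg _)
          refine mul_le_mul (hpowB d hd) hprod ?_ (by positivity)
          exact Finset.prod_nonneg fun ρ _ => Finset.sum_nonneg fun _ _ =>
            Finset.sum_nonneg fun _ _ => by positivity
      _ = W ^ 2 * M ^ (N * (R.card + 1)) * ((p ^ 2 * F) ^ R.card * Q j j ^ d) := by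
          ring
      _ ≤ _ := by
          refine mul_le_mul_of_nonneg_right ?_ (by positivity)
          refine mul_le_mul_of_nonneg_left (pow_le_pow_right₀ hM ?_) (sq_nonneg _)
          exact Nat.mul_le_mul_left _ (by omega)
  have hWM : 0 ≤ W ^ 2 * M ^ (N * (N + 1)) := by positivity
  rcases Nat.lt_or_ge 1 R.card with hR2 | hR1
  · refine (hgenbound 1 hBpos).trans (mul_le_mul_of_nonneg_left ?_ hWM)
    rw [pow_one]
    have : (p ^ 2 * F) ^ R.card * Q j j ≤ (p ^ 2 * F) ^ 2 * Q j j :=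
      mul_le_mul_of_nonneg_right (pow_le_pow_of_le_one hρ0 hρ hR2) hQj
    have h2 : 0 ≤ p ^ 2 * F * Q j j ^ 3 := by positivity
    have h3 : 0 ≤ p ^ 2 * F * δ ^ 2 * Q j j := by positivity
    linarith
  have hR1 : R.card = 1 := le_antisymm hR1 hR0
  have h1 : 0 ≤ (p ^ 2 * F) ^ 2 * Q j j := by positivity
  have h2 : 0 ≤ p ^ 2 * F * Q j j ^ 3 := by positivity
  have h3 : 0 ≤ p ^ 2 * F * δ ^ 2 * Q j j := by positivity
  rcases Nat.lt_or_ge 2 B.card with hB3 | hB2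
  · refine (hgenbound 3 hB3).trans (mul_le_mul_of_nonneg_left ?_ hWM)
    rw [hR1, pow_one]
    linarith
  have hB1 : B.card = 1 := by
    obtain ⟨c, hc⟩ := hBodd; omega
  obtain ⟨t₀, ht₀⟩ := Finset.card_eq_one.1 hB1
  obtain ⟨ρ₀, hρ₀⟩ := Finset.card_eq_one.1 hR1
  have hsρ : ∀ t ∉ B, s t = ρ₀ := by
    intro t ht
    have : s t ∈ R := Finset.mem_image_of_mem _ (Finset.mem_compl.2 ht)
    rwa [hρ₀, Finset.mem_singleton] at this
  -- If the single free value were `i₁`, the index function would be an excluded spike.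
  have hI : ∀ φ ∈ Φ, ∀ t ∉ B, φ t ∈ Finset.univ.erase i₁ := by
    intro φ hφ t ht
    refine Finset.mem_erase.2 ⟨fun hti => ?_, Finset.mem_univ _⟩
    obtain ⟨-, hgen, -, hB⟩ := hΦ φ hφ
    refine hgen.2 ⟨?_, t₀, ?_, ?_⟩
    · rintro rfl
      exact ht (by rw [← hB]; exact mem_fibreAt.2 hti)
    · exact hΦB φ hφ t₀ (by simp [ht₀])
    · intro u hu
      have huB : u ∉ B := by rw [ht₀, Finset.mem_singleton]; exact hu
      rw [hΦs φ hφ u huB, hsρ u huB, ← hsρ t ht, ← hΦs φ hφ t ht, hti]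
  refine (hmain _ hI).trans ?_
  -- The free fibre has `N - 1 = 2r ≥ 4` positions; two are spent on `Q²` and at least two remain
  -- for `δ²`.
  have hbρ : b ρ₀ = N - 1 := by
    rw [hρ₀, Finset.sum_singleton] at hsum
    omega
  have hfac : ∑ i ∈ Finset.univ.erase i₁, ∑ i' ∈ Finset.univ.erase i₁, |Q i i'| ^ b ρ₀ ≤
      δ ^ 2 * F := by
    have h4 := sum_abs_pow_le (Q := Q) (I := Finset.univ.erase i₁) (M := δ)
      (fun i hi i' hi' => hQδ i i' (Finset.ne_of_mem_erase hi) (Finset.ne_of_mem_erase hi'))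
      (hb2 ρ₀ (by simp [hρ₀]))
    refine h4.trans (mul_le_mul (pow_le_pow_of_le_one hδ0 hδ1 (by omega)) ?_ ?_ (by positivity))
    · refine (Finset.sum_le_sum_of_subset_of_nonneg (Finset.erase_subset _ _)
        fun _ _ _ => Finset.sum_nonneg fun _ _ => sq_nonneg _).trans ?_
      exact Finset.sum_le_sum fun i _ => Finset.sum_le_sum_of_subset_of_nonneg
        (Finset.erase_subset _ _) fun _ _ _ => sq_nonneg _
    · exact Finset.sum_nonneg fun _ _ => Finset.sum_nonneg fun _ _ => sq_nonneg _
  rw [hR1, hB1, hρ₀, Finset.prod_singleton, pow_one (Q j j)]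
  calc (W * p ^ (1 : ℕ)) ^ 2 * (Q j j * _) ≤ (W * p ^ (1 : ℕ)) ^ 2 * (Q j j * (δ ^ 2 * F)) := by
        gcongr
    _ = W ^ 2 * 1 * (p ^ 2 * F * δ ^ 2 * Q j j) := by ring
    _ ≤ W ^ 2 * M ^ (N * (N + 1)) * (p ^ 2 * F * δ ^ 2 * Q j j) := by
        gcongr
        exact one_le_pow₀ hM
    _ ≤ _ := by
        refine mul_le_mul_of_nonneg_left ?_ hWM
        linarith

end Patterns

/-! ### Second moment of the generic coefficient -/

section Generic

variable {ι : Type*} [DecidableEq ι] [Fintype ι] {N : ℕ}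

lemma IsSparseSymmetric.isEvenWeight {C q p : ℝ} {k r : ℕ} {P : Measure (ι → ℝ)}
    (h : IsSparseSymmetric C q p k r P) (hC : 1 ≤ C) (j : ι) :
    IsEvenWeight (N := N) (C ^ (N + 1) * q) p r j (mixedMoment P j) where
  even_of_ne_zero φ hφ i := by
    by_contra hodd
    exact hφ (h.mixedMoment_eq_zero i j φ (Nat.not_even_iff_odd.1 hodd))
  abs_le φ hφ := by
    rw [mul_assoc]; exact h.abs_mixedMoment_le hC j φ hφ

open Classical in
/-- The contribution of the generic index functions to the coefficient of the `j`-th column. -/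
def genericCoeff (w : (Fin N → ι) → ℝ) (G : ι → ι → ℝ) (i₁ j : ι) (ζ : Fin N → ι → ℝ) : ℝ :=
  ∑ φ ∈ Finset.univ.filter fun φ : Fin N → ι => IsGeneric i₁ j φ,
    w φ * ∏ t, correlate G (ζ t) (φ t)

/-- The number of fibre patterns of index functions. -/
def patternCount (N : ℕ) : ℕ := Fintype.card ((Fin N → Fin N) × Finset (Fin N))

-- Split by pattern, discarding vanishing weights, and apply Cauchy–Schwarz. The number of patterns
-- depends on `N` only, not on the dimension.
open Classical in
lemma genericCoeff_sq_le (w : (Fin N → ι) → ℝ) (G : ι → ι → ℝ) (i₁ j : ι) (ζ : Fin N → ι → ℝ) :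
    genericCoeff w G i₁ j ζ ^ 2 ≤ patternCount N *
      ∑ c : (Fin N → Fin N) × Finset (Fin N), (∑ φ ∈ Finset.univ.filter fun φ : Fin N → ι =>
        w φ ≠ 0 ∧ IsGeneric i₁ j φ ∧ fibreRep φ = c.1 ∧ fibreAt j φ = c.2,
          w φ * ∏ t, correlate G (ζ t) (φ t)) ^ 2 := by
  have h1 : genericCoeff w G i₁ j ζ =
      ∑ c : (Fin N → Fin N) × Finset (Fin N), ∑ φ ∈ Finset.univ.filter fun φ : Fin N → ι =>
        w φ ≠ 0 ∧ IsGeneric i₁ j φ ∧ fibreRep φ = c.1 ∧ fibreAt j φ = c.2,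
          w φ * ∏ t, correlate G (ζ t) (φ t) := by
    rw [genericCoeff, ← Finset.sum_fiberwise _ fun φ => (fibreRep φ, fibreAt j φ)]
    refine Finset.sum_congr rfl fun c _ => ?_
    symm
    refine Finset.sum_subset ?_ ?_
    · intro φ hφ
      simp only [Finset.mem_filter, Finset.mem_univ, true_and] at hφ ⊢
      exact ⟨hφ.2.1, Prod.ext hφ.2.2.1 hφ.2.2.2⟩
    · intro φ hφ hφ'
      simp only [Finset.mem_filter, Finset.mem_univ, true_and, not_and] at hφ hφ'
      have : w φ = 0 := by
        by_contra hne
        exact hφ' hne hφ.1 (congrArg Prod.fst hφ.2) (congrArg Prod.snd hφ.2)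
      rw [this, zero_mul]
  rw [h1]
  exact sq_sum_le_card_mul_sum_sq

lemma IsSparseSymmetric.integrable_genericCoeff_sq {C q p : ℝ} {k r : ℕ} {P : Measure (ι → ℝ)}
    (h : IsSparseSymmetric C q p k r P) (hC : 1 ≤ C) (hq : 0 < q) (w : (Fin N → ι) → ℝ)
    (G : ι → ι → ℝ) (i₁ j : ι) :
    Integrable (fun ζ => genericCoeff w G i₁ j ζ ^ 2)
      (Measure.pi fun _ : Fin N => condPos P i₁) :=
  h.integrable_sq_sum hC hq G i₁ _ _

lemma IsSparseSymmetric.integral_genericCoeff_sq_le {C q p : ℝ} {k r : ℕ} {P : Measure (ι → ℝ)}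
    (h : IsSparseSymmetric C q p k r P) (hC : 1 ≤ C) (hq : 0 < q) {G : ι → ι → ℝ} {i₁ j : ι}
    {Q : ι → ι → ℝ} (hQ : Q = weightedGram G (condSecondMoment P i₁)) {M δ : ℝ}
    (hN : N = 2 * r + 1) (hr : 2 ≤ r) (hM : 1 ≤ M) (hδ0 : 0 ≤ δ) (hδ1 : δ ≤ 1)
    (hQM : ∀ i i', |Q i i'| ≤ M) (hQδ : ∀ i i', i ≠ i₁ → i' ≠ i₁ → |Q i i'| ≤ δ)
    (hQj : 0 ≤ Q j j) (hρ : p ^ 2 * ∑ i, ∑ i', Q i i' ^ 2 ≤ 1) :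
    ∫ ζ, genericCoeff (mixedMoment P j) G i₁ j ζ ^ 2
        ∂(Measure.pi fun _ : Fin N => condPos P i₁) ≤
      (patternCount N : ℝ) ^ 2 * ((C ^ (N + 1) * q) ^ 2 * M ^ (N * (N + 1)) *
        ((p ^ 2 * ∑ i, ∑ i', Q i i' ^ 2) ^ 2 * Q j j +
          (p ^ 2 * ∑ i, ∑ i', Q i i' ^ 2) * Q j j ^ 3 +
          (p ^ 2 * ∑ i, ∑ i', Q i i' ^ 2) * δ ^ 2 * Q j j)) := by
  classical
  have hi := fun Φ => h.integrable_sq_sum (N := N) hC hq G i₁ Φ (mixedMoment P j)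
  refine (integral_mono (h.integrable_genericCoeff_sq hC hq _ G i₁ j)
    ((integrable_finsetSum _ fun c _ => hi _).const_mul _)
    (fun ζ => genericCoeff_sq_le (mixedMoment P j) G i₁ j ζ)).trans ?_
  -- One factor `patternCount N` comes from Cauchy–Schwarz, the other from adding up the uniform
  -- bound over the patterns.
  rw [integral_const_mul, integral_finsetSum _ fun c _ => hi _, sq (patternCount N : ℝ), mul_assoc]
  refine mul_le_mul_of_nonneg_left ?_ (Nat.cast_nonneg _)
  rw [patternCount, ← nsmul_eq_mul, Fintype.card]
  refine Finset.sum_le_card_nsmul _ _ _ fun c _ => ?_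
  rw [h.integral_sq_sum hC hq, ← hQ]
  exact pattern_second_moment_le hN hr hM hδ0 hδ1 hQM hQδ hQj hρ (h.isEvenWeight hC j)
    fun φ hφ => (Finset.mem_filter.1 hφ).2

end Generic

/-! ### Entry, trace and Frobenius bounds for the weighted Gram matrix -/

section Gram

variable {ι : Type*} [DecidableEq ι] [Fintype ι] {E : Type*} [NormedAddCommGroup E]
  [InnerProductSpace ℝ E] {a : ι → E} {σ : ℝ}

/-- The Gram matrix of a family of vectors. -/
def gramEntry (a : ι → E) (i j : ι) : ℝ := inner ℝ (a i) (a j)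

lemma gramEntry_comm (i j : ι) : gramEntry a i j = gramEntry a j i := real_inner_comm _ _

lemma correlate_gramEntry (x : ι → ℝ) (i : ι) :
    correlate (gramEntry a) x i = inner ℝ (∑ b, x b • a b) (a i) := by
  simp [correlate, gramEntry, sum_inner, real_inner_smul_left]

/-- The adjoint has the same operator norm: the left side `S` is the inner product of `y` with `∑
⟨y, a_i⟩ a_i`, whose norm is at most `σ √S`. -/
lemma sum_inner_sq_le (hσ : ∀ v : ι → ℝ, ‖∑ i, v i • a i‖ ^ 2 ≤ σ ^ 2 * ∑ i, v i ^ 2) (y : E) :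
    ∑ i, inner ℝ y (a i) ^ 2 ≤ σ ^ 2 * ‖y‖ ^ 2 := by
  set S := ∑ i, inner ℝ y (a i) ^ 2 with hS
  have hS0 : 0 ≤ S := Finset.sum_nonneg fun _ _ => sq_nonneg _
  have h1 : S = inner ℝ y (∑ i, inner ℝ y (a i) • a i) := by
    rw [inner_sum, hS]
    exact Finset.sum_congr rfl fun i _ => by rw [real_inner_smul_right, sq]
  have h2 := hσ fun i => inner ℝ y (a i)
  rw [← hS] at h2
  have h3 : S ^ 2 ≤ ‖y‖ ^ 2 * (σ ^ 2 * S) := by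
    calc S ^ 2 ≤ (‖y‖ * ‖∑ i, inner ℝ y (a i) • a i‖) ^ 2 := by
          refine pow_le_pow_left₀ hS0 ?_ 2
          conv_lhs => rw [h1]
          exact real_inner_le_norm _ _
      _ = ‖y‖ ^ 2 * ‖∑ i, inner ℝ y (a i) • a i‖ ^ 2 := by ring
      _ ≤ _ := mul_le_mul_of_nonneg_left h2 (sq_nonneg _)
  rcases hS0.eq_or_lt with h0 | h0
  · rw [← h0]; positivity
  · nlinarith

/-- The entries of the square of the Gram matrix. -/
def gramSq (a : ι → E) (b c : ι) : ℝ := ∑ i, gramEntry a b i * gramEntry a c i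

variable (ha : ∀ i, ‖a i‖ = 1)
  (hσ : ∀ v : ι → ℝ, ‖∑ i, v i • a i‖ ^ 2 ≤ σ ^ 2 * ∑ i, v i ^ 2)
include ha hσ

lemma sum_gramEntry_sq_le (i : ι) : ∑ j, gramEntry a j i ^ 2 ≤ σ ^ 2 := by
  have := sum_inner_sq_le hσ (a i)
  simp only [ha, one_pow, mul_one] at this
  simp only [gramEntry_comm (a := a) _ i]
  exact this

lemma gramSq_self_le (i : ι) : gramSq a i i ≤ σ ^ 2 := by
  have := sum_gramEntry_sq_le ha hσ i
  simp only [gramEntry_comm (a := a) _ i] at this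
  simpa only [gramSq, ← sq] using this

lemma gramSq_self_nonneg (i : ι) : 0 ≤ gramSq a i i :=
  Finset.sum_nonneg fun _ _ => mul_self_nonneg _

/-- A row of `G²` is `AᵀAAᵀa_b`: three applications of an operator of norm at most `σ` to a unit
vector. -/
lemma sum_gramSq_sq_le (b : ι) : ∑ c, gramSq a b c ^ 2 ≤ σ ^ 6 := by
  set y := ∑ i, gramEntry a b i • a i with hy
  have h1 : ∀ c, gramSq a b c = inner ℝ y (a c) := by
    intro c
    rw [hy, sum_inner]
    refine Finset.sum_congr rfl fun i _ => ?_
    rw [real_inner_smul_left, gramEntry_comm c i]; rfl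
  simp only [h1]
  have h2 := sum_inner_sq_le hσ y
  have h3 := hσ (gramEntry a b)
  have h4 := sum_gramEntry_sq_le ha hσ b
  simp only [gramEntry_comm (a := a) _ b] at h4
  calc _ ≤ σ ^ 2 * ‖y‖ ^ 2 := h2
    _ ≤ σ ^ 2 * (σ ^ 2 * σ ^ 2) := by
        refine mul_le_mul_of_nonneg_left (h3.trans ?_) (sq_nonneg _)
        exact mul_le_mul_of_nonneg_left h4 (sq_nonneg _)
    _ = _ := by ring

variable {D : ι → ℝ} {i₁ : ι} {c p : ℝ} (hD0 : ∀ i, 0 ≤ D i) (hc : 0 ≤ c) (hp : 0 ≤ p)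
  (hD1 : ∀ i, D i ≤ c) (hD : ∀ i, i ≠ i₁ → D i ≤ c * p)
include hD0 hc hp hD1 hD

/-- Majorizing `D` by a spike at `i₁` plus a flat level `p` separates the conditioned coordinate
from the bulk in all the bounds below. -/
lemma weight_le (i : ι) : D i ≤ c * ((if i = i₁ then 1 else 0) + p) := by
  by_cases h : i = i₁
  · rw [if_pos h]; have := hD1 i; nlinarith [mul_nonneg hc hp]
  · rw [if_neg h, zero_add]; exact hD i h

lemma weightedGram_self_nonneg (i : ι) : 0 ≤ weightedGram (gramEntry a) D i i :=
  Finset.sum_nonneg fun _ _ => mul_nonneg (hD0 _) (mul_self_nonneg _)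

lemma weightedGram_self_le (i : ι) :
    weightedGram (gramEntry a) D i i ≤ c * (gramEntry a i₁ i ^ 2 + p * σ ^ 2) := by
  have h1 := sum_gramEntry_sq_le ha hσ i
  calc weightedGram (gramEntry a) D i i
      ≤ ∑ b, c * ((if b = i₁ then 1 else 0) + p) * (gramEntry a b i * gramEntry a b i) :=
        Finset.sum_le_sum fun b _ => mul_le_mul_of_nonneg_right
          (weight_le ha hσ hD0 hc hp hD1 hD b) (mul_self_nonneg _)
    _ = c * (gramEntry a i₁ i ^ 2 + p * ∑ b, gramEntry a b i ^ 2) := by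
        simp only [mul_add, add_mul, Finset.sum_add_distrib, Finset.mul_sum, sq]
        congr 1
        · simp
        · exact Finset.sum_congr rfl fun b _ => by ring
    _ ≤ _ := by gcongr

lemma abs_weightedGram_le (i i' : ι) : |weightedGram (gramEntry a) D i i'| ≤
    (weightedGram (gramEntry a) D i i + weightedGram (gramEntry a) D i' i') / 2 := by
  rw [weightedGram, weightedGram, weightedGram, ← Finset.sum_add_distrib, Finset.sum_div]
  refine (Finset.abs_sum_le_sum_abs _ _).trans (Finset.sum_le_sum fun b _ => ?_)
  rw [abs_mul, abs_of_nonneg (hD0 b), ← mul_add, mul_div_assoc]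
  refine mul_le_mul_of_nonneg_left ?_ (hD0 b)
  rw [abs_le]
  constructor <;> nlinarith [sq_nonneg (gramEntry a b i - gramEntry a b i'),
    sq_nonneg (gramEntry a b i + gramEntry a b i')]

lemma sum_weight_le_card : ∑ i, D i ≤ c * (1 + p * Fintype.card ι) := by
  refine (Finset.sum_le_sum fun i _ => weight_le ha hσ hD0 hc hp hD1 hD i).trans (le_of_eq ?_)
  rw [← Finset.mul_sum, Finset.sum_add_distrib]
  simp [mul_comm]

lemma sum_weightedGram_self_le :
    ∑ i, weightedGram (gramEntry a) D i i ≤ c * (1 + p * Fintype.card ι) * σ ^ 2 := by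
  simp only [weightedGram]
  rw [Finset.sum_comm]
  calc ∑ b, ∑ i, D b * (gramEntry a b i * gramEntry a b i) = ∑ b, D b * gramSq a b b :=
        Finset.sum_congr rfl fun b _ => by rw [gramSq, Finset.mul_sum]
    _ ≤ ∑ b, D b * σ ^ 2 := Finset.sum_le_sum fun b _ =>
        mul_le_mul_of_nonneg_left (gramSq_self_le ha hσ b) (hD0 b)
    _ = (∑ b, D b) * σ ^ 2 := (Finset.sum_mul _ _ _).symm
    _ ≤ _ := mul_le_mul_of_nonneg_right (sum_weight_le_card ha hσ hD0 hc hp hD1 hD) (sq_nonneg _)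

/-- Exchanging sums gives `‖GDG‖_F² = ∑ D_b D_d (G²)_{bd}²`. With `D` replaced by spike plus flat
part, the spike–spike term is `(G²)_{i₁i₁}²`, each of the two mixed terms is one row of `G²`, and
the flat–flat term is all rows. -/
lemma sum_weightedGram_sq_le : ∑ i, ∑ i', weightedGram (gramEntry a) D i i' ^ 2 ≤
    c ^ 2 * (σ ^ 4 + 2 * p * σ ^ 6 + p ^ 2 * Fintype.card ι * σ ^ 6) := by
  have h1 : ∑ i, ∑ i', weightedGram (gramEntry a) D i i' ^ 2 =
      ∑ b, ∑ d, D b * D d * gramSq a b d ^ 2 := by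
    have h2 : ∀ i i', weightedGram (gramEntry a) D i i' ^ 2 = ∑ b, ∑ d, D b * D d *
        (gramEntry a b i * gramEntry a d i * (gramEntry a b i' * gramEntry a d i')) := by
      intro i i'
      rw [weightedGram, sq, Finset.sum_mul_sum]
      exact Finset.sum_congr rfl fun b _ => Finset.sum_congr rfl fun d _ => by ring
    simp only [h2]
    have h3 : ∀ b d, D b * D d * gramSq a b d ^ 2 = ∑ i, ∑ i', D b * D d *
        (gramEntry a b i * gramEntry a d i * (gramEntry a b i' * gramEntry a d i')) := by
      intro b d
      rw [gramSq, sq, Finset.sum_mul_sum, Finset.mul_sum]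
      exact Finset.sum_congr rfl fun i _ => by rw [Finset.mul_sum]
    simp only [h3]
    calc _ = ∑ i, ∑ b, ∑ d, ∑ i', D b * D d *
        (gramEntry a b i * gramEntry a d i * (gramEntry a b i' * gramEntry a d i')) := by
          refine Finset.sum_congr rfl fun i _ => ?_
          rw [Finset.sum_comm]
          exact Finset.sum_congr rfl fun b _ => Finset.sum_comm
      _ = _ := by
          rw [Finset.sum_comm]
          exact Finset.sum_congr rfl fun b _ => Finset.sum_comm
  rw [h1]
  have hw := weight_le ha hσ hD0 hc hp hD1 hD
  have hs := sum_gramSq_sq_le ha hσ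
  set e : ι → ℝ := fun i => if i = i₁ then 1 else 0 with he
  have hσ6 : (0 : ℝ) ≤ σ ^ 6 := by positivity
  have hcomm : ∀ b d, gramSq a b d = gramSq a d b := fun b d =>
    Finset.sum_congr rfl fun i _ => mul_comm _ _
  calc ∑ b, ∑ d, D b * D d * gramSq a b d ^ 2
      ≤ ∑ b, ∑ d, c * (e b + p) * (c * (e d + p)) * gramSq a b d ^ 2 := by
        refine Finset.sum_le_sum fun b _ => Finset.sum_le_sum fun d _ =>
          mul_le_mul_of_nonneg_right ?_ (sq_nonneg _)
        exact mul_le_mul (hw b) (hw d) (hD0 d) ((hD0 b).trans (hw b))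
    _ = c ^ 2 * (∑ b, e b * ∑ d, e d * gramSq a b d ^ 2 + p * ∑ b, e b * ∑ d, gramSq a b d ^ 2
          + p * ∑ d, e d * ∑ b, gramSq a d b ^ 2 + p ^ 2 * ∑ b, ∑ d, gramSq a b d ^ 2) := by
        have h4 : ∑ d, e d * ∑ b, gramSq a d b ^ 2 = ∑ b, ∑ d, e d * gramSq a b d ^ 2 := by
          rw [Finset.sum_comm]
          exact Finset.sum_congr rfl fun d _ => by
            rw [Finset.mul_sum]; exact Finset.sum_congr rfl fun b _ => by rw [hcomm]
        nth_rewrite 2 [h4]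
        simp only [Finset.mul_sum, ← Finset.sum_add_distrib]
        exact Finset.sum_congr rfl fun b _ => Finset.sum_congr rfl fun d _ => by ring
    _ ≤ c ^ 2 * (σ ^ 4 + p * σ ^ 6 + p * σ ^ 6 + p ^ 2 * (Fintype.card ι * σ ^ 6)) := by
        have h5 : ∑ b, e b * ∑ d, e d * gramSq a b d ^ 2 = gramSq a i₁ i₁ ^ 2 := by simp [he]
        have h6 : ∑ b, e b * ∑ d, gramSq a b d ^ 2 = ∑ d, gramSq a i₁ d ^ 2 := by simp [he]
        have h7 : ∑ b, ∑ d, gramSq a b d ^ 2 ≤ Fintype.card ι * σ ^ 6 := by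
          refine (Finset.sum_le_card_nsmul _ _ _ fun b _ => hs b).trans (le_of_eq ?_)
          rw [nsmul_eq_mul]; rfl
        have h8 : gramSq a i₁ i₁ ^ 2 ≤ σ ^ 4 := by
          have := pow_le_pow_left₀ (gramSq_self_nonneg ha hσ i₁) (gramSq_self_le ha hσ i₁) 2
          calc _ ≤ _ := this
            _ = _ := by ring
        rw [h5, h6]
        have := hs i₁
        gcongr
    _ = _ := by ring

end Gram

/-! ### Expansion of the statistic into main, spike and tail terms -/

section Decomposition

variable {ι : Type*} [DecidableEq ι] [Fintype ι] {N : ℕ}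

/-- The index function equal to `j` at `t₀` and to `i₁` elsewhere. -/
def spikeIndex (i₁ j : ι) (t₀ : Fin N) : Fin N → ι := Function.update (fun _ => i₁) t₀ j

lemma spikeIndex_self (i₁ j : ι) (t₀ : Fin N) : spikeIndex i₁ j t₀ t₀ = j := by
  simp [spikeIndex]

lemma spikeIndex_of_ne (i₁ j : ι) {t₀ t : Fin N} (h : t ≠ t₀) : spikeIndex i₁ j t₀ t = i₁ := by
  simp [spikeIndex, h]

open Classical in
lemma sum_eq_const_add_spike_add_generic (hN : 2 ≤ N) (i₁ j : ι) (f : (Fin N → ι) → ℝ) :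
    ∑ φ, f φ = f (fun _ => j) + (if j = i₁ then 0 else ∑ t₀, f (spikeIndex i₁ j t₀)) +
      ∑ φ ∈ Finset.univ.filter fun φ : Fin N → ι => IsGeneric i₁ j φ, f φ := by
  have hnt : Nontrivial (Fin N) := Fin.nontrivial_iff_two_le.2 hN
  rw [← Finset.sum_filter_add_sum_filter_not Finset.univ (fun φ : Fin N → ι => IsGeneric i₁ j φ) f,
    add_comm]
  congr 1
  by_cases hj : j = i₁
  · rw [if_pos hj, add_zero, ← Finset.sum_singleton f (fun _ => j)]
    refine Finset.sum_congr ?_ fun _ _ => rfl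
    ext φ
    simp only [Finset.mem_filter, Finset.mem_univ, true_and, Finset.mem_singleton, IsGeneric,
      hj, ne_eq, not_true_eq_false, false_and, not_false_eq_true, and_true, not_exists, not_not]
    exact ⟨fun h => funext h, fun h t => congrFun h t⟩
  · rw [if_neg hj]
    have hinj : Function.Injective (spikeIndex (N := N) i₁ j) := by
      intro s t hst
      by_contra hne
      have h1 := congrFun hst s
      rw [spikeIndex_self, spikeIndex_of_ne _ _ hne] at h1
      exact hj h1
    have hset : (Finset.univ.filter fun φ : Fin N → ι => ¬ IsGeneric i₁ j φ) =
        insert (fun _ => j) (Finset.univ.image (spikeIndex i₁ j)) := by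
      ext φ
      simp only [Finset.mem_filter, Finset.mem_univ, true_and, Finset.mem_insert,
        Finset.mem_image]
      rw [IsGeneric, not_and_or, not_not, not_exists]
      refine or_congr ⟨fun h => funext fun t => not_not.1 (h t),
        fun h t => not_not.2 (congrFun h t)⟩ ⟨?_, ?_⟩
      · rintro ⟨-, t₀, h0, h1⟩
        refine ⟨t₀, funext fun t => ?_⟩
        by_cases ht : t = t₀
        · rw [ht, spikeIndex_self, h0]
        · rw [spikeIndex_of_ne _ _ ht, h1 t ht]
      · rintro ⟨t₀, rfl⟩
        exact ⟨hj, t₀, spikeIndex_self _ _ _, fun t ht => spikeIndex_of_ne _ _ ht⟩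
    rw [hset, Finset.sum_insert, Finset.sum_image fun _ _ _ _ h => hinj h]
    intro hmem
    obtain ⟨t₀, -, h⟩ := Finset.mem_image.1 hmem
    obtain ⟨t, ht⟩ := exists_ne t₀
    have := congrFun h t
    rw [spikeIndex_of_ne _ _ ht] at this
    exact hj this.symm

/-- The coefficient of the `j`-th column outside the main term and the spike terms. -/
def tailCoeff (P : Measure (ι → ℝ)) (G : ι → ι → ℝ) (i₁ j : ι) (ζ : Fin N → ι → ℝ) : ℝ :=
  genericCoeff (mixedMoment P j) G i₁ j ζ +
    if j = i₁ then 0 else mixedMoment P j (fun _ : Fin N => j) * ∏ t, correlate G (ζ t) j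

/-- The coefficient of the `j`-th column contributed by the index function with a spike at `t₀`. -/
def spikeCoeff (P : Measure (ι → ℝ)) (G : ι → ι → ℝ) (i₁ j : ι) (t₀ : Fin N)
    (ζ : Fin N → ι → ℝ) : ℝ :=
  if j = i₁ then 0 else mixedMoment P j (spikeIndex i₁ j t₀) *
    ∏ t, correlate G (ζ t) (spikeIndex i₁ j t₀ t)

/-- Telescoping, replacing one factor at a time. -/
lemma abs_prod_sub_prod_le {α : Type*} (s : Finset α) {f g : α → ℝ} {B ε : ℝ} (hB : 1 ≤ B)
    (hε : 0 ≤ ε) (hf : ∀ t, |f t| ≤ B) (hg : ∀ t, |g t| ≤ B) (h : ∀ t, |f t - g t| ≤ ε) :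
    |∏ t ∈ s, f t - ∏ t ∈ s, g t| ≤ s.card * (B ^ s.card * ε) := by
  classical
  induction s using Finset.induction_on with
  | empty => simp
  | insert a s ha ih =>
    rw [Finset.prod_insert ha, Finset.prod_insert ha, Finset.card_insert_of_notMem ha]
    have h1 : f a * ∏ t ∈ s, f t - g a * ∏ t ∈ s, g t =
        f a * (∏ t ∈ s, f t - ∏ t ∈ s, g t) + (f a - g a) * ∏ t ∈ s, g t := by ring
    have h2 : |∏ t ∈ s, g t| ≤ B ^ s.card := by
      rw [Finset.abs_prod, ← Finset.prod_const]
      exact Finset.prod_le_prod (fun _ _ => abs_nonneg _) fun t _ => hg t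
    rw [h1]
    refine (abs_add_le _ _).trans ?_
    rw [abs_mul, abs_mul]
    calc |f a| * |∏ t ∈ s, f t - ∏ t ∈ s, g t| + |f a - g a| * |∏ t ∈ s, g t|
        ≤ B * (s.card * (B ^ s.card * ε)) + ε * (B * B ^ s.card) := by
          have h3 : B ^ s.card ≤ B * B ^ s.card := le_mul_of_one_le_left (by positivity) hB
          exact add_le_add (mul_le_mul (hf a) ih (abs_nonneg _) (by linarith))
            (mul_le_mul (h a) (h2.trans h3) (abs_nonneg _) hε)
      _ = _ := by push_cast; ring

variable {E : Type*} [NormedAddCommGroup E] [InnerProductSpace ℝ E] [CompleteSpace E] {a : ι → E}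
  {σ C q p : ℝ} {k r : ℕ} {P : Measure (ι → ℝ)}

lemma IsSparseSymmetric.integral_moment_eq (h : IsSparseSymmetric C q p k r P) (hC : 1 ≤ C)
    (ζ : Fin N → ι → ℝ) :
    ∫ x, (∏ t, inner ℝ (∑ i, ζ t i • a i) (∑ i, x i • a i)) • (∑ i, x i • a i) ∂P =
      ∑ j, (∑ φ : Fin N → ι, mixedMoment P j φ * ∏ t, correlate (gramEntry a) (ζ t) (φ t)) •
        a j := by
  have h1 : ∀ x : ι → ℝ,
      (∏ t, inner ℝ (∑ i, ζ t i • a i) (∑ i, x i • a i)) • (∑ i, x i • a i) =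
      ∑ j, (∑ φ : Fin N → ι, (x j * ∏ t, x (φ t)) *
        ∏ t, correlate (gramEntry a) (ζ t) (φ t)) • a j := by
    intro x
    have h2 : ∏ t, inner ℝ (∑ i, ζ t i • a i) (∑ i, x i • a i) =
        ∑ φ : Fin N → ι, (∏ t, x (φ t)) * ∏ t, correlate (gramEntry a) (ζ t) (φ t) := by
      have h3 : ∀ t, inner ℝ (∑ i, ζ t i • a i) (∑ i, x i • a i) =
          ∑ i, x i * correlate (gramEntry a) (ζ t) i := by
        intro t
        rw [inner_sum]
        exact Finset.sum_congr rfl fun i _ => by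
          rw [real_inner_smul_right, correlate_gramEntry]
      simp only [h3]
      rw [Finset.prod_univ_sum, Fintype.piFinset_univ]
      exact Finset.sum_congr rfl fun φ _ => Finset.prod_mul_distrib
    rw [h2, Finset.smul_sum]
    refine Finset.sum_congr rfl fun j _ => ?_
    rw [smul_smul, Finset.sum_mul]
    congr 1
    exact Finset.sum_congr rfl fun φ _ => by ring
  simp only [h1]
  have hi : ∀ j, Integrable (fun x : ι → ℝ => ∑ φ : Fin N → ι, (x j * ∏ t, x (φ t)) *
        ∏ t, correlate (gramEntry a) (ζ t) (φ t)) P := fun j =>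
    integrable_finsetSum _ fun φ _ => (h.integrable_monomial hC j φ).mul_const _
  rw [integral_finsetSum _ fun j _ => (hi j).smul_const _]
  refine Finset.sum_congr rfl fun j _ => ?_
  rw [integral_smul_const, integral_finsetSum _ fun φ _ =>
    (h.integrable_monomial hC j φ).mul_const _]
  simp only [integral_mul_const, mixedMoment]

lemma sum_moment_sub_eq (hN : 2 ≤ N) (i₁ : ι) (ζ : Fin N → ι → ℝ) (b : ℝ) :
    ∑ j, (∑ φ : Fin N → ι, mixedMoment P j φ * ∏ t, correlate (gramEntry a) (ζ t) (φ t)) • a j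
      - b • a i₁ =
    (mixedMoment P i₁ (fun _ : Fin N => i₁) * ∏ t, correlate (gramEntry a) (ζ t) i₁ - b) • a i₁ +
      ∑ j, tailCoeff P (gramEntry a) i₁ j ζ • a j +
      ∑ t₀, ∑ j, spikeCoeff P (gramEntry a) i₁ j t₀ ζ • a j := by
  have h1 : ∀ j, (∑ φ : Fin N → ι, mixedMoment P j φ *
      ∏ t, correlate (gramEntry a) (ζ t) (φ t)) • a j =
      (if j = i₁ then (mixedMoment P i₁ (fun _ : Fin N => i₁) *
        ∏ t, correlate (gramEntry a) (ζ t) i₁) • a i₁ else 0) +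
      tailCoeff P (gramEntry a) i₁ j ζ • a j +
      ∑ t₀, spikeCoeff P (gramEntry a) i₁ j t₀ ζ • a j := by
    intro j
    rw [sum_eq_const_add_spike_add_generic hN i₁ j, tailCoeff, genericCoeff, ← Finset.sum_smul]
    simp only [spikeCoeff]
    by_cases hj : j = i₁
    · subst hj
      simp only [if_true, add_zero, Finset.sum_const_zero, zero_smul, add_smul]
    · simp only [if_neg hj, zero_add, ← add_smul]
      congr 1; ring
  simp only [h1, Finset.sum_add_distrib, Finset.sum_ite_eq', Finset.mem_univ, if_true, sub_smul]
  rw [Finset.sum_comm (f := fun j t₀ => spikeCoeff P (gramEntry a) i₁ j t₀ ζ • a j)]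
  abel

lemma norm_sum_le_of_sq (hσ : ∀ v : ι → ℝ, ‖∑ i, v i • a i‖ ^ 2 ≤ σ ^ 2 * ∑ i, v i ^ 2)
    (hσ0 : 0 ≤ σ) {v : ι → ℝ} {θ : ℝ} (hθ : 0 ≤ θ) (hv : ∑ i, v i ^ 2 ≤ θ ^ 2) :
    ‖∑ i, v i • a i‖ ≤ σ * θ := by
  refine le_of_sq_le_sq ?_ (by positivity)
  rw [mul_pow]
  exact (hσ v).trans (mul_le_mul_of_nonneg_left hv (sq_nonneg _))

/-- Only the position `t₀` depends on `j`, through `⟨u_{t₀}, a_j⟩`. So the coefficient vector is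
dominated by a constant times `Aᵀu_{t₀}`; as `‖u_{t₀}‖² ≤ σ²C²k`, two more factors `σ`, from `Aᵀ`
and from recombining the columns, give the bound for every admissible `ζ`. -/
lemma IsSparseSymmetric.norm_spike_le (h : IsSparseSymmetric C q p k r P) (hC : 1 ≤ C)
    (hN : 2 ≤ N) (hr : 1 ≤ r) (hq : 0 ≤ q) (hp : 0 ≤ p) (hσ0 : 0 ≤ σ)
    (hσ : ∀ v : ι → ℝ, ‖∑ i, v i • a i‖ ^ 2 ≤ σ ^ 2 * ∑ i, v i ^ 2) {i₁ : ι} {t₀ : Fin N}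
    {ζ : Fin N → ι → ℝ} {B : ℝ} (hB : 1 ≤ B)
    (hg : ∀ t, |correlate (gramEntry a) (ζ t) i₁| ≤ B) (hζ : ∑ i, ζ t₀ i ^ 2 ≤ C ^ 2 * k) :
    ‖∑ j, spikeCoeff P (gramEntry a) i₁ j t₀ ζ • a j‖ ≤
      σ ^ 3 * (C ^ (N + 2) * q * p * B ^ N * √k) := by
  have hnt : Nontrivial (Fin N) := Fin.nontrivial_iff_two_le.2 hN
  have hsp : ∀ j, spikeCoeff P (gramEntry a) i₁ j t₀ ζ ^ 2 ≤
      (C ^ (N + 1) * q * p * B ^ N) ^ 2 * inner ℝ (∑ i, ζ t₀ i • a i) (a j) ^ 2 := by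
    intro j
    by_cases hj : j = i₁
    · simp only [spikeCoeff, if_pos hj]; rw [zero_pow two_ne_zero]; positivity
    · rw [spikeCoeff, if_neg hj, ← sq_abs, ← mul_pow]
      rw [abs_mul, Finset.abs_prod]
      rw [← sq_abs (_ * inner ℝ _ _), abs_mul]
      refine pow_le_pow_left₀ (by positivity) ?_ 2
      rw [abs_of_nonneg (by positivity : 0 ≤ C ^ (N + 1) * q * p * B ^ N), mul_assoc _ (B ^ N)]
      -- The only value besides `j` is `i₁`, attained because `N ≥ 2`; this yields exactly one
      -- factor `p`.
      have hset : (Finset.univ.image (spikeIndex i₁ j t₀)).erase j = {i₁} := by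
        ext b
        simp only [Finset.mem_erase, Finset.mem_image, Finset.mem_univ, true_and,
          Finset.mem_singleton]
        constructor
        · rintro ⟨hb, t, rfl⟩
          by_cases ht : t = t₀
          · rw [ht, spikeIndex_self] at hb; exact absurd rfl hb
          · exact spikeIndex_of_ne _ _ ht
        · rintro rfl
          obtain ⟨t, ht⟩ := exists_ne t₀
          exact ⟨Ne.symm hj, t, spikeIndex_of_ne _ _ ht⟩
      refine mul_le_mul ?_ ?_ (Finset.prod_nonneg fun _ _ => abs_nonneg _) (by positivity)
      · have := (h.isEvenWeight hC j).abs_le (spikeIndex i₁ j t₀) (by rw [hset]; simpa using hr)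
        rwa [hset, Finset.card_singleton, pow_one] at this
      · rw [← Finset.mul_prod_erase _ _ (Finset.mem_univ t₀), spikeIndex_self,
          correlate_gramEntry, mul_comm]
        refine mul_le_mul_of_nonneg_right ?_ (abs_nonneg _)
        calc _ ≤ ∏ _t ∈ Finset.univ.erase t₀, B := by
              refine Finset.prod_le_prod (fun _ _ => abs_nonneg _) fun t ht => ?_
              rw [spikeIndex_of_ne _ _ (Finset.ne_of_mem_erase ht)]; exact hg t
          _ ≤ B ^ N := by
              rw [Finset.prod_const]
              exact pow_le_pow_right₀ hB ((Finset.card_le_univ _).trans (by simp))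
  have hθ : ∑ j, spikeCoeff P (gramEntry a) i₁ j t₀ ζ ^ 2 ≤
      (C ^ (N + 1) * q * p * B ^ N * (σ ^ 2 * (C * √k))) ^ 2 := by
    refine (Finset.sum_le_sum fun j _ => hsp j).trans ?_
    rw [← Finset.mul_sum, mul_pow _ (σ ^ 2 * _)]
    refine mul_le_mul_of_nonneg_left ?_ (sq_nonneg _)
    calc _ ≤ σ ^ 2 * ‖∑ i, ζ t₀ i • a i‖ ^ 2 := sum_inner_sq_le hσ _
      _ ≤ σ ^ 2 * (σ ^ 2 * (C ^ 2 * k)) := by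
          refine mul_le_mul_of_nonneg_left ((hσ _).trans ?_) (sq_nonneg _)
          exact mul_le_mul_of_nonneg_left hζ (sq_nonneg _)
      _ = _ := by rw [mul_pow, mul_pow, Real.sq_sqrt (Nat.cast_nonneg k)]; ring
  refine (norm_sum_le_of_sq hσ hσ0 (by positivity) hθ).trans (le_of_eq ?_)
  ring

end Decomposition

/-- Markov's inequality twice and a union bound. Only subadditivity is used, so `S` need not be
measurable. -/
lemma one_sub_le_measureReal {Ω : Type*} [MeasurableSpace Ω] {μ : Measure Ω}
    [IsProbabilityMeasure μ] {f g : Ω → ℝ} (hf0 : ∀ ω, 0 ≤ f ω) (hg0 : ∀ ω, 0 ≤ g ω)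
    (hf : Integrable f μ) (hg : Integrable g μ) {s t : ℝ} (hs : 0 < s) (ht : 0 < t) {S : Set Ω}
    (hS : ∀ᵐ ω ∂μ, f ω < s → g ω < t → ω ∈ S) :
    1 - (∫ ω, f ω ∂μ) / s - (∫ ω, g ω ∂μ) / t ≤ μ.real S := by
  have h1 := mul_meas_ge_le_integral_of_nonneg (Filter.Eventually.of_forall hf0) hf s
  have h2 := mul_meas_ge_le_integral_of_nonneg (Filter.Eventually.of_forall hg0) hg t
  have h3 : μ.real {ω | s ≤ f ω} ≤ (∫ ω, f ω ∂μ) / s := by rw [le_div_iff₀ hs]; linarith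
  have h4 : μ.real {ω | t ≤ g ω} ≤ (∫ ω, g ω ∂μ) / t := by rw [le_div_iff₀ ht]; linarith
  have h5 : (1 : ℝ) ≤ μ.real S + (μ.real {ω | s ≤ f ω} + μ.real {ω | t ≤ g ω}) := by
    calc (1 : ℝ) = μ.real Set.univ := by simp
      _ ≤ μ.real (S ∪ ({ω | s ≤ f ω} ∪ {ω | t ≤ g ω})) := by
          refine ENNReal.toReal_mono (measure_ne_top _ _) (measure_mono_ae ?_)
          refine (?_ : ∀ᵐ ω ∂μ, ω ∈ Set.univ → ω ∈ S ∪ ({ω | s ≤ f ω} ∪ {ω | t ≤ g ω}))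
          filter_upwards [hS] with ω hω
          intro _
          simp only [Set.mem_union, Set.mem_ofPred_eq]
          by_contra! hn
          exact hn.1 (hω hn.2.1 hn.2.2)
      _ ≤ _ := (measureReal_union_le _ _).trans
          (add_le_add_right (measureReal_union_le _ _) _)
  linarith

/-! ### Expected size of the tail coefficients and of the interference -/

section Tail

variable {ι : Type*} [DecidableEq ι] [Fintype ι] {N : ℕ}
  {C q p : ℝ} {k r : ℕ} {P : Measure (ι → ℝ)}

/-- An integrable upper bound for the sum of squares of the tail coefficients. -/
def tailBound (P : Measure (ι → ℝ)) (G : ι → ι → ℝ) (i₁ : ι) (ζ : Fin N → ι → ℝ) : ℝ :=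
  ∑ j, (2 * genericCoeff (mixedMoment P j) G i₁ j ζ ^ 2 + 2 * if j = i₁ then 0 else
    (mixedMoment P j (fun _ : Fin N => j) * ∏ t, correlate G (ζ t) j) ^ 2)

lemma sum_tailCoeff_sq_le (G : ι → ι → ℝ) (i₁ : ι) (ζ : Fin N → ι → ℝ) :
    ∑ j, tailCoeff P G i₁ j ζ ^ 2 ≤ tailBound P G i₁ ζ := by
  refine Finset.sum_le_sum fun j _ => ?_
  rw [tailCoeff]
  split_ifs with h
  · nlinarith [sq_nonneg (genericCoeff (mixedMoment P j) G i₁ j ζ)]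
  · nlinarith [sq_nonneg (genericCoeff (mixedMoment P j) G i₁ j ζ -
      mixedMoment P j (fun _ : Fin N => j) * ∏ t, correlate G (ζ t) j)]

lemma tailBound_nonneg (G : ι → ι → ℝ) (i₁ : ι) (ζ : Fin N → ι → ℝ) : 0 ≤ tailBound P G i₁ ζ :=
  (Finset.sum_nonneg fun _ _ => sq_nonneg _).trans (sum_tailCoeff_sq_le G i₁ ζ)

lemma IsSparseSymmetric.integrable_const_sq (h : IsSparseSymmetric C q p k r P) (hC : 1 ≤ C)
    (hq : 0 < q) (G : ι → ι → ℝ) (i₁ j : ι) (w : ℝ) :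
    Integrable (fun ζ : Fin N → ι → ℝ => if j = i₁ then 0 else
      (w * ∏ t, correlate G (ζ t) j) ^ 2) (Measure.pi fun _ : Fin N => condPos P i₁) := by
  have := h.prob_condPos hq i₁
  split_ifs
  · exact integrable_const _
  · simpa using h.integrable_sq_sum (N := N) hC hq G i₁ {fun _ => j} (fun _ => w)

lemma IsSparseSymmetric.integral_const_sq (h : IsSparseSymmetric C q p k r P) (hC : 1 ≤ C)
    (hq : 0 < q) (G : ι → ι → ℝ) (i₁ j : ι) (w : ℝ) :
    ∫ ζ : Fin N → ι → ℝ, (if j = i₁ then 0 else (w * ∏ t, correlate G (ζ t) j) ^ 2)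
      ∂(Measure.pi fun _ : Fin N => condPos P i₁) =
      if j = i₁ then 0 else w ^ 2 * weightedGram G (condSecondMoment P i₁) j j ^ N := by
  split_ifs
  · simp
  · have := h.integral_sq_sum (N := N) hC hq G i₁ {fun _ => j} (fun _ => w)
    simpa [sq w] using this

lemma IsSparseSymmetric.integrable_tailBound (h : IsSparseSymmetric C q p k r P) (hC : 1 ≤ C)
    (hq : 0 < q) (G : ι → ι → ℝ) (i₁ : ι) :
    Integrable (tailBound (N := N) P G i₁) (Measure.pi fun _ : Fin N => condPos P i₁) :=
  integrable_finsetSum _ fun j _ => ((h.integrable_genericCoeff_sq hC hq _ G i₁ j).const_mul _).add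
    ((h.integrable_const_sq hC hq G i₁ j _).const_mul _)

/-- Sums the bounds over `j`. Only `Q_{i₁i₁}` needs the bound `M`; every other diagonal entry is at
most `δ`, so higher powers reduce to the trace bound `T`. -/
lemma IsSparseSymmetric.integral_tailBound_le (h : IsSparseSymmetric C q p k r P) (hC : 1 ≤ C)
    (hq : 0 < q) {G : ι → ι → ℝ} {i₁ : ι} {Q : ι → ι → ℝ}
    (hQ : Q = weightedGram G (condSecondMoment P i₁)) {M δ ρ T : ℝ}
    (hN : N = 2 * r + 1) (hr : 2 ≤ r) (hM : 1 ≤ M) (hδ0 : 0 ≤ δ) (hδ1 : δ ≤ 1)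
    (hQM : ∀ i i', |Q i i'| ≤ M) (hQδ : ∀ i i', i ≠ i₁ → i' ≠ i₁ → |Q i i'| ≤ δ)
    (hQ0 : ∀ j, 0 ≤ Q j j) (hρ : p ^ 2 * ∑ i, ∑ i', Q i i' ^ 2 ≤ ρ) (hρ1 : ρ ≤ 1)
    (hT : ∑ j, Q j j ≤ T) :
    ∫ ζ, tailBound P G i₁ ζ ∂(Measure.pi fun _ : Fin N => condPos P i₁) ≤
      2 * ((patternCount N : ℝ) ^ 2 * M ^ (N * (N + 1)) + 1) * (C ^ (N + 1) * q) ^ 2 *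
        (ρ ^ 2 * T + ρ * (M ^ 3 + 2 * δ ^ 2 * T) + δ ^ 3 * T) := by
  set F := p ^ 2 * ∑ i, ∑ i', Q i i' ^ 2 with hF
  have hF0 : 0 ≤ F := mul_nonneg (sq_nonneg _)
    (Finset.sum_nonneg fun _ _ => Finset.sum_nonneg fun _ _ => sq_nonneg _)
  set W := C ^ (N + 1) * q with hW
  set K := (patternCount N : ℝ) ^ 2 * M ^ (N * (N + 1)) with hK
  have hK0 : 0 ≤ K := by positivity
  have hg : ∀ j, ∫ ζ, genericCoeff (mixedMoment P j) G i₁ j ζ ^ 2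
        ∂(Measure.pi fun _ : Fin N => condPos P i₁) ≤
      K * W ^ 2 * (ρ ^ 2 * Q j j + ρ * Q j j ^ 3 + ρ * δ ^ 2 * Q j j) := by
    intro j
    refine (h.integral_genericCoeff_sq_le hC hq hQ hN hr hM hδ0 hδ1 hQM hQδ (hQ0 j)
      (hρ.trans hρ1)).trans ?_
    have h0 := hQ0 j
    calc _ = K * W ^ 2 * (F ^ 2 * Q j j + F * Q j j ^ 3 + F * δ ^ 2 * Q j j) := by
          rw [hK, hW, hF]; ring
      _ ≤ _ := by gcongr
  have hc : ∀ j, ∫ ζ : Fin N → ι → ℝ, (if j = i₁ then 0 else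
      (mixedMoment P j (fun _ : Fin N => j) * ∏ t, correlate G (ζ t) j) ^ 2)
      ∂(Measure.pi fun _ : Fin N => condPos P i₁) ≤ W ^ 2 * (δ ^ 3 * Q j j) := by
    intro j
    rw [h.integral_const_sq hC hq, ← hQ]
    have h0 := hQ0 j
    split_ifs with hj
    · positivity
    · have hcard : ((Finset.univ.image fun _ : Fin N => j).erase j).card = 0 := by
        rw [Finset.card_eq_zero, Finset.erase_eq_empty_iff]
        have hne : (Finset.univ : Finset (Fin N)).Nonempty := ⟨⟨0, by omega⟩, Finset.mem_univ _⟩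
        exact Or.inr (Finset.image_const hne j)
      have hw := (h.isEvenWeight hC j).abs_le (fun _ : Fin N => j) (by rw [hcard]; omega)
      rw [hcard, pow_zero, mul_one] at hw
      refine mul_le_mul ?_ ?_ (by positivity) (by positivity)
      · rw [← sq_abs]; exact pow_le_pow_left₀ (abs_nonneg _) hw 2
      · have h1 : Q j j ≤ δ := (le_abs_self _).trans (hQδ j j hj hj)
        -- Of the `N ≥ 5` factors `Q j j`, one is kept for the trace; the others are at most `δ` and
        -- give at least `δ³`.
        obtain ⟨d, hd⟩ : ∃ d, N = d + 1 := ⟨2 * r, hN⟩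
        rw [hd, pow_succ]
        refine mul_le_mul_of_nonneg_right ?_ h0
        exact (pow_le_pow_left₀ h0 h1 d).trans (pow_le_pow_of_le_one hδ0 hδ1 (by omega))
  have hcube : ∑ j, Q j j ^ 3 ≤ M ^ 3 + δ ^ 2 * ∑ j, Q j j := by
    have h1 : ∀ j, Q j j ^ 3 ≤ (if j = i₁ then M ^ 3 else 0) + δ ^ 2 * Q j j := by
      intro j
      have h0 := hQ0 j
      split_ifs with hj
      · have := pow_le_pow_left₀ h0 ((le_abs_self _).trans (hQM j j)) 3
        nlinarith [mul_nonneg (sq_nonneg δ) h0]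
      · have h1 : Q j j ≤ δ := (le_abs_self _).trans (hQδ j j hj hj)
        have := mul_le_mul_of_nonneg_right (pow_le_pow_left₀ h0 h1 2) h0
        linarith [this, pow_succ (Q j j) 2]
    refine (Finset.sum_le_sum fun j _ => h1 j).trans (le_of_eq ?_)
    rw [Finset.sum_add_distrib, Finset.mul_sum]; simp
  have hT0 : 0 ≤ ∑ j, Q j j := Finset.sum_nonneg fun j _ => hQ0 j
  have hTT : 0 ≤ T := hT0.trans hT
  have hρ0 : 0 ≤ ρ := hF0.trans hρ
  have hi1 := fun j => h.integrable_genericCoeff_sq hC hq (mixedMoment (N := N) P j) G i₁ j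
  have hi2 := fun j => h.integrable_const_sq (N := N) hC hq G i₁ j (mixedMoment P j fun _ : Fin N => j)
  simp only [tailBound]
  have hi3 : ∀ j, Integrable (fun ζ : Fin N → ι → ℝ =>
      2 * genericCoeff (mixedMoment P j) G i₁ j ζ ^ 2 + 2 * if j = i₁ then 0 else
        (mixedMoment P j (fun _ : Fin N => j) * ∏ t, correlate G (ζ t) j) ^ 2)
      (Measure.pi fun _ : Fin N => condPos P i₁) := fun j =>
    ((hi1 j).const_mul _).add ((hi2 j).const_mul _)
  rw [integral_finsetSum _ fun j _ => hi3 j]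
  calc _ ≤ ∑ j, (2 * (K * W ^ 2 * (ρ ^ 2 * Q j j + ρ * Q j j ^ 3 + ρ * δ ^ 2 * Q j j)) +
        2 * (W ^ 2 * (δ ^ 3 * Q j j))) := by
        refine Finset.sum_le_sum fun j _ => ?_
        rw [integral_add ((hi1 j).const_mul _) ((hi2 j).const_mul _), integral_const_mul,
          integral_const_mul]
        exact add_le_add (mul_le_mul_of_nonneg_left (hg j) zero_le_two)
          (mul_le_mul_of_nonneg_left (hc j) zero_le_two)
    _ = 2 * (K * W ^ 2 * (ρ ^ 2 * ∑ j, Q j j + ρ * ∑ j, Q j j ^ 3 + ρ * δ ^ 2 * ∑ j, Q j j)) +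
        2 * (W ^ 2 * (δ ^ 3 * ∑ j, Q j j)) := by
        simp only [Finset.mul_sum, ← Finset.sum_add_distrib]
    _ ≤ 2 * (K * W ^ 2 * (ρ ^ 2 * T + ρ * (M ^ 3 + δ ^ 2 * T) + ρ * δ ^ 2 * T)) +
        2 * (W ^ 2 * (δ ^ 3 * T)) := by
        have := hcube.trans (add_le_add_right (mul_le_mul_of_nonneg_left hT (sq_nonneg δ)) (M ^ 3))
        gcongr
    _ ≤ _ := by
        have e1 : 0 ≤ W ^ 2 * (ρ ^ 2 * T + ρ * (M ^ 3 + 2 * δ ^ 2 * T)) := by positivity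
        have e2 : 0 ≤ K * (W ^ 2 * (δ ^ 3 * T)) := by positivity
        nlinarith [e1, e2]

/-- The sum over the samples of the squared interference in coordinate `i₁`. -/
def noiseBound (G : ι → ι → ℝ) (i₁ : ι) (ζ : Fin N → ι → ℝ) : ℝ :=
  ∑ t, correlate (fun b i => if b = i then 0 else G b i) (ζ t) i₁ ^ 2

lemma correlate_offDiag {G : ι → ι → ℝ} {i : ι} (hG : G i i = 1) (x : ι → ℝ) :
    correlate (fun b i => if b = i then 0 else G b i) x i = correlate G x i - x i := by
  have : x i = ∑ b, if b = i then x i else 0 := by simp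
  conv_rhs => rw [this]
  rw [correlate, correlate, ← Finset.sum_sub_distrib]
  refine Finset.sum_congr rfl fun b _ => ?_
  split_ifs with hb
  · rw [hb, hG]; ring
  · ring

lemma IsSparseSymmetric.integrable_noiseBound (h : IsSparseSymmetric C q p k r P) (hC : 1 ≤ C)
    (hq : 0 < q) (G : ι → ι → ℝ) (i₁ : ι) :
    Integrable (noiseBound (N := N) G i₁) (Measure.pi fun _ : Fin N => condPos P i₁) := by
  have := h.prob_condPos hq i₁
  refine integrable_finsetSum _ fun t _ => ?_
  have h1 := h.integrable_correlate_mul hC hq (fun b i => if b = i then 0 else G b i) i₁ i₁ i₁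
  simp only [← sq] at h1
  exact (measurePreserving_eval (fun _ : Fin N => condPos P i₁) t).integrable_comp_of_integrable h1

/-- With the conditioned coordinate removed, every remaining weight is at most `C²p`, and a column
of `G` has squared length at most `σ²`. -/
lemma IsSparseSymmetric.integral_noiseBound_le (h : IsSparseSymmetric C q p k r P) (hC : 1 ≤ C)
    (hq : 0 < q) (hr : 1 ≤ r) (hp : 0 ≤ p) {G : ι → ι → ℝ} {i₁ : ι} {σ : ℝ}
    (hG : ∑ b, G b i₁ ^ 2 ≤ σ ^ 2) :
    ∫ ζ, noiseBound G i₁ ζ ∂(Measure.pi fun _ : Fin N => condPos P i₁) ≤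
      N * (C ^ 2 * p * σ ^ 2) := by
  have := h.prob_condPos hq i₁
  set G' : ι → ι → ℝ := fun b i => if b = i then 0 else G b i with hG'
  have h1 := h.integrable_correlate_mul hC hq G' i₁ i₁ i₁
  have h2 := h.integral_correlate_mul hC hq G' i₁ i₁ i₁
  simp only [← sq] at h1 h2
  have h3 : ∀ t : Fin N, ∫ ζ : Fin N → ι → ℝ, correlate G' (ζ t) i₁ ^ 2
      ∂(Measure.pi fun _ : Fin N => condPos P i₁) ≤ C ^ 2 * p * σ ^ 2 := by
    intro t
    have hmp := measurePreserving_eval (fun _ : Fin N => condPos P i₁) t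
    have h4 : ∫ ζ : Fin N → ι → ℝ, correlate G' (ζ t) i₁ ^ 2
      ∂(Measure.pi fun _ : Fin N => condPos P i₁) = ∫ x, correlate G' x i₁ ^ 2 ∂condPos P i₁ := by
      have := integral_map (μ := Measure.pi fun _ : Fin N => condPos P i₁)
        (f := fun x => correlate G' x i₁ ^ 2) hmp.measurable.aemeasurable
        (by rw [hmp.map_eq]; exact h1.aestronglyMeasurable)
      rw [hmp.map_eq] at this
      exact this.symm
    rw [h4, h2, weightedGram]
    calc _ ≤ ∑ b, C ^ 2 * p * G b i₁ ^ 2 := by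
          refine Finset.sum_le_sum fun b _ => ?_
          simp only [hG']
          split_ifs with hb
          · simp only [mul_zero]; positivity
          · rw [← sq]
            exact mul_le_mul_of_nonneg_right (h.condSecondMoment_le_of_ne hC hq hr hb)
              (sq_nonneg _)
      _ ≤ _ := by
          rw [← Finset.mul_sum]
          exact mul_le_mul_of_nonneg_left hG (by positivity)
  have h5 : ∀ t : Fin N, Integrable (fun ζ : Fin N → ι → ℝ => correlate G' (ζ t) i₁ ^ 2)
      (Measure.pi fun _ : Fin N => condPos P i₁) := fun t =>
    (measurePreserving_eval (fun _ : Fin N => condPos P i₁) t).integrable_comp_of_integrable h1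
  simp only [noiseBound]
  rw [integral_finsetSum _ fun t _ => h5 t]
  refine (Finset.sum_le_card_nsmul _ _ _ fun t _ => h3 t).trans (le_of_eq ?_)
  rw [nsmul_eq_mul, Finset.card_univ, Fintype.card_fin]

end Tail

/-! ### Error bound for samples with small interference and small tail -/

section Error

variable {ι : Type*} [DecidableEq ι] [Fintype ι] {N : ℕ}
  {C q p : ℝ} {k r : ℕ} {P : Measure (ι → ℝ)}
  {E : Type*} [NormedAddCommGroup E] [InnerProductSpace ℝ E] [CompleteSpace E] {a : ι → E} {σ : ℝ}

lemma IsSparseSymmetric.norm_error_le (h : IsSparseSymmetric C q p k r P) (hC : 1 ≤ C)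
    (hN : 2 ≤ N) (hr : 1 ≤ r) (hq : 0 ≤ q) (hp : 0 ≤ p) (hσ0 : 0 ≤ σ)
    (hσ : ∀ v : ι → ℝ, ‖∑ i, v i • a i‖ ^ 2 ≤ σ ^ 2 * ∑ i, v i ^ 2) (ha : ∀ i, ‖a i‖ = 1) {i₁ : ι}
    {ζ : Fin N → ι → ℝ} {ε θ : ℝ} (hε0 : 0 ≤ ε) (hε1 : ε ≤ 1) (hθ : 0 ≤ θ)
    (hval : ∀ t, |ζ t i₁| ≤ C) (hζ : ∀ t, ∑ i, ζ t i ^ 2 ≤ C ^ 2 * k)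
    (hnoise : noiseBound (gramEntry a) i₁ ζ < ε ^ 2)
    (htail : tailBound P (gramEntry a) i₁ ζ < θ ^ 2) :
    ‖∫ x, (∏ t, inner ℝ (∑ i, ζ t i • a i) (∑ i, x i • a i)) • (∑ i, x i • a i) ∂P -
      (mixedMoment P i₁ (fun _ : Fin N => i₁) * ∏ t, ζ t i₁) • a i₁‖ ≤
      C ^ (N + 1) * q * (N * ((C + 1) ^ N * ε)) + σ * θ +
        N * (σ ^ 3 * (C ^ (N + 2) * q * p * (C + 1) ^ N * √k)) := by
  have hgram : ∀ i, gramEntry a i i = 1 := fun i => by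
    rw [gramEntry, real_inner_self_eq_norm_sq, ha, one_pow]
  have hdiff : ∀ t, |correlate (gramEntry a) (ζ t) i₁ - ζ t i₁| ≤ ε := by
    intro t
    refine abs_le_of_sq_le_sq ?_ hε0
    rw [← correlate_offDiag (hgram i₁)]
    -- Bounding the sum over all samples makes every single correlation `ε`-close to `ζ t i₁`.
    exact (Finset.single_le_sum (f := fun t =>
      correlate (fun b i => if b = i then 0 else gramEntry a b i) (ζ t) i₁ ^ 2)
      (fun _ _ => sq_nonneg _) (Finset.mem_univ t)).trans hnoise.le
  have hg : ∀ t, |correlate (gramEntry a) (ζ t) i₁| ≤ C + 1 := by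
    intro t
    have h1 := abs_sub_abs_le_abs_sub (correlate (gramEntry a) (ζ t) i₁) (ζ t i₁)
    linarith [hdiff t, hval t]
  rw [h.integral_moment_eq hC, sum_moment_sub_eq hN]
  refine (norm_add₃_le).trans ?_
  refine add_le_add (add_le_add ?_ ?_) ?_
  · rw [norm_smul, ha, mul_one, ← mul_sub, Real.norm_eq_abs, abs_mul]
    refine mul_le_mul ?_ ?_ (abs_nonneg _) (by positivity)
    · have hcard : ((Finset.univ.image fun _ : Fin N => i₁).erase i₁).card = 0 := by
        rw [Finset.card_eq_zero, Finset.erase_eq_empty_iff]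
        have hne : (Finset.univ : Finset (Fin N)).Nonempty := ⟨⟨0, by omega⟩, Finset.mem_univ _⟩
        exact Or.inr (Finset.image_const hne i₁)
      have hw := (h.isEvenWeight hC i₁).abs_le (fun _ : Fin N => i₁) (by rw [hcard]; omega)
      rwa [hcard, pow_zero, mul_one] at hw
    · have := abs_prod_sub_prod_le (Finset.univ : Finset (Fin N)) (B := C + 1) (by linarith) hε0 hg
        (fun t => (hval t).trans (by linarith)) hdiff
      simpa using this
  · exact norm_sum_le_of_sq hσ hσ0 hθ ((sum_tailCoeff_sq_le _ _ _).trans htail.le)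
  · refine (norm_sum_le _ _).trans ?_
    refine (Finset.sum_le_card_nsmul _ _ _ fun t₀ _ => h.norm_spike_le hC hN hr hq hp hσ0 hσ
      (by linarith : (1 : ℝ) ≤ C + 1) hg (hζ t₀)).trans (le_of_eq ?_)
    rw [nsmul_eq_mul, Finset.card_univ, Fintype.card_fin]

end Error

/-! ### Operator norm of the dictionary -/

section Dictionary

variable {n m : ℕ} {A : Matrix (Fin n) (Fin m) ℝ} {σ : ℝ}

lemma dictSample_eq_toEuclideanLin (x : Fin m → ℝ) :
    dictSample A x = Matrix.toEuclideanLin A (WithLp.toLp 2 x) := by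
  ext r
  simp [dictSample, dictColumn, Matrix.toLpLin_apply, Matrix.mulVec, dotProduct, mul_comm]

lemma norm_dictSample_sq_le (hA : dictSpectralNorm A ≤ σ) (x : Fin m → ℝ) :
    ‖∑ i, x i • dictColumn A i‖ ^ 2 ≤ σ ^ 2 * ∑ i, x i ^ 2 := by
  have h1 : ‖dictSample A x‖ ≤ σ * ‖(WithLp.toLp 2 x : EuclideanSpace ℝ (Fin m))‖ := by
    rw [dictSample_eq_toEuclideanLin]
    exact ((LinearMap.toContinuousLinearMap (Matrix.toEuclideanLin A)).le_opNorm _).trans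
      (mul_le_mul_of_nonneg_right hA (norm_nonneg _))
  have h2 := pow_le_pow_left₀ (norm_nonneg _) h1 2
  rw [mul_pow, EuclideanSpace.norm_sq_eq (WithLp.toLp 2 x)] at h2
  simpa only [dictSample, Real.norm_eq_abs, sq_abs] using h2

lemma one_le_of_dictSpectralNorm_le {μ : ℝ} (hinc : IsIncoherent μ A)
    (hA : dictSpectralNorm A ≤ σ) (i : Fin m) : 1 ≤ σ := by
  have hσ0 : 0 ≤ σ := (norm_nonneg _).trans hA
  have h1 := norm_dictSample_sq_le hA (Pi.single i 1)
  have h2 : ∑ j, (Pi.single i 1 : Fin m → ℝ) j • dictColumn A j = dictColumn A i := by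
    rw [Finset.sum_eq_single i] <;> simp +contextual
  have h3 : ∑ j, (Pi.single i 1 : Fin m → ℝ) j ^ 2 = 1 := by
    rw [Finset.sum_eq_single i] <;> simp +contextual
  rw [h2, h3, hinc.1 i] at h1
  nlinarith

end Dictionary

/-! ### Almost sure bounds for the conditioned samples and the leading moment -/

section SampleFacts

variable {ι : Type*} [DecidableEq ι] [Fintype ι] {C q p : ℝ} {k r : ℕ} {P : Measure (ι → ℝ)}

lemma IsSparseSymmetric.ae_pi_condPos (h : IsSparseSymmetric C q p k r P) (hC : 1 ≤ C)
    (hq : 0 < q) (N : ℕ) (i₁ : ι) : ∀ᵐ ζ ∂(Measure.pi fun _ : Fin N => condPos P i₁), ∀ t,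
      (∀ i, |ζ t i| ≤ C) ∧ 1 ≤ ζ t i₁ ∧ ∑ i, ζ t i ^ 2 ≤ C ^ 2 * k := by
  have hprob := h.prob_condPos hq i₁
  have h1 : ∀ᵐ x ∂condPos P i₁,
      (∀ i, |x i| ≤ C) ∧ 1 ≤ x i₁ ∧ ∑ i, x i ^ 2 ≤ C ^ 2 * k := by
    have hpos : ∀ᵐ x ∂condPos P i₁, 0 < x i₁ := ae_cond_mem (measurableSet_pos i₁)
    filter_upwards [hpos, condPos_ae (h.ae_abs_le hC), condPos_ae h.range, condPos_ae h.sparse]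
      with x hx0 hxC hxr hxs
    refine ⟨hxC, ?_, ?_⟩
    · rcases hxr i₁ with h0 | h0
      · linarith
      · rw [abs_of_pos hx0] at h0; exact h0.1
    · calc ∑ i, x i ^ 2 = ∑ i ∈ Finset.univ.filter (fun i => x i ≠ 0), x i ^ 2 := by
            symm
            refine Finset.sum_filter_of_ne fun i _ hi h0 => hi (by rw [h0]; simp)
        _ ≤ (Finset.univ.filter fun i => x i ≠ 0).card • C ^ 2 := by
            refine Finset.sum_le_card_nsmul _ _ _ fun i _ => ?_
            rw [← sq_abs]; exact pow_le_pow_left₀ (abs_nonneg _) (hxC i) 2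
        _ ≤ C ^ 2 * k := by
            rw [nsmul_eq_mul, mul_comm]
            exact mul_le_mul_of_nonneg_left (by exact_mod_cast hxs) (sq_nonneg _)
  refine ae_all_iff.2 fun t => ?_
  exact (Measure.quasiMeasurePreserving_eval (fun _ : Fin N => condPos P i₁) t).ae h1

lemma mixedMoment_const (N : ℕ) (i : ι) :
    mixedMoment P i (fun _ : Fin N => i) = ∫ x, x i ^ (N + 1) ∂P := by
  simp [mixedMoment, pow_succ']

/-- An even power of a coordinate dominates the indicator of its support, as nonzero values are at
least 1 in absolute value. -/
lemma IsSparseSymmetric.le_moment (h : IsSparseSymmetric C q p k r P) (hC : 1 ≤ C) {N : ℕ}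
    (hN : Even (N + 1)) (i : ι) : q ≤ ∫ x, x i ^ (N + 1) ∂P := by
  have := h.prob
  have hm : MeasurableSet {x : ι → ℝ | x i ≠ 0} :=
    (measurableSet_eq_fun (measurable_pi_apply i) measurable_const).compl
  have h1 : ∫ x, {x : ι → ℝ | x i ≠ 0}.indicator (fun _ => (1 : ℝ)) x ∂P ≤
      ∫ x, x i ^ (N + 1) ∂P := by
    refine integral_mono_ae ((integrable_const _).indicator hm) ?_ ?_
    · simpa [pow_succ'] using h.integrable_monomial hC i (fun _ : Fin N => i)
    · filter_upwards [h.range] with x hx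
      by_cases hxS : x ∈ {x : ι → ℝ | x i ≠ 0}
      · rw [Set.indicator_of_mem hxS, ← hN.pow_abs]
        rcases hx i with h0 | h0
        · exact absurd h0 hxS
        · exact one_le_pow₀ h0.1
      · rw [Set.indicator_of_notMem hxS]; exact hN.pow_nonneg _
  rw [integral_indicator_const _ hm, h.marginal i, smul_eq_mul, mul_one] at h1
  exact h1

end SampleFacts

/-! ### A crude deterministic error bound, used for bounded `m` -/

section CrudeBound

variable {ι : Type*} [DecidableEq ι] [Fintype ι] {C q p : ℝ} {k r : ℕ} {P : Measure (ι → ℝ)}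
  {E : Type*} [NormedAddCommGroup E] [InnerProductSpace ℝ E] {a : ι → E}

lemma norm_combination_le (ha : ∀ i, ‖a i‖ = 1) {x : ι → ℝ} (hx : ∀ i, |x i| ≤ C) :
    ‖∑ i, x i • a i‖ ≤ Fintype.card ι * C := by
  refine (norm_sum_le _ _).trans ((Finset.sum_le_card_nsmul _ _ C fun i _ => ?_).trans (le_of_eq ?_))
  · rw [norm_smul, ha, mul_one]; exact hx i
  · rw [nsmul_eq_mul]; rfl

lemma IsSparseSymmetric.norm_error_le_crude (h : IsSparseSymmetric C q p k r P) (hC : 1 ≤ C)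
    (ha : ∀ i, ‖a i‖ = 1) {N : ℕ} (i₁ : ι) {ζ : Fin N → ι → ℝ} (hζ : ∀ t i, |ζ t i| ≤ C) :
    ‖∫ x, (∏ t, inner ℝ (∑ i, ζ t i • a i) (∑ i, x i • a i)) • (∑ i, x i • a i) ∂P -
      ((∫ x, x i₁ ^ (N + 1) ∂P) * ∏ t, ζ t i₁) • a i₁‖ ≤
      2 * (Fintype.card ι * C) ^ (2 * N + 1) := by
  have := h.prob
  set b : ℝ := Fintype.card ι * C with hb
  have hcard : (1 : ℝ) ≤ Fintype.card ι := by
    exact_mod_cast Fintype.card_pos_iff.2 ⟨i₁⟩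
  have hbC : C ≤ b := le_mul_of_one_le_left (by linarith) hcard
  have hb1 : 1 ≤ b := hC.trans hbC
  have h1 : ‖∫ x, (∏ t, inner ℝ (∑ i, ζ t i • a i) (∑ i, x i • a i)) • (∑ i, x i • a i) ∂P‖ ≤
      b ^ (2 * N + 1) := by
    have h2 := norm_integral_le_of_norm_le_const (μ := P) (C := b ^ (2 * N + 1))
      (f := fun x => (∏ t, inner ℝ (∑ i, ζ t i • a i) (∑ i, x i • a i)) • (∑ i, x i • a i)) (by
        filter_upwards [h.ae_abs_le hC] with x hx
        have hy := norm_combination_le ha hx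
        rw [norm_smul, Real.norm_eq_abs, Finset.abs_prod, pow_succ, pow_mul]
        refine mul_le_mul ?_ hy (norm_nonneg _) (by positivity)
        calc _ ≤ ∏ _t : Fin N, b ^ 2 := by
              refine Finset.prod_le_prod (fun _ _ => abs_nonneg _) fun t _ => ?_
              refine (abs_real_inner_le_norm _ _).trans ?_
              rw [sq]
              exact mul_le_mul (norm_combination_le ha (hζ t)) hy (norm_nonneg _) (by positivity)
          _ = _ := by simp)
    simpa using h2
  have h3 : ‖((∫ x, x i₁ ^ (N + 1) ∂P) * ∏ t, ζ t i₁) • a i₁‖ ≤ b ^ (2 * N + 1) := by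
    rw [norm_smul, ha, mul_one, norm_mul, Real.norm_eq_abs (∏ t, ζ t i₁), Finset.abs_prod]
    have h4 : ‖∫ x, x i₁ ^ (N + 1) ∂P‖ ≤ C ^ (N + 1) := by
      have h2 := norm_integral_le_of_norm_le_const (μ := P) (C := C ^ (N + 1))
        (f := fun x => x i₁ ^ (N + 1)) (by
          filter_upwards [h.ae_abs_le hC] with x hx
          rw [norm_pow]
          exact pow_le_pow_left₀ (norm_nonneg _) (hx i₁) _)
      simpa using h2
    have h5 : ∏ t, |ζ t i₁| ≤ C ^ N := by
      calc _ ≤ ∏ _t : Fin N, C :=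
            Finset.prod_le_prod (fun _ _ => abs_nonneg _) fun t _ => hζ t i₁
        _ = _ := by simp
    calc _ ≤ C ^ (N + 1) * C ^ N :=
          mul_le_mul h4 h5 (Finset.prod_nonneg fun _ _ => abs_nonneg _) (by positivity)
      _ = C ^ (2 * N + 1) := by ring
      _ ≤ _ := pow_le_pow_left₀ (by linarith) hbC _
  refine (norm_sub_le _ _).trans ?_
  linarith

end CrudeBound

/-! ### Inequalities between the parameters, with `h = n^{1/3}` and `s = τk` -/

section Parameters

variable {c₁ C σ μ h s ν l m : ℝ} {L : ℕ}

lemma pow_le_of_nuFactor_ge (hL : 8 ≤ L) (hσ : 1 ≤ σ) (hl : 1 ≤ l) (hcl : 1 ≤ c₁ * l)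
    (hc₁ : 0 < c₁) (hν : c₁ * (σ ^ 2 * l ^ 2) ^ (2 * L) ≤ ν) : σ ^ 16 ≤ ν := by
  refine le_trans ?_ hν
  have h1 : σ ^ 16 ≤ (σ ^ 2) ^ (2 * L) := by
    rw [← pow_mul]; exact pow_le_pow_right₀ hσ (by omega)
  have h2 : l ≤ (l ^ 2) ^ (2 * L) := by
    rw [← pow_mul]; exact le_self_pow₀ hl (by omega)
  rw [mul_pow]
  have h3 : (0 : ℝ) ≤ (σ ^ 2) ^ (2 * L) := by positivity
  calc σ ^ 16 ≤ 1 * (σ ^ 2) ^ (2 * L) := by linarith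
    _ ≤ (c₁ * (l ^ 2) ^ (2 * L)) * (σ ^ 2) ^ (2 * L) := by
        refine mul_le_mul_of_nonneg_right ?_ h3
        exact hcl.trans (mul_le_mul_of_nonneg_left h2 hc₁.le)
    _ = _ := by ring

/-- From `(νs)³ ≤ h⁶ ≤ m²` one gets `s^{3/2}/m ≤ ν^{-3/2}`, while `ν ≥ c₁ σ² l^{4L}`. The exponent
`6L = (3/2)·4L` is the limit imposed on `c`. -/
lemma spike_parameter_le (hL : 8 ≤ L) (hσ : 1 ≤ σ) (hl : 1 ≤ l) (hc₁ : 0 < c₁) (hh : 1 ≤ h)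
    (hm : h ^ 3 ≤ m) (hs : 1 ≤ s) (hsν : ν * s ≤ h ^ 2)
    (hν : c₁ * (σ ^ 2 * l ^ 2) ^ (2 * L) ≤ ν) {k : ℝ} (hk0 : 0 ≤ k) (hk : k ≤ s) :
    σ ^ 3 * (s / m) * √k ≤ 1 / √(c₁ ^ 3) / l ^ (6 * L) := by
  have hl0 : 0 < l := by linarith
  have hσ0 : 0 < σ := by linarith
  have hh0 : 0 < h := by linarith
  have hm0 : 0 < m := lt_of_lt_of_le (by positivity) hm
  have hν1 : c₁ * σ ^ 2 * l ^ (4 * L) ≤ ν := by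
    refine le_trans ?_ hν
    rw [mul_pow, mul_assoc, ← pow_mul, ← pow_mul, show 2 * (2 * L) = 4 * L by ring]
    refine mul_le_mul_of_nonneg_left ?_ hc₁.le
    exact mul_le_mul_of_nonneg_right (pow_le_pow_right₀ hσ (by omega)) (by positivity)
  have hν0 : 0 < ν := lt_of_lt_of_le (by positivity) hν1
  refine le_of_sq_le_sq ?_ (by positivity)
  have e1 : (σ ^ 3 * (s / m) * √k) ^ 2 = σ ^ 6 * (s ^ 2 * k) / m ^ 2 := by
    rw [mul_pow, Real.sq_sqrt hk0]; field_simp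
  have e2 : (1 / √(c₁ ^ 3) / l ^ (6 * L)) ^ 2 = 1 / (c₁ * l ^ (4 * L)) ^ 3 := by
    rw [div_pow, div_pow, Real.sq_sqrt (by positivity), mul_pow]
    rw [← pow_mul, ← pow_mul, show 6 * L * 2 = 4 * L * 3 by ring]
    field_simp
  rw [e1, e2, div_le_div_iff₀ (by positivity) (by positivity), one_mul]
  calc σ ^ 6 * (s ^ 2 * k) * (c₁ * l ^ (4 * L)) ^ 3
      = (c₁ * σ ^ 2 * l ^ (4 * L)) ^ 3 * (s ^ 2 * k) := by ring
    _ ≤ ν ^ 3 * (s ^ 2 * s) := by gcongr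
    _ = (ν * s) ^ 3 := by ring
    _ ≤ (h ^ 2) ^ 3 := pow_le_pow_left₀ (by positivity) hsν 3
    _ = (h ^ 3) ^ 2 := by ring
    _ ≤ m ^ 2 := pow_le_pow_left₀ (by positivity) hm 2

lemma sparsity_ratio_le (hh : 1 ≤ h) (hm : h ^ 3 ≤ m) (hν0 : 0 < ν) (hsν : ν * s ≤ h ^ 2) :
    s / m ≤ 1 / (h * ν) := by
  have hh0 : 0 < h := by linarith
  have hm0 : 0 < m := lt_of_lt_of_le (by positivity) hm
  rw [div_le_div_iff₀ hm0 (by positivity)]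
  nlinarith

/-- In the term from two free fibres all powers of `h` cancel, leaving `σ¹⁶/ν⁵`: this is what
requires `σ¹⁶ ≤ ν`, and its smallness comes from `ν` alone. The other terms keep a factor `1/h`. -/
lemma tail_parameter_le (hσ : 1 ≤ σ) (hC : 1 ≤ C) (hh : 1 ≤ h) (hσν : σ ^ 16 ≤ ν) :
    σ ^ 2 * ((4 * C ^ 4 * σ ^ 6 / (h * ν ^ 2)) ^ 2 * (2 * C ^ 2 * σ ^ 2 * h ^ 2 / ν) +
      4 * C ^ 4 * σ ^ 6 / (h * ν ^ 2) * ((2 * C ^ 2) ^ 3 +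
        2 * (2 * C ^ 2 * σ ^ 2 / (h * ν)) ^ 2 * (2 * C ^ 2 * σ ^ 2 * h ^ 2 / ν)) +
      (2 * C ^ 2 * σ ^ 2 / (h * ν)) ^ 3 * (2 * C ^ 2 * σ ^ 2 * h ^ 2 / ν)) ≤
    32 * C ^ 10 / ν ^ 4 + 112 * C ^ 10 / h := by
  have hν1 : 1 ≤ ν := (one_le_pow₀ hσ).trans hσν
  have hν0 : 0 < ν := by linarith
  have hσ0 : 0 < σ := by linarith
  have hh0 : 0 < h := by linarith
  have hC0 : 0 < C := by linarith
  have hσp : ∀ a b : ℕ, a ≤ 16 → 1 ≤ b → σ ^ a ≤ ν ^ b := fun a b ha hb =>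
    (pow_le_pow_right₀ hσ ha).trans (hσν.trans (le_self_pow₀ hν1 (by omega)))
  have e : σ ^ 2 * ((4 * C ^ 4 * σ ^ 6 / (h * ν ^ 2)) ^ 2 * (2 * C ^ 2 * σ ^ 2 * h ^ 2 / ν) +
      4 * C ^ 4 * σ ^ 6 / (h * ν ^ 2) * ((2 * C ^ 2) ^ 3 +
        2 * (2 * C ^ 2 * σ ^ 2 / (h * ν)) ^ 2 * (2 * C ^ 2 * σ ^ 2 * h ^ 2 / ν)) +
      (2 * C ^ 2 * σ ^ 2 / (h * ν)) ^ 3 * (2 * C ^ 2 * σ ^ 2 * h ^ 2 / ν)) =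
      32 * C ^ 10 / ν ^ 4 * (σ ^ 16 / ν) + 32 * C ^ 10 / h * (σ ^ 8 / ν ^ 2) +
      64 * C ^ 10 / h * (σ ^ 14 / ν ^ 5) + 16 * C ^ 8 / h * (σ ^ 10 / ν ^ 4) := by
    field_simp
    ring
  rw [e]
  have h1 : σ ^ 16 / ν ≤ 1 := (div_le_one hν0).2 hσν
  have h2 : σ ^ 8 / ν ^ 2 ≤ 1 := (div_le_one (by positivity)).2 (hσp _ _ (by norm_num) (by norm_num))
  have h3 : σ ^ 14 / ν ^ 5 ≤ 1 :=
    (div_le_one (by positivity)).2 (hσp _ _ (by norm_num) (by norm_num))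
  have h4 : σ ^ 10 / ν ^ 4 ≤ 1 :=
    (div_le_one (by positivity)).2 (hσp _ _ (by norm_num) (by norm_num))
  have h5 : C ^ 8 ≤ C ^ 10 := pow_le_pow_right₀ hC (by norm_num)
  calc _ ≤ 32 * C ^ 10 / ν ^ 4 * 1 + 32 * C ^ 10 / h * 1 + 64 * C ^ 10 / h * 1 +
        16 * C ^ 10 / h * 1 := by gcongr
    _ = _ := by ring

lemma pair_parameter_le (hσ : 1 ≤ σ) (hh : 1 ≤ h) (hm : h ^ 3 ≤ m) (hs : 1 ≤ s) (hν1 : 1 ≤ ν)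
    (hsν : ν * s ≤ h ^ 2) :
    (s / m) ^ 2 * ((C ^ 2) ^ 2 * (σ ^ 4 + 2 * (s / m) * σ ^ 6 + (s / m) ^ 2 * m * σ ^ 6)) ≤
      4 * C ^ 4 * σ ^ 6 / (h * ν ^ 2) := by
  have hν0 : 0 < ν := by linarith
  have hh0 : 0 < h := by linarith
  have hm0 : 0 < m := lt_of_lt_of_le (by positivity) hm
  have hp := sparsity_ratio_le hh hm hν0 hsν
  have hp0 : 0 ≤ s / m := by positivity
  have hhν : 1 ≤ h * ν := one_le_mul_of_one_le_of_one_le hh hν1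
  have hp1 : s / m ≤ 1 := hp.trans ((div_le_one (by positivity)).2 hhν)
  have hp2 : (s / m) ^ 2 ≤ 1 / (h * ν ^ 2) := by
    refine (pow_le_pow_left₀ hp0 hp 2).trans ?_
    rw [div_pow, one_pow, mul_pow]
    exact one_div_le_one_div_of_le (by positivity)
      (mul_le_mul_of_nonneg_right (le_self_pow₀ hh (by norm_num)) (by positivity))
  have hp4 : (s / m) ^ 2 * ((s / m) ^ 2 * m) ≤ 1 / (h * ν ^ 2) := by
    have e : (s / m) ^ 2 * ((s / m) ^ 2 * m) = s ^ 4 / m ^ 3 := by field_simp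
    rw [e, div_le_div_iff₀ (by positivity) (by positivity), one_mul]
    have h2 : ν ^ 2 ≤ ν ^ 4 := pow_le_pow_right₀ hν1 (by norm_num)
    calc s ^ 4 * (h * ν ^ 2) ≤ s ^ 4 * (h * ν ^ 4) := by gcongr
      _ = (ν * s) ^ 4 * h := by ring
      _ ≤ (h ^ 2) ^ 4 * h := by gcongr
      _ = (h ^ 3) ^ 3 := by ring
      _ ≤ m ^ 3 := pow_le_pow_left₀ (by positivity) hm 3
  have hσ4 : σ ^ 4 ≤ σ ^ 6 := pow_le_pow_right₀ hσ (by norm_num)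
  calc _ ≤ (s / m) ^ 2 * ((C ^ 2) ^ 2 * (σ ^ 6 + 2 * 1 * σ ^ 6 + (s / m) ^ 2 * m * σ ^ 6)) := by
        gcongr
    _ = C ^ 4 * σ ^ 6 * (3 * (s / m) ^ 2 + (s / m) ^ 2 * ((s / m) ^ 2 * m)) := by ring
    _ ≤ C ^ 4 * σ ^ 6 * (3 * (1 / (h * ν ^ 2)) + 1 / (h * ν ^ 2)) := by gcongr
    _ = _ := by ring

end Parameters

/-! ### Lower bounds for the factor `ν` -/

section NuFactor

variable {c₁ C σ μ : ℝ} {n m L : ℕ}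

lemma nuFactor_base_ge (hC : 1 ≤ C) (hμ : 1 ≤ μ) (hn : 1 ≤ n) (hm : 1 ≤ m)
    (hl : 1 ≤ Real.log m) :
    σ ^ 2 * Real.log m ^ 2 ≤
      C * (σ ^ 2 + μ * √((m : ℝ) / n)) * Real.log ((n : ℝ) / (1 / (m : ℝ))) ^ 2 ∧
    √((m : ℝ) / n) ≤
      C * (σ ^ 2 + μ * √((m : ℝ) / n)) * Real.log ((n : ℝ) / (1 / (m : ℝ))) ^ 2 := by
  have hn' : (1 : ℝ) ≤ n := by exact_mod_cast hn
  have hm' : (1 : ℝ) ≤ m := by exact_mod_cast hm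
  have hlog : Real.log m ≤ Real.log ((n : ℝ) / (1 / (m : ℝ))) := by
    refine Real.log_le_log (by linarith) ?_
    rw [div_div_eq_mul_div, div_one]
    nlinarith
  have hlog2 : Real.log m ^ 2 ≤ Real.log ((n : ℝ) / (1 / (m : ℝ))) ^ 2 :=
    pow_le_pow_left₀ (by linarith) hlog 2
  have h1 : 1 ≤ Real.log m ^ 2 := one_le_pow₀ hl
  have hs : 0 ≤ √((m : ℝ) / n) := Real.sqrt_nonneg _
  have hμs : √((m : ℝ) / n) ≤ μ * √((m : ℝ) / n) := le_mul_of_one_le_left hs hμ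
  have hσ : 0 ≤ σ ^ 2 := sq_nonneg _
  have hb : σ ^ 2 + √((m : ℝ) / n) ≤ C * (σ ^ 2 + μ * √((m : ℝ) / n)) :=
    (add_le_add_right hμs _).trans (le_mul_of_one_le_left (by linarith) hC)
  have hb0 : 0 ≤ C * (σ ^ 2 + μ * √((m : ℝ) / n)) := by linarith
  constructor
  · calc σ ^ 2 * Real.log m ^ 2 ≤ (C * (σ ^ 2 + μ * √((m : ℝ) / n))) * Real.log m ^ 2 :=
          mul_le_mul_of_nonneg_right (by linarith) (by positivity)
      _ ≤ _ := mul_le_mul_of_nonneg_left hlog2 hb0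
  · calc √((m : ℝ) / n) ≤ (C * (σ ^ 2 + μ * √((m : ℝ) / n))) * 1 := by linarith
      _ ≤ _ := mul_le_mul_of_nonneg_left (h1.trans hlog2) hb0

lemma nuFactor_ge (hC : 1 ≤ C) (hμ : 1 ≤ μ) (hn : 1 ≤ n) (hm : 1 ≤ m) (hl : 1 ≤ Real.log m)
    (hc₁ : 0 < c₁) :
    c₁ * (σ ^ 2 * Real.log m ^ 2) ^ (2 * L) ≤ nuFactor c₁ C σ μ n m (1 / (m : ℝ)) (2 * L) :=
  mul_le_mul_of_nonneg_left (pow_le_pow_left₀ (by positivity)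
    (nuFactor_base_ge hC hμ hn hm hl).1 _) hc₁.le

/-- Combined with `ν ≤ n^{2/3}`, this forces `n` to be polynomially large in `m`. -/
lemma ratio_le_nuFactor (hC : 1 ≤ C) (hμ : 1 ≤ μ) (hn : 1 ≤ n) (hnm : n ≤ m)
    (hl : 1 ≤ Real.log m) (hc₁ : 0 < c₁) (hL : 1 ≤ L) :
    c₁ * ((m : ℝ) / n) ≤ nuFactor c₁ C σ μ n m (1 / (m : ℝ)) (2 * L) := by
  have hn0 : (0 : ℝ) < n := by exact_mod_cast hn
  have h1 : 1 ≤ (m : ℝ) / n := by rw [le_div_iff₀ hn0, one_mul]; exact_mod_cast hnm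
  refine mul_le_mul_of_nonneg_left ?_ hc₁.le
  calc (m : ℝ) / n ≤ ((m : ℝ) / n) ^ L := le_self_pow₀ h1 (by omega)
    _ = √((m : ℝ) / n) ^ (2 * L) := by rw [pow_mul, Real.sq_sqrt (by positivity)]
    _ ≤ _ := pow_le_pow_left₀ (Real.sqrt_nonneg _)
      (nuFactor_base_ge (σ := σ) hC hμ hn (hn.trans hnm) hl).2 _

end NuFactor

/-- For large `m`, polylogarithmic quantities are small compared with `m`. -/
lemma exists_threshold (L : ℕ) {c₁ κ B : ℝ} (hc₁ : 0 < c₁) (hκ : 0 < κ) :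
    ∃ m₀ : ℕ, ∀ m : ℕ, m₀ ≤ m → 1 ≤ Real.log m ∧ 1 ≤ c₁ * Real.log m ∧
      (L : ℝ) ≤ κ * Real.log m ∧ (B * Real.log m ^ (12 * L + 2)) ^ 5 ≤ c₁ * m := by
  have hlog : Filter.Tendsto (fun m : ℕ => Real.log m) Filter.atTop Filter.atTop :=
    Real.tendsto_log_atTop.comp tendsto_natCast_atTop_atTop
  have h1 := hlog.eventually_ge_atTop 1
  have h2 := (hlog.const_mul_atTop hc₁).eventually_ge_atTop 1
  have h3 := (hlog.const_mul_atTop hκ).eventually_ge_atTop (L : ℝ)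
  have h4 := tendsto_natCast_atTop_atTop.eventually
    ((Real.isLittleO_pow_log_id_atTop (n := (12 * L + 2) * 5)).bound
      (by positivity : 0 < c₁ / (|B| ^ 5 + 1)))
  obtain ⟨m₀, hm₀⟩ := Filter.eventually_atTop.1 (h1.and (h2.and (h3.and h4)))
  refine ⟨m₀, fun m hm => ?_⟩
  obtain ⟨e1, e2, e3, e4⟩ := hm₀ m hm
  refine ⟨e1, e2, e3, ?_⟩
  have hl0 : 0 ≤ Real.log m := by linarith
  rw [id, Real.norm_of_nonneg (by positivity), Real.norm_of_nonneg (Nat.cast_nonneg m)] at e4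
  have hB : B ^ 5 ≤ |B| ^ 5 + 1 := by
    have := le_abs_self (B ^ 5)
    rw [abs_pow] at this; linarith
  calc (B * Real.log m ^ (12 * L + 2)) ^ 5 = B ^ 5 * Real.log m ^ ((12 * L + 2) * 5) := by
        rw [mul_pow, ← pow_mul]
    _ ≤ (|B| ^ 5 + 1) * (c₁ / (|B| ^ 5 + 1) * m) := by
        exact mul_le_mul hB e4 (by positivity) (by positivity)
    _ = c₁ * m := by field_simp

/-! ### The error bound for large `m` -/

section Asymptotic

variable {n m : ℕ} {A : Matrix (Fin n) (Fin m) ℝ} {C c₁ q p σ μ s ν h l b : ℝ} {k L : ℕ}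
  {P : Measure (Fin m → ℝ)}

/-- The constant in the bound for the tail coefficients. -/
def tailConst (c₁ C : ℝ) (L : ℕ) : ℝ :=
  4 * ((patternCount (2 * L - 1) : ℝ) ^ 2 * (2 * C ^ 2) ^ ((2 * L - 1) * (2 * L - 1 + 1)) + 1) *
    C ^ (2 * (2 * L - 1 + 1)) * (32 * C ^ 10 / c₁ ^ 4 + 1)

/-- The constant in the error bound for large `m`. -/
def errorConst (c₁ C : ℝ) (L : ℕ) : ℝ :=
  C ^ (2 * L - 1 + 1) * ((2 * L - 1 : ℕ) * (C + 1) ^ (2 * L - 1)) + tailConst c₁ C L +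
    (2 * L - 1 : ℕ) * (C ^ (2 * L - 1 + 2) * (C + 1) ^ (2 * L - 1) * (1 / √(c₁ ^ 3)))

lemma one_le_tailConst (hC : 1 ≤ C) (hc₁ : 0 < c₁) : 1 ≤ tailConst c₁ C L := by
  have h1 : (1 : ℝ) ≤ (patternCount (2 * L - 1) : ℝ) ^ 2 *
      (2 * C ^ 2) ^ ((2 * L - 1) * (2 * L - 1 + 1)) + 1 := by
    have : (0 : ℝ) ≤ (patternCount (2 * L - 1) : ℝ) ^ 2 *
      (2 * C ^ 2) ^ ((2 * L - 1) * (2 * L - 1 + 1)) := by positivity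
    linarith
  have h2 : 1 ≤ C ^ (2 * (2 * L - 1 + 1)) := one_le_pow₀ hC
  have h3 : 1 ≤ 32 * C ^ 10 / c₁ ^ 4 + 1 := by
    have : 0 ≤ 32 * C ^ 10 / c₁ ^ 4 := by positivity
    linarith
  rw [tailConst]
  refine one_le_mul_of_one_le_of_one_le (one_le_mul_of_one_le_of_one_le ?_ h2) h3
  linarith

/-- A second moment bound for the tail coefficients under the sparsity assumption. -/
lemma integral_tailBound_le_of_parameters
    (hP : IsSparseSymmetric C q (s / m) k (L - 1) P) (hC : 1 ≤ C) (hq : 0 < q) (hL : 8 ≤ L)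
    (hinc : IsIncoherent μ A) (hA : dictSpectralNorm A ≤ σ) (i₁ : Fin m) (hσ : 1 ≤ σ)
    (hh : 1 ≤ h) (hhn : h ^ 3 = n) (hm : h ^ 3 ≤ m) (hs : 1 ≤ s)
    (hsν : ν * s * μ ^ 2 ≤ h ^ 2) (hμ : 1 ≤ μ) (hσν : σ ^ 16 ≤ ν)
    (hhC : 4 * C ^ 4 ≤ h) :
    σ ^ 2 * ∫ ζ, tailBound P (gramEntry (dictColumn A)) i₁ ζ
        ∂(Measure.pi fun _ : Fin (2 * L - 1) => condPos P i₁) ≤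
      2 * ((patternCount (2 * L - 1) : ℝ) ^ 2 *
        (2 * C ^ 2) ^ ((2 * L - 1) * (2 * L - 1 + 1)) + 1) *
        (C ^ (2 * L - 1 + 1) * q) ^ 2 * (32 * C ^ 10 / ν ^ 4 + 112 * C ^ 10 / h) := by
  set a := dictColumn A with ha_def
  set D := condSecondMoment P i₁ with hD_def
  have hν1 : 1 ≤ ν := (one_le_pow₀ hσ).trans hσν
  have hν0 : 0 < ν := by linarith
  have hh0 : 0 < h := by linarith
  have hm0 : (0 : ℝ) < m := lt_of_lt_of_le (by positivity) hm
  have hμ2 : 1 ≤ μ ^ 2 := one_le_pow₀ hμ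
  have hνs : ν * s ≤ h ^ 2 := (le_mul_of_one_le_right (by positivity) hμ2).trans hsν
  have hp0 : 0 ≤ s / m := by positivity
  have hp := sparsity_ratio_le hh hm hν0 hνs
  have ha : ∀ i, ‖a i‖ = 1 := hinc.1
  have hop : ∀ v : Fin m → ℝ, ‖∑ i, v i • a i‖ ^ 2 ≤ σ ^ 2 * ∑ i, v i ^ 2 :=
    norm_dictSample_sq_le hA
  have hD0 : ∀ i, 0 ≤ D i := fun i => condSecondMoment_nonneg i₁ i
  have hD1 : ∀ i, D i ≤ C ^ 2 := fun i => hP.condSecondMoment_le hC hq i₁ i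
  have hD : ∀ i, i ≠ i₁ → D i ≤ C ^ 2 * (s / m) := fun i hi =>
    hP.condSecondMoment_le_of_ne hC hq (by omega) hi
  have hc : 0 ≤ C ^ 2 := sq_nonneg C
  have hσ2ν : σ ^ 2 ≤ ν := (pow_le_pow_right₀ hσ (by norm_num)).trans hσν
  have hσ6ν : σ ^ 6 ≤ ν := (pow_le_pow_right₀ hσ (by norm_num)).trans hσν
  have hβ : s / m * σ ^ 2 ≤ σ ^ 2 / (h * ν) := by
    calc s / m * σ ^ 2 ≤ 1 / (h * ν) * σ ^ 2 := by gcongr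
      _ = _ := by ring
  have hβ1 : σ ^ 2 / (h * ν) ≤ 1 := by
    rw [div_le_one (by positivity)]
    exact hσ2ν.trans (le_mul_of_one_le_left hν0.le hh)
  -- As `s ≥ 1`, the sparsity assumption includes `νμ² ≤ h²`; dividing by `n = h³` brings the
  -- incoherence term to the same size as the bulk term.
  have hμn : μ ^ 2 / n ≤ σ ^ 2 / (h * ν) := by
    rw [← hhn, div_le_div_iff₀ (by positivity) (by positivity)]
    have h1 : ν * μ ^ 2 ≤ h ^ 2 := by
      refine le_trans ?_ hsν
      rw [mul_right_comm]; exact le_mul_of_one_le_right (by positivity) hs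
    have h2 : (1 : ℝ) ≤ σ ^ 2 := one_le_pow₀ hσ
    calc μ ^ 2 * (h * ν) = ν * μ ^ 2 * h := by ring
      _ ≤ h ^ 2 * h := by gcongr
      _ = 1 * h ^ 3 := by ring
      _ ≤ σ ^ 2 * h ^ 3 := by gcongr
  have hQd := weightedGram_self_le ha hop hD0 hc hp0 hD1 hD
  have hQa := abs_weightedGram_le ha hop hD0 hc hp0 hD1 hD
  have hgram1 : ∀ i, gramEntry a i₁ i ^ 2 ≤ 1 := by
    intro i
    rw [← sq_abs]
    refine pow_le_one₀ (abs_nonneg _) ((abs_real_inner_le_norm _ _).trans ?_)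
    rw [ha, ha, one_mul]
  have hgramμ : ∀ i, i ≠ i₁ → gramEntry a i₁ i ^ 2 ≤ μ ^ 2 / n := by
    intro i hi
    rw [← sq_abs]
    refine (pow_le_pow_left₀ (abs_nonneg _) (hinc.2 i₁ i hi.symm) 2).trans (le_of_eq ?_)
    rw [div_pow, Real.sq_sqrt (Nat.cast_nonneg n)]
  have hQM' : ∀ i, weightedGram (gramEntry a) D i i ≤ 2 * C ^ 2 := by
    intro i
    refine (hQd i).trans ?_
    have := hgram1 i
    nlinarith [hβ.trans hβ1]
  have hQδ' : ∀ i, i ≠ i₁ → weightedGram (gramEntry a) D i i ≤ 2 * C ^ 2 * σ ^ 2 / (h * ν) := by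
    intro i hi
    refine (hQd i).trans ?_
    have := (hgramμ i hi).trans hμn
    calc _ ≤ C ^ 2 * (σ ^ 2 / (h * ν) + σ ^ 2 / (h * ν)) := by gcongr
      _ = _ := by ring
  have hδ1 : 2 * C ^ 2 * σ ^ 2 / (h * ν) ≤ 1 := by
    rw [div_le_one (by positivity)]
    have h1 : 2 * C ^ 2 ≤ h := by nlinarith [one_le_pow₀ hC (n := 2), sq_nonneg (C ^ 2)]
    exact mul_le_mul h1 hσ2ν (by positivity) hh0.le
  have hρ1 : 4 * C ^ 4 * σ ^ 6 / (h * ν ^ 2) ≤ 1 := by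
    rw [div_le_one (by positivity)]
    exact mul_le_mul hhC (hσ6ν.trans (le_self_pow₀ hν1 (by norm_num))) (by positivity) hh0.le
  have hF := sum_weightedGram_sq_le ha hop hD0 hc hp0 hD1 hD
  rw [Fintype.card_fin] at hF
  have hρ : (s / m) ^ 2 * ∑ i, ∑ i', weightedGram (gramEntry a) D i i' ^ 2 ≤
      4 * C ^ 4 * σ ^ 6 / (h * ν ^ 2) :=
    (mul_le_mul_of_nonneg_left hF (sq_nonneg _)).trans (pair_parameter_le hσ hh hm hs hν1 hνs)
  have hT : ∑ i, weightedGram (gramEntry a) D i i ≤ 2 * C ^ 2 * σ ^ 2 * h ^ 2 / ν := by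
    refine (sum_weightedGram_self_le ha hop hD0 hc hp0 hD1 hD).trans ?_
    rw [Fintype.card_fin, div_mul_cancel₀ _ hm0.ne', le_div_iff₀ hν0]
    calc C ^ 2 * (1 + s) * σ ^ 2 * ν ≤ C ^ 2 * (s + s) * σ ^ 2 * ν := by gcongr
      _ = 2 * C ^ 2 * σ ^ 2 * (ν * s) := by ring
      _ ≤ _ := by gcongr
  have hmain := hP.integral_tailBound_le (N := 2 * L - 1) hC hq (G := gramEntry a) (i₁ := i₁) rfl
    (M := 2 * C ^ 2) (δ := 2 * C ^ 2 * σ ^ 2 / (h * ν)) (by omega) (by omega)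
    (by nlinarith [one_le_pow₀ hC (n := 2)]) (by positivity) hδ1
    (fun i i' => (hQa i i').trans (by linarith [hQM' i, hQM' i']))
    (fun i i' hi hi' => (hQa i i').trans (by linarith [hQδ' i hi, hQδ' i' hi']))
    (weightedGram_self_nonneg ha hop hD0 hc hp0 hD1 hD) hρ hρ1 hT
  refine (mul_le_mul_of_nonneg_left hmain (sq_nonneg σ)).trans ?_
  rw [mul_left_comm]
  exact mul_le_mul_of_nonneg_left (tail_parameter_le hσ hC hh hσν) (by positivity)

/-- The error bound in the range where `m` is large. -/
lemma one_sub_le_of_parameters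
    (hP : IsSparseSymmetric C q (s / m) k (L - 1) P) (hC : 1 ≤ C) (hq : 0 < q) (hL : 8 ≤ L)
    (hinc : IsIncoherent μ A) (hA : dictSpectralNorm A ≤ σ) (i₁ : Fin m) (hσ : 1 ≤ σ)
    (hh : 1 ≤ h) (hhn : h ^ 3 = n) (hm : h ^ 3 ≤ m) (hs : 1 ≤ s)
    (hsν : ν * s * μ ^ 2 ≤ h ^ 2) (hμ : 1 ≤ μ) (hks : (k : ℝ) ≤ s) (hc₁ : 0 < c₁) (hl : 1 ≤ l)
    (hcl : 1 ≤ c₁ * l) (hν : c₁ * (σ ^ 2 * l ^ 2) ^ (2 * L) ≤ ν)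
    (hhl : (112 * C ^ 10 + 2 * (2 * L - 1 : ℕ) * C ^ 2) * l ^ (12 * L + 2) ≤ h)
    (hb1 : 1 ≤ b) (hbl : b ≤ l ^ (6 * L)) {S : Set (Fin (2 * L - 1) → Fin m → ℝ)}
    (hS : ∀ ζ : Fin (2 * L - 1) → Fin m → ℝ, (∀ t, 1 ≤ ζ t i₁) →
      ‖∫ x, (∏ t, inner ℝ (∑ i, ζ t i • dictColumn A i) (∑ i, x i • dictColumn A i)) •
          (∑ i, x i • dictColumn A i) ∂P -
        (mixedMoment P i₁ (fun _ : Fin (2 * L - 1) => i₁) * ∏ t, ζ t i₁) • dictColumn A i₁‖ ≤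
        errorConst c₁ C L * (q / b) → ζ ∈ S) :
    1 - 1 / l ^ 2 ≤ (Measure.pi fun _ : Fin (2 * L - 1) => condPos P i₁).real S := by
  have hprob := hP.prob_condPos hq i₁
  have hσν := pow_le_of_nuFactor_ge hL hσ hl hcl hc₁ hν
  have hν1 : 1 ≤ ν := (one_le_pow₀ hσ).trans hσν
  have hν0 : 0 < ν := by linarith
  have hh0 : 0 < h := by linarith
  have hl0 : 0 < l := by linarith
  have hb0 : 0 < b := by linarith
  have hσ0 : 0 < σ := by linarith
  have hm0 : (0 : ℝ) < m := lt_of_lt_of_le (by positivity) hm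
  have hμ2 : 1 ≤ μ ^ 2 := one_le_pow₀ hμ
  have hνs : ν * s ≤ h ^ 2 := (le_mul_of_one_le_right (by positivity) hμ2).trans hsν
  have hp0 : 0 ≤ s / m := by positivity
  have hlp : 1 ≤ l ^ (12 * L + 2) := one_le_pow₀ hl
  have hC10 : C ^ 4 ≤ C ^ 10 := pow_le_pow_right₀ hC (by norm_num)
  have hC4 : (1 : ℝ) ≤ C ^ 4 := one_le_pow₀ hC
  have hN0 : (0 : ℝ) ≤ 2 * (2 * L - 1 : ℕ) * C ^ 2 := by positivity
  have hh112 : 112 * C ^ 10 * l ^ (12 * L + 2) ≤ h := by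
    refine le_trans ?_ hhl
    exact mul_le_mul_of_nonneg_right (by linarith) (by positivity)
  have hhN : 2 * (2 * L - 1 : ℕ) * C ^ 2 * l ^ (12 * L + 2) ≤ h := by
    refine le_trans ?_ hhl
    exact mul_le_mul_of_nonneg_right (by nlinarith) (by positivity)
  have hhC : 4 * C ^ 4 ≤ h := by
    refine le_trans ?_ hh112
    nlinarith
  have hb2 : b ^ 2 ≤ l ^ (12 * L) := by
    refine (pow_le_pow_left₀ hb0.le hbl 2).trans (le_of_eq ?_)
    rw [← pow_mul]; ring_nf
  have htail := integral_tailBound_le_of_parameters hP hC hq hL hinc hA i₁ hσ hh hhn hm hs hsν hμ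
    hσν hhC
  have hKt1 := one_le_tailConst (L := L) hC hc₁
  set K := tailConst c₁ C L with hK
  have hK0 : 0 < K := by linarith
  set E₁ := ∫ ζ, noiseBound (gramEntry (dictColumn A)) i₁ ζ
    ∂(Measure.pi fun _ : Fin (2 * L - 1) => condPos P i₁) with hE₁
  set E₂ := ∫ ζ, tailBound P (gramEntry (dictColumn A)) i₁ ζ
    ∂(Measure.pi fun _ : Fin (2 * L - 1) => condPos P i₁) with hE₂
  have hop : ∀ v : Fin m → ℝ, ‖∑ i, v i • dictColumn A i‖ ^ 2 ≤ σ ^ 2 * ∑ i, v i ^ 2 :=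
    norm_dictSample_sq_le hA
  have hnoise : E₁ ≤ (2 * L - 1 : ℕ) * (C ^ 2 * (s / m) * σ ^ 2) :=
    hP.integral_noiseBound_le hC hq (by omega) hp0 (sum_gramEntry_sq_le hinc.1 hop i₁)
  have hσ2ν : σ ^ 2 ≤ ν := (pow_le_pow_right₀ hσ (by norm_num)).trans hσν
  have hpσ : s / m * σ ^ 2 ≤ 1 / h := by
    calc s / m * σ ^ 2 ≤ 1 / (h * ν) * ν := by
          have := sparsity_ratio_le hh hm hν0 hνs
          gcongr
      _ = _ := by field_simp
  -- The exponent `12L + 2` in the assumption on `h` covers `b² ≤ l^{12L}` and the `l²` of the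
  -- failure probability.
  have hfail₁ : E₁ / (1 / b) ^ 2 ≤ 1 / (2 * l ^ 2) := by
    have e1 : E₁ / (1 / b) ^ 2 = E₁ * b ^ 2 := by field_simp
    rw [e1, le_div_iff₀ (by positivity)]
    calc E₁ * b ^ 2 * (2 * l ^ 2)
        ≤ ((2 * L - 1 : ℕ) * (C ^ 2 * (s / m) * σ ^ 2)) * l ^ (12 * L) * (2 * l ^ 2) := by gcongr
      _ = 2 * (2 * L - 1 : ℕ) * C ^ 2 * l ^ (12 * L + 2) * (s / m * σ ^ 2) := by ring
      _ ≤ h * (1 / h) := by gcongr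
      _ = 1 := by field_simp
  have hfail₂ : E₂ / (K * q / (σ * b)) ^ 2 ≤ 1 / (2 * l ^ 2) := by
    have e1 : E₂ / (K * q / (σ * b)) ^ 2 = (σ ^ 2 * E₂) * b ^ 2 / (K * q) ^ 2 := by field_simp
    have hν4 : 32 * C ^ 10 / ν ^ 4 ≤ 32 * C ^ 10 / c₁ ^ 4 / l ^ (12 * L + 2) := by
      rw [div_div]
      refine div_le_div_of_nonneg_left (by positivity) (by positivity) ?_
      have h1 : c₁ * l ^ (4 * L) ≤ ν := by
        refine le_trans ?_ hν
        rw [mul_pow, ← pow_mul, ← pow_mul, show 2 * (2 * L) = 4 * L by ring]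
        refine mul_le_mul_of_nonneg_left ?_ hc₁.le
        exact le_mul_of_one_le_left (by positivity) (one_le_pow₀ hσ)
      -- `ν⁴` carries `l^{16L}`, more than the `l^{12L + 2}` needed.
      calc c₁ ^ 4 * l ^ (12 * L + 2) ≤ c₁ ^ 4 * l ^ (4 * L * 4) := by
            refine mul_le_mul_of_nonneg_left (pow_le_pow_right₀ hl ?_) (by positivity)
            omega
        _ = (c₁ * l ^ (4 * L)) ^ 4 := by rw [mul_pow, ← pow_mul]
        _ ≤ ν ^ 4 := pow_le_pow_left₀ (by positivity) h1 4
    have hh4 : 112 * C ^ 10 / h ≤ 1 / l ^ (12 * L + 2) := by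
      rw [div_le_div_iff₀ hh0 (by positivity), one_mul]; exact hh112
    have hsum : 32 * C ^ 10 / ν ^ 4 + 112 * C ^ 10 / h ≤
        (32 * C ^ 10 / c₁ ^ 4 + 1) / l ^ (12 * L + 2) := by
      rw [add_div]; exact add_le_add hν4 hh4
    have h2 : σ ^ 2 * E₂ ≤ K * q ^ 2 / (2 * l ^ (12 * L + 2)) := by
      refine htail.trans ?_
      refine (mul_le_mul_of_nonneg_left hsum (by positivity)).trans (le_of_eq ?_)
      rw [hK, tailConst]
      field_simp
      ring
    rw [e1, div_le_div_iff₀ (by positivity) (by positivity), one_mul]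
    calc σ ^ 2 * E₂ * b ^ 2 * (2 * l ^ 2)
        ≤ (K * q ^ 2 / (2 * l ^ (12 * L + 2))) * l ^ (12 * L) * (2 * l ^ 2) := by gcongr
      _ = K * q ^ 2 := by rw [pow_add]; field_simp
      -- `K ≥ 1` permits `K` in the threshold where `√K` would do.
      _ ≤ (K * q) ^ 2 := by
          rw [mul_pow]
          exact mul_le_mul_of_nonneg_right (le_self_pow₀ hKt1 (by norm_num)) (sq_nonneg _)
  have hspike := spike_parameter_le hL hσ hl hc₁ hh hm hs hνs hν (Nat.cast_nonneg k) hks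
  have hmain := one_sub_le_measureReal (S := S)
    (μ := Measure.pi fun _ : Fin (2 * L - 1) => condPos P i₁)
    (f := noiseBound (gramEntry (dictColumn A)) i₁)
    (g := tailBound P (gramEntry (dictColumn A)) i₁)
    (fun ζ => Finset.sum_nonneg fun _ _ => sq_nonneg _) (fun ζ => tailBound_nonneg _ _ _)
    (hP.integrable_noiseBound hC hq _ i₁) (hP.integrable_tailBound hC hq _ i₁)
    -- The thresholds make the interference at most `1/b` and the tail, after the factor `σ` for
    -- recombining the columns, at most `Kq/b`.
    (s := (1 / b) ^ 2) (t := (K * q / (σ * b)) ^ 2) (by positivity) (by positivity) (by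
      filter_upwards [hP.ae_pi_condPos hC hq (2 * L - 1) i₁] with ζ hζ hf hg
      refine hS ζ (fun t => (hζ t).2.1) ?_
      refine (hP.norm_error_le hC (by omega) (by omega) hq.le hp0 hσ0.le hop hinc.1
        (by positivity) ((div_le_one hb0).2 hb1) (by positivity) (fun t => (hζ t).1 i₁)
        (fun t => (hζ t).2.2) hf hg).trans ?_
      have e1 : σ * (K * q / (σ * b)) = K * (q / b) := by field_simp
      have e2 : (σ ^ 3 * (C ^ (2 * L - 1 + 2) * q * (s / m) * (C + 1) ^ (2 * L - 1) * √k)) ≤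
          C ^ (2 * L - 1 + 2) * (C + 1) ^ (2 * L - 1) * (1 / √(c₁ ^ 3)) * (q / b) := by
        calc _ = C ^ (2 * L - 1 + 2) * (C + 1) ^ (2 * L - 1) * q * (σ ^ 3 * (s / m) * √k) := by ring
          _ ≤ C ^ (2 * L - 1 + 2) * (C + 1) ^ (2 * L - 1) * q * (1 / √(c₁ ^ 3) / b) := by
              refine mul_le_mul_of_nonneg_left (hspike.trans ?_) (by positivity)
              exact div_le_div_of_nonneg_left (by positivity) hb0 hbl
          _ = _ := by ring
      rw [e1, errorConst, ← hK, add_mul, add_mul]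
      refine add_le_add (add_le_add (le_of_eq (by ring)) le_rfl) ?_
      rw [mul_assoc (Nat.cast _) (C ^ _ * _ * _) (q / b)]
      exact mul_le_mul_of_nonneg_left e2 (Nat.cast_nonneg _))
  have : 1 / l ^ 2 = 1 / (2 * l ^ 2) + 1 / (2 * l ^ 2) := by field_simp; norm_num
  linarith

end Asymptotic

end

/-! ### The main theorem -/

theorem theorem6p2 (c : ℝ) (L : ℕ) (C c₁ κ : ℝ) (hc : 2 ≤ c) (hL : 8 ≤ L) (hcL : c ≤ 6 * (L : ℝ))
    (hC : 1 < C) (hc₁ : 0 < c₁) (hκ : 0 < κ) :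
    ∃ K : ℝ, 0 < K ∧
      ∀ (n m k : ℕ) (μ σ τ : ℝ) (A : Matrix (Fin n) (Fin m) ℝ)
        (Ds : Measure (Fin m → Bool)) (Dv : Measure ℝ) (i₁ : Fin m),
        n < m → 1 ≤ k → 1 ≤ μ → 1 ≤ τ →
        IsIncoherent μ A → dictSpectralNorm A ≤ σ →
        IsRandomSupport κ τ k Ds → IsValueDistribution C Dv →
        (k : ℝ) ≤ (n : ℝ) ^ (2 / 3 : ℝ) /
          (nuFactor c₁ C σ μ n m (1 / (m : ℝ)) (2 * L) * τ * μ ^ 2) →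
        1 - 1 / Real.log m ^ 2 ≤
          (sharedColumnLaw (2 * L - 1) Ds Dv i₁).real
            {ζ | supportMarginal Ds i₁ ≤ columnCoeff Ds Dv i₁ ζ ∧
              ∃ e : EuclideanSpace ℝ (Fin n),
                momentStatistic A Ds Dv ζ =
                  columnCoeff Ds Dv i₁ ζ • dictColumn A i₁ + e ∧
                ‖e‖ ≤ K * (supportMarginal Ds i₁ / Real.log m ^ c)} := by
  have hC1 : 1 ≤ C := hC.le
  obtain ⟨m₀, hm₀⟩ := exists_threshold L (B := 112 * C ^ 10 + 2 * (2 * L - 1 : ℕ) * C ^ 2) hc₁ hκ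
  set K₀ : ℝ := 2 * (m₀ * C) ^ (2 * (2 * L - 1) + 1) * (m₀ * Real.log m₀ ^ (6 * L)) with hK₀
  have hK₁ : 1 ≤ errorConst c₁ C L := by
    have h1 := one_le_tailConst (L := L) hC1 hc₁
    have h2 : 0 ≤ C ^ (2 * L - 1 + 1) * ((2 * L - 1 : ℕ) * (C + 1) ^ (2 * L - 1)) := by positivity
    have h3 : 0 ≤ (2 * L - 1 : ℕ) * (C ^ (2 * L - 1 + 2) * (C + 1) ^ (2 * L - 1) *
      (1 / √(c₁ ^ 3))) := by positivity
    rw [errorConst]; linarith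
  refine ⟨max (errorConst c₁ C L) K₀, lt_max_of_lt_left (by linarith), ?_⟩
  intro n m k μ σ τ A Ds Dv i₁ hnm hk hμ hτ hinc hA hDs hDv hkn
  have hmpos : 0 < m := by omega
  have hm1 : (1 : ℝ) ≤ m := by exact_mod_cast hmpos
  have hk1 : (1 : ℝ) ≤ k := by exact_mod_cast hk
  have hq0 : 0 < (k : ℝ) / m := by positivity
  have hmarg : supportMarginal Ds i₁ = (k : ℝ) / m := hDs.marginal i₁
  have hN : 2 * L - 1 + 1 = 2 * L := by omega
  have heven : Even (2 * L - 1 + 1) := by rw [hN]; exact even_two_mul L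
  -- With `r = 0` no lower bound on `κ log m` is needed, so this version serves every `m`.
  have hP₀ := sampleLaw_isSparseSymmetric (r := 0) hDs hDv (by linarith)
    (by simp only [Nat.cast_zero]; exact mul_nonneg hκ.le (Real.log_nonneg hm1))
  set P := sampleLaw Ds Dv with hPdef
  have hcoef : ∀ ζ : Fin (2 * L - 1) → Fin m → ℝ, (∀ t, 1 ≤ ζ t i₁) →
      (k : ℝ) / m ≤ columnCoeff Ds Dv i₁ ζ := by
    intro ζ hζ
    have h1 := hP₀.le_moment hC1 heven i₁
    have h2 : 1 ≤ ∏ t, ζ t i₁ := by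
      simpa using Finset.prod_le_prod (s := Finset.univ) (f := fun _ => (1 : ℝ))
        (g := fun t => ζ t i₁) (fun _ _ => zero_le_one) fun t _ => hζ t
    exact h1.trans (le_mul_of_one_le_right (hq0.le.trans h1) h2)
  rw [hmarg]
  rcases lt_or_ge (Real.log m) 1 with hl | hl
  · have hlog0 : 0 ≤ Real.log m := Real.log_nonneg hm1
    rcases hlog0.eq_or_lt with h0 | h0
    · have hm2 : 1 < m := by
        by_contra hcon
        have hm_eq : m = 1 := by omega
        have hn0 : n = 0 := by omega
        subst hn0
        rw [Nat.cast_zero, Real.zero_rpow (by norm_num), zero_div] at hkn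
        linarith
      have := Real.log_pos (by exact_mod_cast hm2 : (1 : ℝ) < m)
      linarith
    · have h1 : 1 ≤ 1 / Real.log m ^ 2 := by
        rw [le_div_iff₀ (by positivity), one_mul]
        exact pow_le_one₀ hlog0 hl.le
      exact (sub_nonpos.2 h1).trans measureReal_nonneg
  have hl0 : 0 < Real.log m := by linarith
  have hb1 : 1 ≤ Real.log m ^ c := Real.one_le_rpow hl (by linarith)
  have hbl : Real.log m ^ c ≤ Real.log m ^ (6 * L) := by
    rw [← Real.rpow_natCast]
    exact Real.rpow_le_rpow_of_exponent_le hl (by push_cast; exact hcL)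
  have hmem : ∀ (K : ℝ) (ζ : Fin (2 * L - 1) → Fin m → ℝ),
      K ≤ max (errorConst c₁ C L) K₀ → (∀ t, 1 ≤ ζ t i₁) →
      ‖momentStatistic A Ds Dv ζ - columnCoeff Ds Dv i₁ ζ • dictColumn A i₁‖ ≤
        K * ((k : ℝ) / m / Real.log m ^ c) →
      ζ ∈ {ζ : Fin (2 * L - 1) → Fin m → ℝ | (k : ℝ) / m ≤ columnCoeff Ds Dv i₁ ζ ∧
        ∃ e : EuclideanSpace ℝ (Fin n),
          momentStatistic A Ds Dv ζ = columnCoeff Ds Dv i₁ ζ • dictColumn A i₁ + e ∧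
          ‖e‖ ≤ max (errorConst c₁ C L) K₀ * ((k : ℝ) / m / Real.log m ^ c)} := by
    intro K ζ hK hζ he
    refine ⟨hcoef ζ hζ, _, (add_sub_cancel _ _).symm, he.trans ?_⟩
    exact mul_le_mul_of_nonneg_right hK (by positivity)
  rcases lt_or_ge m m₀ with hmm | hmm
  · have hmm' : (m : ℝ) ≤ m₀ := by exact_mod_cast hmm.le
    have hae := hP₀.ae_pi_condPos hC1 hq0 (2 * L - 1) i₁
    have hprob := hP₀.prob_condPos hq0 i₁
    have hone : (sharedColumnLaw (2 * L - 1) Ds Dv i₁).real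
        {ζ : Fin (2 * L - 1) → Fin m → ℝ | (k : ℝ) / m ≤ columnCoeff Ds Dv i₁ ζ ∧
        ∃ e : EuclideanSpace ℝ (Fin n),
          momentStatistic A Ds Dv ζ = columnCoeff Ds Dv i₁ ζ • dictColumn A i₁ + e ∧
          ‖e‖ ≤ max (errorConst c₁ C L) K₀ * ((k : ℝ) / m / Real.log m ^ c)} = 1 := by
      have h1 : ∀ᵐ ζ ∂(sharedColumnLaw (2 * L - 1) Ds Dv i₁), ζ ∈
          {ζ : Fin (2 * L - 1) → Fin m → ℝ | (k : ℝ) / m ≤ columnCoeff Ds Dv i₁ ζ ∧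
          ∃ e : EuclideanSpace ℝ (Fin n),
            momentStatistic A Ds Dv ζ = columnCoeff Ds Dv i₁ ζ • dictColumn A i₁ + e ∧
            ‖e‖ ≤ max (errorConst c₁ C L) K₀ * ((k : ℝ) / m / Real.log m ^ c)} := by
        filter_upwards [hae] with ζ hζ
        refine hmem K₀ ζ (le_max_right _ _) (fun t => (hζ t).2.1) ?_
        refine (hP₀.norm_error_le_crude hC1 hinc.1 i₁ fun t => (hζ t).1).trans ?_
        rw [Fintype.card_fin, hK₀, mul_assoc]
        have h2 : (m * C) ^ (2 * (2 * L - 1) + 1) ≤ (m₀ * C) ^ (2 * (2 * L - 1) + 1) := by gcongr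
        -- For `1 ≤ log m` and `m < m₀` the target `q / log^c m` is bounded below, so the crude
        -- bound fits into `K₀`.
        have h3 : 1 ≤ m₀ * Real.log m₀ ^ (6 * L) * ((k : ℝ) / m / Real.log m ^ c) := by
          have h4 : Real.log m ^ c ≤ Real.log m₀ ^ (6 * L) :=
            hbl.trans (pow_le_pow_left₀ hl0.le (Real.log_le_log (by linarith) hmm') _)
          have h5 : 1 ≤ m₀ * ((k : ℝ) / m) := by
            rw [← mul_div_assoc, le_div_iff₀ (by linarith)]; nlinarith
          have h6 : 1 ≤ Real.log m₀ ^ (6 * L) / Real.log m ^ c := by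
            rwa [le_div_iff₀ (by linarith), one_mul]
          calc (1 : ℝ) ≤ m₀ * ((k : ℝ) / m) * (Real.log m₀ ^ (6 * L) / Real.log m ^ c) :=
                one_le_mul_of_one_le_of_one_le h5 h6
            _ = _ := by ring
        have h7 : 0 ≤ (m₀ * C) ^ (2 * (2 * L - 1) + 1) := by positivity
        nlinarith
      have hprob' : IsProbabilityMeasure (sharedColumnLaw (2 * L - 1) Ds Dv i₁) :=
        inferInstanceAs (IsProbabilityMeasure
          (Measure.pi fun _ : Fin (2 * L - 1) => condPos P i₁))
      exact (measureReal_congr (Filter.eventuallyEq_set.2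
        (h1.mono fun ζ hζ => iff_of_true hζ (Set.mem_univ _)))).trans probReal_univ
    rw [hone]
    have : 0 ≤ 1 / Real.log m ^ 2 := by positivity
    linarith
  · obtain ⟨-, hcl, hLκ, hbig⟩ := hm₀ m hmm
    have hn1 : 1 ≤ n := by
      by_contra hcon
      have hn0 : n = 0 := by omega
      subst hn0
      rw [Nat.cast_zero, Real.zero_rpow (by norm_num), zero_div] at hkn
      linarith
    have hn1' : (1 : ℝ) ≤ n := by exact_mod_cast hn1
    have hP := sampleLaw_isSparseSymmetric (r := L - 1) hDs hDv (by linarith)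
      (le_trans (by exact_mod_cast Nat.sub_le L 1) hLκ)
    rw [← mul_div_assoc] at hP
    have hσ := one_le_of_dictSpectralNorm_le hinc hA i₁
    set h : ℝ := (n : ℝ) ^ (1 / 3 : ℝ) with hh
    have hh1 : 1 ≤ h := Real.one_le_rpow hn1' (by norm_num)
    have hh3 : h ^ 3 = n := by
      rw [hh, ← Real.rpow_natCast, ← Real.rpow_mul (by linarith)]; norm_num
    have hh2 : (n : ℝ) ^ (2 / 3 : ℝ) = h ^ 2 := by
      rw [hh, ← Real.rpow_natCast, ← Real.rpow_mul (by linarith)]; norm_num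
    have hnm' : (n : ℝ) ≤ m := by exact_mod_cast hnm.le
    have hν := nuFactor_ge (L := L) (σ := σ) hC1 hμ hn1 hmpos hl hc₁
    have hratio := ratio_le_nuFactor (σ := σ) hC1 hμ hn1 hnm.le hl hc₁ (by omega : 1 ≤ L)
    set ν := nuFactor c₁ C σ μ n m (1 / (m : ℝ)) (2 * L) with hνdef
    have hν0 : 0 < ν := lt_of_lt_of_le (by positivity) hν
    have hs1 : 1 ≤ τ * k := one_le_mul_of_one_le_of_one_le hτ hk1
    have hμ2 : 1 ≤ μ ^ 2 := one_le_pow₀ hμ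
    have hsν : ν * (τ * k) * μ ^ 2 ≤ h ^ 2 := by
      rw [hh2, le_div_iff₀ (by positivity)] at hkn
      linarith
    -- `c₁ m/n ≤ ν ≤ h²` and `n = h³`. With the choice of `m₀`, taking fifth roots shows that `h`
    -- exceeds the required power of `log m`.
    have hmh : c₁ * m ≤ h ^ 5 := by
      have h1 : ν ≤ h ^ 2 := by
        refine le_trans ?_ hsν
        rw [mul_assoc]
        exact le_mul_of_one_le_right hν0.le (one_le_mul_of_one_le_of_one_le hs1 hμ2)
      have h2 := hratio.trans h1
      rw [← mul_div_assoc, div_le_iff₀ (by linarith), ← hh3] at h2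
      linarith [show h ^ 2 * h ^ 3 = h ^ 5 by ring]
    have hhl := le_of_pow_le_pow_left₀ (by norm_num) (by linarith) (hbig.trans hmh)
    refine one_sub_le_of_parameters (P := P) hP hC1 hq0 hL hinc hA i₁ hσ hh1 hh3
      (hh3.le.trans hnm') hs1 hsν hμ (le_mul_of_one_le_left (by linarith) hτ) hc₁ hl hcl hν hhl
      hb1 hbl fun ζ hζ he => hmem _ ζ (le_max_left _ _) hζ ?_
    rw [mixedMoment_const] at he
    exact he
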